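/- Let $N=\mathbb Z^n$, $M=\operatorname{Hom}(N,\mathbb Z)$, $T=(\mathbb C^*)^n$, and let $X$ be the normal $T$-toric variety, in the classical topology, of a finite rational polyhedral fan $\Sigma$ in $N_{\mathbb R}=\mathbb R^n$ (a finite non-empty set of strongly convex rational polyhedral cones, closed under taking faces, any two of which meet in a common face). Thus $X$ is glued from the affine charts $U_\sigma=\operatorname{Hom}_{\mathrm{monoid}}(\sigma^\vee\cap M,\mathbb C)$, $\sigma\in\Sigma$. For $\sigma\in\Sigma$ let $x_\sigma\in U_\sigma$ be the distinguished point ($m\mapsto 1$ if $m\in\sigma^\perp$, $m\mapsto 0$ otherwise) and $O_\sigma=T\cdot x_\sigma$ the corresponding orbit. If $O_\sigma\subset\overline{O_\tau}$ (equivalently, $\tau$ is a face of $\sigma$), let $p_{\tau\sigma}\colon O_\tau\to O_\sigma$, $t\cdot x_\tau\mapsto t\cdot x_\sigma$, be the canonical projection; it is the restriction to $O_\tau$ of the canonical projection $U_\sigma\to O_\sigma$. Let $LC(X)$ be the full subcategory of the category of sheaves of complex vector spaces on $X$ that consists of the sheaves whose restriction to every orbit is locally constant. Let $\mathcal B$ be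 the ringed poset on the set of orbits, ordered by $O_\sigma\le O_\tau$ iff $O_\sigma\subset\overline{O_\tau}$, with $\mathcal B_\sigma=\mathbb C[\pi_1(O_\sigma,x_\sigma)]$ and with the ring homomorphisms $\mathcal B_\tau\to\mathcal B_\sigma$ induced by $p_{\tau\sigma}$ for $O_\sigma\le O_\tau$. A co-$\mathcal B$-module consists of a $\mathcal B_\sigma$-module $\mathcal M_\sigma$ for every $\sigma$ and of $\mathcal B_\tau$-linear maps $\varphi_{\sigma\tau}\colon\mathcal M_\sigma\to\mathcal M_\tau$ for $O_\sigma\le O_\tau$ ($\mathcal B_\tau$ acting on $\mathcal M_\sigma$ through $\mathcal B_\tau\to\mathcal B_\sigma$) with $\varphi_{\sigma\sigma}=\mathrm{id}$ and $\varphi_{\tau\rho}\varphi_{\sigma\tau}=\varphi_{\sigma\rho}$; morphisms are families of $\mathcal B_\sigma$-linear maps that commute with the maps $\varphi$. For $F\in LC(X)$ let $F_\sigma$ be the stalk of $F$ at $x_\sigma$, on which $\pi_1(O_\sigma,x_\sigma)$ acts by monodromy. For $O_\sigma\le O_\tau$ with $p=p_{\tau\sigma}$, the sheaf $F$ determines a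 morphism $F|_{O_\sigma}\to p_*(F|_{O_\tau})$: the germ at $x\in O_\sigma$ of a section $f$ of $F$ goes to the germ at $x$ of the section of $F|_{O_\tau}$ over $p^{-1}(V)$, $V$ a small neighbourhood of $x$ in $O_\sigma$, that coincides with $f$ on $O_\tau\cap W$ for some neighbourhood $W$ of $x$ in $X$. Taking the value at $x_\tau$ when $x=x_\sigma$ gives a map $F_\sigma\to F_\tau$. Theorem. With these actions and maps the stalks $F_\sigma$ form a co-$\mathcal B$-module, functorially in $F$, and the resulting functor $$\eta\colon LC(X)\to\text{co-}\mathcal B\text{-Mod}$$ is an equivalence of categories. -/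

import Mathlib

open CategoryTheory TopologicalSpace Opposite

/-! ### Ringed quivers and co-modules -/

/-- A ringed quiver on a poset `Γ` is a collection of rings `A_α` with compatible ring homomorphisms
`A_β → A_α` for `β ≥ α`, i.e. a functor `Γᵒᵖ ⥤ RingCat` (for the poset `Γ`, Mathlib has
exactly one morphism `α ⟶ β` when `α ≤ β`).

A co-`A`-module consists of an `A_α`-module `M_α` for every `α` and, for `α ≤ β`, a morphism
`M_α → M_β` of `A_β`-modules, where `A_β` acts on `M_α` through `A_β → A_α`. -/
structure CoModule {Γ : Type} [PartialOrder Γ] (A : Γᵒᵖ ⥤ RingCat.{0}) where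
  /-- the module at `α` -/
  obj : ∀ α : Γ, ModuleCat.{0} (A.obj (op α))
  /-- the structure maps -/
  map : ∀ {α β : Γ}, α ≤ β → (obj α →+ obj β)
  map_smul : ∀ {α β : Γ} (h : α ≤ β) (r : A.obj (op β)) (m : obj α),
    map h ((A.map (homOfLE h).op).hom r • m) = r • map h m
  map_id : ∀ (α : Γ) (m : obj α), map (le_refl α) m = m
  map_comp : ∀ {α β γ : Γ} (h : α ≤ β) (h' : β ≤ γ) (m : obj α),
    map h' (map h m) = map (h.trans h') m

namespace CoModule

variable {Γ : Type} [PartialOrder Γ] {A : Γᵒᵖ ⥤ RingCat.{0}}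

/-- A morphism of co-`A`-modules: `A_α`-linear maps commuting with the structure maps. -/
@[ext]
structure Hom (M N : CoModule A) where
  /-- the component at `α` -/
  app : ∀ α : Γ, M.obj α ⟶ N.obj α
  naturality : ∀ {α β : Γ} (h : α ≤ β) (m : M.obj α),
    (app β).hom (M.map h m) = N.map h ((app α).hom m)

instance : Category (CoModule A) where
  Hom M N := Hom M N
  id M := { app := fun α => 𝟙 (M.obj α), naturality := fun _ _ => rfl }
  comp f g :=
    { app := fun α => f.app α ≫ g.app α
      naturality := fun h m => by
        simp only [ModuleCat.hom_comp, LinearMap.comp_apply, f.naturality, g.naturality] }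

end CoModule

/-! ### Fans -/

/-- The pairing between the character lattice `M = ℤⁿ` and `N_ℝ = ℝⁿ`. -/
def latticePairing {n : ℕ} (m : Fin n → ℤ) (v : Fin n → ℝ) : ℝ := ∑ i, (m i : ℝ) * v i

/-- A finite rational polyhedral fan in `N_ℝ = ℝⁿ`, with respect to the lattice `N = ℤⁿ`. -/
structure Fan (n : ℕ) where
  /-- the cones of the fan -/
  cones : Set (PointedCone ℝ (Fin n → ℝ))
  finite : cones.Finite
  nonempty : cones.Nonempty
  rational : ∀ σ ∈ cones, ∃ S : Finset (Fin n → ℤ),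
    σ = PointedCone.hull ℝ ((fun (v : Fin n → ℤ) (i : Fin n) => (v i : ℝ)) '' (S : Set (Fin n → ℤ)))
  salient : ∀ σ ∈ cones, ∀ v ∈ σ, -v ∈ σ → v = 0
  face_mem : ∀ σ ∈ cones, ∀ τ : PointedCone ℝ (Fin n → ℝ), τ.IsFaceOf σ → τ ∈ cones
  inter_isFaceOf : ∀ σ ∈ cones, ∀ τ ∈ cones, (σ ⊓ τ).IsFaceOf σ

/-- The monoid `S_σ = σ^∨ ∩ M`. -/
def dualMonoid {n : ℕ} (σ : PointedCone ℝ (Fin n → ℝ)) : AddSubmonoid (Fin n → ℤ) where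
  carrier := {m | ∀ v ∈ σ, 0 ≤ latticePairing m v}
  zero_mem' := fun v _ => by simp [latticePairing]
  add_mem' := fun {a b} ha hb v hv => by
    have h := add_nonneg (ha v hv) (hb v hv)
    simpa [latticePairing, add_mul, Finset.sum_add_distrib] using h

theorem dualMonoid_anti {n : ℕ} {τ σ : PointedCone ℝ (Fin n → ℝ)} (h : τ ≤ σ) :
    dualMonoid σ ≤ dualMonoid τ :=
  fun _ hm v hv => hm v (h hv)

/-- `m ∈ σ^⊥`, i.e. the character `m` vanishes on `σ`. -/
def IsPerp {n : ℕ} (σ : PointedCone ℝ (Fin n → ℝ)) (m : Fin n → ℤ) : Prop :=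
  ∀ v ∈ σ, latticePairing m v = 0

theorem isPerp_zero {n : ℕ} (σ : PointedCone ℝ (Fin n → ℝ)) : IsPerp σ 0 :=
  fun v _ => by simp [latticePairing]

theorem isPerp_add_iff {n : ℕ} {σ : PointedCone ℝ (Fin n → ℝ)} (m m' : dualMonoid σ) :
    IsPerp σ ((m : Fin n → ℤ) + (m' : Fin n → ℤ)) ↔ IsPerp σ m ∧ IsPerp σ m' := by
  have key : ∀ v, latticePairing ((m : Fin n → ℤ) + (m' : Fin n → ℤ)) v =
      latticePairing (m : Fin n → ℤ) v + latticePairing (m' : Fin n → ℤ) v := fun v => by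
    simp [latticePairing, add_mul, Finset.sum_add_distrib]
  constructor
  · intro h
    have h' : ∀ v ∈ σ, latticePairing (m : Fin n → ℤ) v = 0 ∧
        latticePairing (m' : Fin n → ℤ) v = 0 := fun v hv => by
      have h1 := m.2 v hv
      have h2 := m'.2 v hv
      have h3 := h v hv
      rw [key] at h3
      constructor <;> linarith
    exact ⟨fun v hv => (h' v hv).1, fun v hv => (h' v hv).2⟩
  · rintro ⟨h1, h2⟩ v hv
    rw [key, h1 v hv, h2 v hv, add_zero]

/-! ### Affine toric varieties -/

/-- The complex points of the affine toric variety `U_σ = Spec ℂ[S_σ]`: monoid homomorphisms from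
`S_σ` to the multiplicative monoid `ℂ`. -/
def Chart {n : ℕ} (σ : PointedCone ℝ (Fin n → ℝ)) : Type :=
  {x : dualMonoid σ → ℂ // x 0 = 1 ∧ ∀ m m', x (m + m') = x m * x m'}

namespace Chart

variable {n : ℕ} {σ τ ρ : PointedCone ℝ (Fin n → ℝ)}

/-- The classical topology: pointwise convergence. Since `S_σ` is finitely generated, it is the
topology induced by any closed embedding of `U_σ` in an affine space. -/
instance : TopologicalSpace (Chart σ) :=
  inferInstanceAs (TopologicalSpace {_x : dualMonoid σ → ℂ // _})

theorem continuous_eval (m : dualMonoid σ) : Continuous fun x : Chart σ => x.1 m :=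
  (continuous_apply m).comp continuous_subtype_val

/-- The map `U_τ → U_σ` for `τ ⊆ σ` (an open embedding when `τ` is a face of `σ`). -/
def incl (h : τ ≤ σ) : C(Chart τ, Chart σ) where
  toFun x := ⟨fun m => x.1 ⟨m, dualMonoid_anti h m.2⟩, x.2.1, fun m m' =>
    x.2.2 ⟨m, dualMonoid_anti h m.2⟩ ⟨m', dualMonoid_anti h m'.2⟩⟩
  continuous_toFun := Continuous.subtype_mk (continuous_pi fun _ => continuous_eval _) _

/-- The torus `T = (ℂ^*)ⁿ` acts on `U_σ` by `(t • x)(m) = t^m x(m)`. -/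
noncomputable instance : MulAction (Fin n → ℂˣ) (Chart σ) where
  smul t x := ⟨fun m => (∏ i, (t i : ℂ) ^ (m.1 i)) * x.1 m, by simp [x.2.1], fun m m' => by
    have h : ∀ i, (t i : ℂ) ^ ((m + m').1 i) = (t i : ℂ) ^ (m.1 i) * (t i : ℂ) ^ (m'.1 i) :=
      fun i => zpow_add₀ (t i).ne_zero _ _
    simp only [h, Finset.prod_mul_distrib, x.2.2]
    ring⟩
  one_smul x := Subtype.ext <| funext fun m => by
    change (∏ i, (((1 : Fin n → ℂˣ) i : ℂˣ) : ℂ) ^ (m.1 i)) * x.1 m = x.1 m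
    simp
  mul_smul s t x := Subtype.ext <| funext fun m => by
    change (∏ i, (((s * t) i : ℂˣ) : ℂ) ^ (m.1 i)) * x.1 m =
      (∏ i, (s i : ℂ) ^ (m.1 i)) * ((∏ i, (t i : ℂ) ^ (m.1 i)) * x.1 m)
    simp only [Pi.mul_apply, Units.val_mul, mul_zpow, Finset.prod_mul_distrib, mul_assoc]

open Classical in
/-- The distinguished point of `U_σ`: `m ↦ 1` for `m ∈ σ^⊥`, and `m ↦ 0` otherwise. -/
noncomputable def dist (σ : PointedCone ℝ (Fin n → ℝ)) : Chart σ :=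
  ⟨fun m => if IsPerp σ m then 1 else 0, by simp [isPerp_zero], fun m m' => by
    by_cases h : IsPerp σ m <;> by_cases h' : IsPerp σ m' <;> simp [isPerp_add_iff, h, h']⟩

open Classical in
/-- The canonical projection `p_σ : St(O_σ) = U_σ → O_σ ⊆ U_σ`, dual to
`ℂ[σ^⊥ ∩ M] = ℂ[S_σ]^{T_σ} ⊆ ℂ[S_σ]`. -/
noncomputable def proj (σ : PointedCone ℝ (Fin n → ℝ)) : C(Chart σ, Chart σ) where
  toFun x := ⟨fun m => if IsPerp σ m then x.1 m else 0, by simp [isPerp_zero, x.2.1],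
    fun m m' => by
      by_cases h : IsPerp σ m <;> by_cases h' : IsPerp σ m' <;>
        simp [isPerp_add_iff, h, h', x.2.2]⟩
  continuous_toFun := Continuous.subtype_mk (continuous_pi fun m => by
    by_cases h : IsPerp σ m
    · simpa [h] using continuous_eval m
    · simpa [h] using continuous_const) _

theorem smul_apply (t : Fin n → ℂˣ) (x : Chart σ) (m : dualMonoid σ) :
    (t • x).1 m = (∏ i, (t i : ℂ) ^ (m.1 i)) * x.1 m := rfl

theorem proj_incl_smul_dist (h : τ ≤ σ) (t : Fin n → ℂˣ) :
    proj σ (incl h (t • dist τ)) = t • dist σ := by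
  classical
  refine Subtype.ext <| funext fun m => ?_
  rw [smul_apply]
  change (if IsPerp σ m then (t • dist τ).1 ⟨m, dualMonoid_anti h m.2⟩ else 0) =
    (∏ i, (t i : ℂ) ^ (m.1 i)) * (if IsPerp σ m then 1 else 0)
  rw [smul_apply]
  by_cases hm : IsPerp σ m
  · have hm' : IsPerp τ m := fun v hv => hm v (h hv)
    simp [hm, hm', dist]
  · simp [hm]

theorem proj_incl_mem_orbit (h : τ ≤ σ) {x : Chart τ}
    (hx : x ∈ MulAction.orbit (Fin n → ℂˣ) (dist τ)) :
    proj σ (incl h x) ∈ MulAction.orbit (Fin n → ℂˣ) (dist σ) := by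
  obtain ⟨t, rfl⟩ := hx
  exact ⟨t, (proj_incl_smul_dist h t).symm⟩

theorem proj_incl_dist (h : τ ≤ σ) : proj σ (incl h (dist τ)) = dist σ := by
  simpa using proj_incl_smul_dist h 1

end Chart

/-! ### The toric variety of a fan -/

namespace Fan

variable {n : ℕ}

/-- The cones of the fan, ordered by inclusion (`τ ≤ σ` iff `τ` is a face of `σ`). -/
abbrev Cone (Δ : Fan n) : Type := {σ : PointedCone ℝ (Fin n → ℝ) // σ ∈ Δ.cones}

/-- The toric variety of the fan in the classical topology: the charts `U_σ` glued along the
inclusions `U_τ ⊆ U_σ` for the faces `τ` of `σ`. -/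
def Variety (Δ : Fan n) : Type :=
  Quot fun x y : Σ σ : Δ.Cone, Chart σ.1 => ∃ h : x.1 ≤ y.1, Chart.incl h x.2 = y.2

instance (Δ : Fan n) : TopologicalSpace Δ.Variety :=
  inferInstanceAs (TopologicalSpace (Quot _))

/-- The inclusion of the open set `U_σ = St(O_σ)` into the toric variety. -/
def chartMap (Δ : Fan n) (σ : Δ.Cone) : C(Chart σ.1, Δ.Variety) where
  toFun x := Quot.mk _ ⟨σ, x⟩
  continuous_toFun := continuous_quot_mk.comp continuous_sigmaMk

/-- The orbit `O_σ`: the `T`-orbit of the distinguished point of `U_σ`. -/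
abbrev Orbit (Δ : Fan n) (σ : Δ.Cone) : Type :=
  MulAction.orbit (Fin n → ℂˣ) (Chart.dist σ.1)

/-- The distinguished point of `O_σ`. -/
noncomputable def basePoint (Δ : Fan n) (σ : Δ.Cone) : Δ.Orbit σ :=
  ⟨Chart.dist σ.1, MulAction.mem_orbit_self _⟩

/-- The inclusion of `O_σ` into the toric variety. -/
def orbitMap (Δ : Fan n) (σ : Δ.Cone) : C(Δ.Orbit σ, Δ.Variety) :=
  (Δ.chartMap σ).comp ⟨Subtype.val, continuous_subtype_val⟩

/-- The canonical projection `O_τ → O_σ` for a face `τ` of `σ` (that is, `O_σ ⊆ closure O_τ`): the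
restriction of `p_σ : U_σ → O_σ` to `O_τ ⊆ U_σ`. -/
noncomputable def orbitProj (Δ : Fan n) {τ σ : Δ.Cone} (h : τ ≤ σ) :
    C(Δ.Orbit τ, Δ.Orbit σ) where
  toFun x := ⟨Chart.proj σ.1 (Chart.incl h x.1), Chart.proj_incl_mem_orbit h x.2⟩
  continuous_toFun := Continuous.subtype_mk
    ((Chart.proj σ.1).continuous.comp ((Chart.incl h).continuous.comp continuous_subtype_val)) _

theorem orbitProj_basePoint (Δ : Fan n) {τ σ : Δ.Cone} (h : τ ≤ σ) :
    Δ.orbitProj h (Δ.basePoint τ) = Δ.basePoint σ :=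
  Subtype.ext (Chart.proj_incl_dist h)

theorem orbitProj_refl (Δ : Fan n) (σ : Δ.Cone) :
    Δ.orbitProj (le_refl σ) = ContinuousMap.id _ := by
  refine ContinuousMap.ext fun x => Subtype.ext ?_
  obtain ⟨_, t, rfl⟩ := x
  exact Chart.proj_incl_smul_dist (le_refl σ.1) t

theorem orbitProj_comp (Δ : Fan n) {ρ τ σ : Δ.Cone} (h : ρ ≤ τ) (h' : τ ≤ σ) :
    (Δ.orbitProj h').comp (Δ.orbitProj h) = Δ.orbitProj (h.trans h') := by
  refine ContinuousMap.ext fun x => Subtype.ext ?_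
  obtain ⟨_, t, rfl⟩ := x
  change Chart.proj σ.1 (Chart.incl h' (Chart.proj τ.1 (Chart.incl h (t • Chart.dist ρ.1)))) =
    Chart.proj σ.1 (Chart.incl (h.trans h') (t • Chart.dist ρ.1))
  rw [Chart.proj_incl_smul_dist, Chart.proj_incl_smul_dist, Chart.proj_incl_smul_dist]

/-! ### The ringed quiver `B` -/

/-- The map `π₁(O_τ) → π₁(O_σ)` induced by the canonical projection. -/
noncomputable def pi1Map (Δ : Fan n) {τ σ : Δ.Cone} (h : τ ≤ σ) :
    FundamentalGroup (Δ.Orbit τ) (Δ.basePoint τ) →*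
      FundamentalGroup (Δ.Orbit σ) (Δ.basePoint σ) :=
  FundamentalGroup.mapOfEq (Δ.orbitProj h) (Δ.orbitProj_basePoint h)

theorem pi1Map_refl (Δ : Fan n) (σ : Δ.Cone) : Δ.pi1Map (le_refl σ) = MonoidHom.id _ := by
  refine MonoidHom.ext fun p => ?_
  obtain ⟨γ, rfl⟩ := Path.Homotopic.Quotient.mk_surjective p
  rw [pi1Map, FundamentalGroup.mapOfEq_apply]
  refine congrArg Path.Homotopic.Quotient.mk (Path.ext (funext fun t => ?_))
  exact congrArg (fun f : C(Δ.Orbit σ, Δ.Orbit σ) => f (γ t)) (Δ.orbitProj_refl σ)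

theorem pi1Map_comp (Δ : Fan n) {ρ τ σ : Δ.Cone} (h : ρ ≤ τ) (h' : τ ≤ σ) :
    (Δ.pi1Map h').comp (Δ.pi1Map h) = Δ.pi1Map (h.trans h') := by
  refine MonoidHom.ext fun p => ?_
  obtain ⟨γ, rfl⟩ := Path.Homotopic.Quotient.mk_surjective p
  rw [MonoidHom.comp_apply]
  simp only [pi1Map, FundamentalGroup.mapOfEq_apply]
  refine congrArg Path.Homotopic.Quotient.mk (Path.ext (funext fun t => ?_))
  exact congrArg (fun f : C(Δ.Orbit ρ, Δ.Orbit σ) => f (γ t)) (Δ.orbitProj_comp h h')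

/-- The ringed quiver `B` on the poset of orbits, i.e. on the poset of cones with the opposite
order: `B_σ = ℂ[π₁(O_σ)]`, with the maps induced by the canonical projections. -/
noncomputable def B (Δ : Fan n) : (Δ.Coneᵒᵈ)ᵒᵖ ⥤ RingCat.{0} where
  obj α := RingCat.of
    (MonoidAlgebra ℂ (FundamentalGroup (Δ.Orbit (OrderDual.ofDual α.unop)) (Δ.basePoint _)))
  map f := RingCat.ofHom (MonoidAlgebra.mapDomainRingHom ℂ
    (Δ.pi1Map (OrderDual.ofDual_le_ofDual.mpr (leOfHom f.unop))))
  map_id α := by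
    refine RingCat.hom_ext ?_
    change MonoidAlgebra.mapDomainRingHom ℂ (Δ.pi1Map (le_refl _)) = RingHom.id _
    rw [pi1Map_refl]
    exact MonoidAlgebra.mapDomainRingHom_id ..
  map_comp f g := by
    refine RingCat.hom_ext ?_
    change MonoidAlgebra.mapDomainRingHom ℂ (Δ.pi1Map _) =
      (MonoidAlgebra.mapDomainRingHom ℂ (Δ.pi1Map _)).comp
        (MonoidAlgebra.mapDomainRingHom ℂ (Δ.pi1Map _))
    rw [← MonoidAlgebra.mapDomainRingHom_comp, pi1Map_comp]

/-- The element `c • g` of `B_σ = ℂ[π₁(O_σ)]`. -/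
noncomputable def monomialB (Δ : Fan n) (σ : Δ.Cone)
    (g : FundamentalGroup (Δ.Orbit σ) (Δ.basePoint σ)) (c : ℂ) :
    Δ.B.obj (op (OrderDual.toDual σ)) :=
  MonoidAlgebra.single g c

/-! ### The category `LC(X)` -/

/-- The toric variety as an object of `TopCat`. -/
abbrev X (Δ : Fan n) : TopCat.{0} := TopCat.of Δ.Variety

end Fan

/-- A sheaf of complex vector spaces is locally constant if every point has an open neighbourhood
to which its restriction is isomorphic to a constant sheaf. -/
def IsLocallyConstantSheaf {Y : TopCat.{0}} (G : TopCat.Sheaf (ModuleCat.{0} ℂ) Y) : Prop :=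
  ∀ y : Y, ∃ V : Opens Y, y ∈ V ∧
    Sheaf.IsConstant _ ((TopCat.Sheaf.pullback (ModuleCat.{0} ℂ) V.inclusion').obj G)

namespace Fan

variable {n : ℕ}

/-- The sheaves of complex vector spaces on `X` whose restriction to every orbit is locally
constant. -/
def isLC (Δ : Fan n) : ObjectProperty (TopCat.Sheaf (ModuleCat.{0} ℂ) Δ.X) := fun F =>
  ∀ σ : Δ.Cone, IsLocallyConstantSheaf
    ((TopCat.Sheaf.pullback (ModuleCat.{0} ℂ) (TopCat.ofHom (Δ.orbitMap σ))).obj F)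

/-- The category `LC(X)`, a full subcategory of the category of sheaves on `X`. -/
abbrev LC (Δ : Fan n) : Type 1 := Δ.isLC.FullSubcategory

/-- The distinguished point of `O_σ`, as a point of `X`. -/
noncomputable def point (Δ : Fan n) (σ : Δ.Cone) : Δ.X := Δ.orbitMap σ (Δ.basePoint σ)

/-- The stalk of `F` at the distinguished point of `O_σ`. -/
noncomputable abbrev stalkAt (Δ : Fan n) (F : Δ.LC) (σ : Δ.Cone) : ModuleCat.{0} ℂ :=
  TopCat.Presheaf.stalk F.obj.presheaf (Δ.point σ)

/-- `a` is carried to `b` by parallel transport along the loop `γ` in `O_σ`: there is a section of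
the inverse image of `F` along `γ` (a continuous lift of `γ` to the étale space of `F`) with value
`a` at the start and `b` at the end. -/
def Transport (Δ : Fan n) (F : Δ.LC) {σ : Δ.Cone} (γ : Path (Δ.basePoint σ) (Δ.basePoint σ))
    (a b : Δ.stalkAt F σ) : Prop :=
  ∃ s : C(unitInterval, TopCat.Presheaf.EtaleSpace F.obj.presheaf),
    (∀ t, (s t).base = Δ.orbitMap σ (γ t)) ∧ s 0 = ⟨Δ.point σ, a⟩ ∧ s 1 = ⟨Δ.point σ, b⟩

/-- For `O_σ ⊆ closure O_τ` with canonical projection `p : O_τ → O_σ`, the sheaf `F` defines a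
morphism `F|O_σ → p_* (F|O_τ)`; it sends the class of a section `f` of `F` near a point `x` of `O_σ`
to the class of a section `s` of `F|O_τ` over `p⁻¹(V)`, `V` a neighbourhood of `x` in `O_σ`, that
coincides with `f` on `O_τ ∩ W` for some neighbourhood `W` of `x` in `X`. The relation
`Cospecialize` says that the induced map `F_σ → F_τ` on the stalks at the distinguished points
takes `a` to `b`. -/
def Cospecialize (Δ : Fan n) (F : Δ.LC) {τ σ : Δ.Cone} (h : τ ≤ σ)
    (a : Δ.stalkAt F σ) (b : Δ.stalkAt F τ) : Prop :=
  ∃ (W : Opens Δ.X) (hW : Δ.point σ ∈ W) (f : F.obj.presheaf.obj (op W)) (V : Opens (Δ.Orbit σ))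
    (s : C(Δ.orbitProj h ⁻¹' (V : Set (Δ.Orbit σ)), TopCat.Presheaf.EtaleSpace F.obj.presheaf))
    (hV : Δ.basePoint τ ∈ Δ.orbitProj h ⁻¹' (V : Set (Δ.Orbit σ))),
    F.obj.presheaf.germ W (Δ.point σ) hW f = a ∧
    (∀ y, (s y).base = Δ.orbitMap τ y) ∧
    (∀ (y : Δ.Orbit τ) (hy : Δ.orbitMap τ y ∈ W),
      ∃ hy' : y ∈ Δ.orbitProj h ⁻¹' (V : Set (Δ.Orbit σ)),
        s ⟨y, hy'⟩ = ⟨Δ.orbitMap τ y, F.obj.presheaf.germ W (Δ.orbitMap τ y) hy f⟩) ∧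
    s ⟨Δ.basePoint τ, hV⟩ = ⟨Δ.point τ, b⟩

/-- The data identifying a functor `η : LC(X) ⥤ co-B-Mod` with the functor that sends `F` to its
stalks `F_σ` at the distinguished points, on which `π₁(O_σ)` acts by monodromy, with the
cospecialization maps `F_σ → F_τ` for `O_σ ⊆ closure O_τ`. -/
structure StalkFunctorData (Δ : Fan n) (η : Δ.LC ⥤ CoModule Δ.B) where
  /-- the identification of the stalk `F_σ` with the module of `η(F)` at `σ` -/
  e : ∀ (F : Δ.LC) (σ : Δ.Cone), Δ.stalkAt F σ ≃+ (η.obj F).obj (OrderDual.toDual σ)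
  e_smul : ∀ (F : Δ.LC) (σ : Δ.Cone) (c : ℂ) (a : Δ.stalkAt F σ),
    e F σ (c • a) = Δ.monomialB σ 1 c • e F σ a
  e_natural : ∀ {F G : Δ.LC} (g : F ⟶ G) (σ : Δ.Cone) (a : Δ.stalkAt F σ),
    e G σ ((TopCat.Presheaf.stalkFunctor (ModuleCat.{0} ℂ) (Δ.point σ)).map g.hom.hom a) =
      ((η.map g).app (OrderDual.toDual σ)).hom (e F σ a)
  monodromy : ∀ (F : Δ.LC) (σ : Δ.Cone) (γ : Path (Δ.basePoint σ) (Δ.basePoint σ))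
    (a : Δ.stalkAt F σ), ∃ b : Δ.stalkAt F σ, Δ.Transport F γ a b ∧
      Δ.monomialB σ (FundamentalGroup.fromPath (Path.Homotopic.Quotient.mk γ)) 1 • e F σ a =
        e F σ b
  cospecialize : ∀ (F : Δ.LC) {τ σ : Δ.Cone} (h : τ ≤ σ) (a : Δ.stalkAt F σ),
    ∃ b : Δ.stalkAt F τ, Δ.Cospecialize F h a b ∧
      (η.obj F).map (OrderDual.toDual_le_toDual.mpr h) (e F σ a) = e F τ b

end Fan

/-! ### Inverse images and constant sheaves in terms of stalks -/

namespace TopCat.Presheaf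

/-! Everything is computed in logarithmic coordinates. The map `expMap σ`, w ↦ exp(w)·x_σ,
parametrizes O_σ by the simply connected space ℂⁿ. Its fibres are the cosets of `periods σ`, and
π₁(O_σ) is the quotient of `periods σ` by the complex span `spanC σ` of σ, along which the map is
constant. Pulled back to ℂⁿ, a sheaf F of LC(X) becomes constant, so its space `flat F σ` of flat
sections is identified with the stalk at every point of O_σ (`flatEval`), and translation by periods
is the monodromy.

Since the same ℂⁿ serves all orbits, the projections O_τ → O_σ become the identity of ℂⁿ. Points of
O_τ close to exp(z)·x_σ have logarithms in `nearSet τ σ z A δ`: they are δ-close to z modulo `spanC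
σ`, and finitely many functions Re⟨m, ·⟩ are less than log δ on them. This set is convex and
non-empty, so a section of F near exp(z)·x_σ restricts there to a single flat section on O_τ. It
depends only on the flat section on O_σ, not on z; this defines `cosp`. Functoriality comes from
nesting these sets (`nearFilter_nested`), equivariance from their behaviour under translation by
periods. That they describe the topology of X (`mem_nhds_expMap_iff`) rests on convex geometry:
faces are exposed by characters, U_τ is a principal open subset of U_σ, and every point of U_σ lies
in the orbit of exactly one face.

The functor `eta` sends F to its flat sections; `stalkFunctorData` identifies them with the stalks
at the points x_σ. It is faithful because flat sections see every stalk. It is full because a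
morphism of co-modules induces maps of stalks: equivariance makes them well defined, and
compatibility with `cosp` makes them take sections to sections. For essential surjectivity, a
co-module M defines the sheaf of equivariant functions of the logarithms with values in the M_σ that
follow the structure maps near each point. An element of M_σ extends to a neighbourhood because, in
a small basic set, two logarithms of one point differ by an element of `spanC σ`, which acts
trivially on M_σ. Hence the stalks of this sheaf are the M_σ (`coGerm_bijective`). -/

theorem stalkFunctor_map_toSheafify_bijective {Y : TopCat.{0}} (P : Y.Presheaf (ModuleCat.{0} ℂ))
    (y : Y) :
    Function.Bijective ((stalkFunctor (ModuleCat.{0} ℂ) y).map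
      (CategoryTheory.toSheafify (Opens.grothendieckTopology Y) P)) := by
  constructor
  · intro s t hst
    obtain ⟨U, hU, s, rfl⟩ := P.exists_germ_eq s
    obtain ⟨V, hV, t, rfl⟩ := P.exists_germ_eq t
    rw [stalkFunctor_map_germ_apply, stalkFunctor_map_germ_apply] at hst
    obtain ⟨W, hW, iU, iV, h⟩ := germ_eq _ _ _ _ _ _ hst
    rw [← ConcreteCategory.comp_apply, ← ConcreteCategory.comp_apply, ← NatTrans.naturality,
      ← NatTrans.naturality, ConcreteCategory.comp_apply, ConcreteCategory.comp_apply] at h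
    -- Sheafification is locally injective: sections with the same image agree on a covering sieve.
    have := CategoryTheory.Presheaf.equalizerSieve_mem (Opens.grothendieckTopology Y)
      (CategoryTheory.toSheafify (Opens.grothendieckTopology Y) P) _ _ h
    obtain ⟨W', i, hi, hW'⟩ := this y hW
    rw [← P.germ_res_apply iU y hW, ← P.germ_res_apply iV y hW, ← P.germ_res_apply i y hW']
    conv_rhs => rw [← P.germ_res_apply i y hW']
    exact congrArg _ hi
  · have : IsLocallySurjective (CategoryTheory.toSheafify (Opens.grothendieckTopology Y) P) :=
      inferInstanceAs (CategoryTheory.Presheaf.IsLocallySurjective (Opens.grothendieckTopology Y)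
        (CategoryTheory.toSheafify (Opens.grothendieckTopology Y) P))
    exact (locally_surjective_iff_surjective_on_stalks _).mp this y

/-- The map on stalks induced by a morphism `F ⟶ f_* G` of presheaves. -/
noncomputable def stalkMapAlong {X Y : TopCat.{0}} (f : Y ⟶ X) {F : X.Presheaf (ModuleCat.{0} ℂ)}
    {G : Y.Presheaf (ModuleCat.{0} ℂ)} (θ : F ⟶ (pushforward _ f).obj G) (y : Y) :
    F.stalk (f y) ⟶ G.stalk y :=
  (stalkFunctor _ (f y)).map θ ≫ stalkPushforward _ f G y

theorem stalkMapAlong_germ {X Y : TopCat.{0}} (f : Y ⟶ X) {F : X.Presheaf (ModuleCat.{0} ℂ)}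
    {G : Y.Presheaf (ModuleCat.{0} ℂ)} (θ : F ⟶ (pushforward _ f).obj G) (y : Y) (W : Opens X)
    (hW : f y ∈ W) (s : F.obj (op W)) :
    stalkMapAlong f θ y (F.germ W (f y) hW s) =
      G.germ ((Opens.map f).obj W) y hW (θ.app (op W) s) := by
  exact (congrArg (stalkPushforward _ f G y) (stalkFunctor_map_germ_apply W (f y) hW θ s)).trans
    (stalkPushforward_germ_apply ..)

/-- The inverse image of a sheaf receives a morphism that is bijective on stalks. -/
theorem exists_stalkMapAlong_bijective {X Y : TopCat.{0}} (f : Y ⟶ X)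
    (F : TopCat.Sheaf (ModuleCat.{0} ℂ) X) :
    ∃ θ : F.presheaf ⟶
        (pushforward _ f).obj ((Sheaf.pullback (ModuleCat.{0} ℂ) f).obj F).presheaf,
      ∀ y, Function.Bijective (stalkMapAlong f θ y) := by
  let P := (pullback (ModuleCat.{0} ℂ) f).obj F.presheaf
  let e := (Sheaf.pullbackIso (ModuleCat.{0} ℂ) f).app F
  let u : P ⟶ ((Sheaf.pullback (ModuleCat.{0} ℂ) f).obj F).presheaf :=
    CategoryTheory.toSheafify (Opens.grothendieckTopology Y) P ≫ e.inv.hom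
  let ν : F.presheaf ⟶ (pushforward _ f).obj P :=
    (pullbackPushforwardAdjunction (ModuleCat.{0} ℂ) f).unit.app F.presheaf
  refine ⟨ν ≫ (pushforward _ f).map u, fun y => ?_⟩
  have hν : Function.Bijective (stalkMapAlong f ν y) :=
    ConcreteCategory.bijective_of_isIso (stalkPullbackIso (ModuleCat.{0} ℂ) f F.presheaf y).hom
  have hcomp : ∀ a, stalkMapAlong f (ν ≫ (pushforward _ f).map u) y a =
      (stalkFunctor _ y).map u (stalkMapAlong f ν y a) := fun a => by
    obtain ⟨W, hW, s, rfl⟩ := F.presheaf.exists_germ_eq a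
    refine (stalkMapAlong_germ f _ y W hW s).trans ?_
    refine Eq.trans ?_ (congrArg ((stalkFunctor _ y).map u)
      (stalkMapAlong_germ f ν y W hW s)).symm
    exact (stalkFunctor_map_germ_apply ((Opens.map f).obj W) y hW u (ν.app (op W) s)).symm
  have hu : Function.Bijective ((stalkFunctor _ y).map u) := by
    have : (stalkFunctor _ y).map u = (stalkFunctor _ y).map
        (CategoryTheory.toSheafify (Opens.grothendieckTopology Y) P) ≫
        (stalkFunctor _ y).map e.inv.hom := Functor.map_comp ..
    rw [this]
    have he : Function.Bijective ((stalkFunctor _ y).map e.inv.hom) := by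
      have : IsIso ((stalkFunctor (ModuleCat.{0} ℂ) y).map e.inv.hom) :=
        Functor.map_isIso (Sheaf.forget (ModuleCat.{0} ℂ) Y ⋙ stalkFunctor (ModuleCat.{0} ℂ) y)
          e.inv
      exact ConcreteCategory.bijective_of_isIso _
    exact he.comp (stalkFunctor_map_toSheafify_bijective P y)
  rw [funext hcomp]
  exact hu.comp hν

theorem germ_const_bijective {Y : TopCat.{0}} (A : ModuleCat.{0} ℂ) (y : Y) :
    Function.Bijective (germ (show Y.Presheaf (ModuleCat.{0} ℂ) from
      (Functor.const (Opens Y)ᵒᵖ).obj A) ⊤ y (Opens.mem_top y)) := by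
  let P : Y.Presheaf (ModuleCat.{0} ℂ) := (Functor.const _).obj A
  refine ⟨fun a b hab => ?_, fun t => ?_⟩
  · obtain ⟨W, _, i, j, hW⟩ := P.germ_eq y (Opens.mem_top y) (Opens.mem_top y) a b hab
    exact hW
  · obtain ⟨W, hW, s, rfl⟩ := P.exists_germ_eq t
    exact ⟨s, (P.germ_res_apply (homOfLE le_top : W ⟶ ⊤) y hW s).symm⟩

/-- A constant sheaf has enough global sections, which are determined by any of their germs. -/
theorem exists_linearMap_of_isConstant {Y : TopCat.{0}} (G : TopCat.Sheaf (ModuleCat.{0} ℂ) Y)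
    (h : Sheaf.IsConstant _ G) :
    ∃ (A : ModuleCat.{0} ℂ) (c : A ⟶ G.presheaf.obj (op ⊤)),
      ∀ y, Function.Bijective fun a => G.presheaf.germ ⊤ y (Opens.mem_top y) (c a) := by
  obtain ⟨A, ⟨e⟩⟩ := h.mem_essImage
  let P : Y.Presheaf (ModuleCat.{0} ℂ) := (Functor.const _).obj A
  let e' : (constantSheaf (Opens.grothendieckTopology Y) _).obj A ⟶ G := e.hom
  have he' : IsIso e' := e.isIso_hom
  let u : P ⟶ G.presheaf :=
    CategoryTheory.toSheafify (Opens.grothendieckTopology Y) P ≫ e'.hom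
  refine ⟨A, u.app (op ⊤), fun y => ?_⟩
  have h1 : (fun a => G.presheaf.germ ⊤ y (Opens.mem_top y) (u.app (op ⊤) a)) =
      fun a => (stalkFunctor _ y).map u (P.germ ⊤ y (Opens.mem_top y) a) :=
    funext fun a => (stalkFunctor_map_germ_apply ⊤ y (Opens.mem_top y) u a).symm
  refine (congrArg Function.Bijective h1).mpr ?_
  have hu : Function.Bijective ((stalkFunctor _ y).map u) := by
    have : (stalkFunctor _ y).map u = (stalkFunctor _ y).map
        (CategoryTheory.toSheafify (Opens.grothendieckTopology Y) P) ≫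
        (stalkFunctor _ y).map e'.hom := Functor.map_comp ..
    rw [this]
    have he : Function.Bijective ((stalkFunctor _ y).map e'.hom) := by
      have : IsIso ((stalkFunctor (ModuleCat.{0} ℂ) y).map e'.hom) :=
        @Functor.map_isIso _ _ _ _ _ _
          (Sheaf.forget (ModuleCat.{0} ℂ) Y ⋙ stalkFunctor (ModuleCat.{0} ℂ) y) e' he'
      exact ConcreteCategory.bijective_of_isIso _
    exact he.comp (stalkFunctor_map_toSheafify_bijective P y)
  exact hu.comp (germ_const_bijective A y)

/-- The map from the constant presheaf factors through the constant sheaf, and a morphism of sheaves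
that is bijective on stalks is an isomorphism. This is the converse of
`exists_linearMap_of_isConstant`. -/
theorem isConstant_of_linearMap {Y : TopCat.{0}} (G : TopCat.Sheaf (ModuleCat.{0} ℂ) Y)
    (A : ModuleCat.{0} ℂ) (c : A ⟶ G.presheaf.obj (op ⊤))
    (h : ∀ y, Function.Bijective fun a => G.presheaf.germ ⊤ y (Opens.mem_top y) (c a)) :
    Sheaf.IsConstant _ G := by
  let P : Y.Presheaf (ModuleCat.{0} ℂ) := (Functor.const _).obj A
  let u : P ⟶ G.presheaf :=
    { app := fun W => c ≫ G.presheaf.map (homOfLE le_top : W.unop ⟶ ⊤).op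
      naturality := fun W W' i => by
        rw [Category.assoc, ← Functor.map_comp]
        exact Category.id_comp _ }
  let v : (constantSheaf (Opens.grothendieckTopology Y) _).obj A ⟶ G :=
    ⟨CategoryTheory.sheafifyLift _ u G.2⟩
  have hv : ∀ y, Function.Bijective ((stalkFunctor _ y).map v.hom) := fun y => by
    have h1 : ∀ t, (stalkFunctor _ y).map v.hom ((stalkFunctor _ y).map
        (CategoryTheory.toSheafify (Opens.grothendieckTopology Y) P) t) =
        (stalkFunctor _ y).map u t := fun t => by
      have h0 : (stalkFunctor _ y).map (CategoryTheory.toSheafify _ P) ≫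
          (stalkFunctor _ y).map v.hom = (stalkFunctor _ y).map u := by
        rw [← Functor.map_comp]
        exact congrArg _ (CategoryTheory.toSheafify_sheafifyLift _ u G.2)
      exact congrArg (fun k => k.hom t) h0
    have h2 : ∀ a, (stalkFunctor _ y).map u (P.germ ⊤ y (Opens.mem_top y) a) =
        G.presheaf.germ ⊤ y (Opens.mem_top y) (c a) := fun a =>
      (stalkFunctor_map_germ_apply ⊤ y (Opens.mem_top y) u a).trans
        (G.presheaf.germ_res_apply (homOfLE le_top : ⊤ ⟶ ⊤) y (Opens.mem_top y) (c a))
    have h4 := h y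
    have h5 := (stalkFunctor_map_toSheafify_bijective P y).comp (germ_const_bijective A y)
    refine (Function.Bijective.of_comp_iff _ h5).mp ?_
    exact (congrArg Function.Bijective (funext fun a => (h1 _).trans (h2 a))).mpr h4
  have : ∀ y : Y, IsIso ((stalkFunctor (ModuleCat.{0} ℂ) y).map v.hom) := fun y =>
    (ConcreteCategory.isIso_iff_bijective _).mpr (hv y)
  have : IsIso v := isIso_of_stalkFunctor_map_iso v
  exact Sheaf.isConstant_of_iso _ (asIso v).symm

end TopCat.Presheaf

open TopCat.Presheaf

/-- Local trivializations of a sheaf whose inverse image is locally constant. -/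
theorem IsLocallyConstantSheaf.exists_trivialization {X Y : TopCat.{0}} (f : Y ⟶ X)
    (F : TopCat.Sheaf (ModuleCat.{0} ℂ) X)
    (h : IsLocallyConstantSheaf ((TopCat.Sheaf.pullback (ModuleCat.{0} ℂ) f).obj F)) (y : Y) :
    ∃ (V : Opens Y) (A : Type) (c : ∀ y', A → F.presheaf.stalk (f y')), y ∈ V ∧
      (∀ y' ∈ V, Function.Bijective (c y')) ∧
      ∀ a, ∀ y' ∈ V, ∃ (W : Opens X) (s : F.presheaf.obj (op W)), f y' ∈ W ∧
        ∃ V' : Opens Y, y' ∈ V' ∧ ∀ y'' ∈ V', ∃ hW : f y'' ∈ W,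
          c y'' a = F.presheaf.germ W (f y'') hW s := by
  obtain ⟨V, hyV, hV⟩ := h y
  obtain ⟨A, c, hc⟩ := exists_linearMap_of_isConstant _ hV
  obtain ⟨θ, hθ⟩ := exists_stalkMapAlong_bijective f F
  obtain ⟨ψ, hψ⟩ := exists_stalkMapAlong_bijective V.inclusion'
    ((TopCat.Sheaf.pullback (ModuleCat.{0} ℂ) f).obj F)
  clear hV
  -- From here on the two inverse images enter only through morphisms that are bijective on stalks.
  generalize (TopCat.Sheaf.pullback (ModuleCat.{0} ℂ) V.inclusion').obj
    ((TopCat.Sheaf.pullback (ModuleCat.{0} ℂ) f).obj F) = H at *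
  generalize (TopCat.Sheaf.pullback (ModuleCat.{0} ℂ) f).obj F = G at *
  let κ : ∀ v : V, F.presheaf.stalk (f v.1) → H.presheaf.stalk v := fun v a =>
    stalkMapAlong V.inclusion' ψ v (stalkMapAlong f θ v.1 a)
  have hκ : ∀ v, Function.Bijective (κ v) := fun v => (hψ v).comp (hθ v.1)
  let κe : ∀ v : V, F.presheaf.stalk (f v.1) ≃ H.presheaf.stalk v := fun v =>
    Equiv.ofBijective (κ v) (hκ v)
  have κ_germ : ∀ (v : V) (W : Opens X) (hW : f v.1 ∈ W) (s : F.presheaf.obj (op W)),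
      κ v (F.presheaf.germ W (f v.1) hW s) =
        H.presheaf.germ ((Opens.map V.inclusion').obj ((Opens.map f).obj W)) v hW
          (ψ.app _ (θ.app _ s)) := fun v W hW s => by
    refine (congrArg (stalkMapAlong V.inclusion' ψ v)
      (stalkMapAlong_germ f θ v.1 W hW s)).trans ?_
    exact stalkMapAlong_germ V.inclusion' ψ v _ hW _
  classical
  refine ⟨V, A, fun y' a => if hy' : y' ∈ V then
    (κe ⟨y', hy'⟩).symm (H.presheaf.germ ⊤ ⟨y', hy'⟩ (Opens.mem_top _) (c a)) else 0, hyV,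
    fun y' hy' => ?_, fun a y' hy' => ?_⟩
  · simp only [hy', dite_true]
    exact (κe ⟨y', hy'⟩).symm.bijective.comp (hc ⟨y', hy'⟩)
  · obtain ⟨t, ht⟩ := (hκ ⟨y', hy'⟩).2 (H.presheaf.germ ⊤ ⟨y', hy'⟩ (Opens.mem_top _) (c a))
    obtain ⟨W, hW, s, rfl⟩ := F.presheaf.exists_germ_eq t
    rw [κ_germ] at ht
    obtain ⟨V', hV', i, j, hij⟩ := H.presheaf.germ_eq _ _ _ _ _ ht
    refine ⟨W, s, hW, ⟨(Subtype.val : V → Y) '' V'.carrier,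
      V.isOpen.isOpenMap_subtype_val _ V'.isOpen⟩, ⟨⟨y', hy'⟩, hV', rfl⟩, ?_⟩
    rintro _ ⟨v, hv, rfl⟩
    refine ⟨i.le hv, ?_⟩
    refine (dif_pos v.2).trans ?_
    refine (κe v).injective ?_
    rw [Equiv.apply_symm_apply]
    refine Eq.trans ?_ (κ_germ v W (i.le hv) s).symm
    refine (H.presheaf.germ_res_apply j v hv _).symm.trans ?_
    rw [← hij]
    exact H.presheaf.germ_res_apply i v hv _

/-- Stalks of an inverse image are stalks of `F`, so a linear family of sections of `F` with
bijective germs trivializes the inverse image on `V`. -/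
theorem isLocallyConstantSheaf_pullback {X Y : TopCat.{0}} (f : Y ⟶ X)
    (F : TopCat.Sheaf (ModuleCat.{0} ℂ) X)
    (h : ∀ y : Y, ∃ (V : Opens Y) (W : Opens X) (A : ModuleCat.{0} ℂ)
      (c : A ⟶ F.presheaf.obj (op W)), y ∈ V ∧ ∀ y' ∈ V, ∃ hW : f y' ∈ W,
        Function.Bijective fun a => F.presheaf.germ W (f y') hW (c a)) :
    IsLocallyConstantSheaf ((TopCat.Sheaf.pullback (ModuleCat.{0} ℂ) f).obj F) := by
  intro y
  obtain ⟨V, W, A, c, hyV, hV⟩ := h y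
  obtain ⟨θ, hθ⟩ := exists_stalkMapAlong_bijective f F
  obtain ⟨ψ, hψ⟩ := exists_stalkMapAlong_bijective V.inclusion'
    ((TopCat.Sheaf.pullback (ModuleCat.{0} ℂ) f).obj F)
  refine ⟨V, hyV, ?_⟩
  generalize (TopCat.Sheaf.pullback (ModuleCat.{0} ℂ) V.inclusion').obj
    ((TopCat.Sheaf.pullback (ModuleCat.{0} ℂ) f).obj F) = H at *
  generalize (TopCat.Sheaf.pullback (ModuleCat.{0} ℂ) f).obj F = G at *
  let j : (⊤ : Opens V) ⟶ (Opens.map V.inclusion').obj ((Opens.map f).obj W) :=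
    homOfLE fun v _ => (hV v.1 v.2).1
  let c' : A ⟶ H.presheaf.obj (op ⊤) :=
    c ≫ θ.app _ ≫ ψ.app (op ((Opens.map f).obj W)) ≫ H.presheaf.map j.op
  refine isConstant_of_linearMap _ A c' fun v => ?_
  obtain ⟨hW, hc⟩ := hV v.1 v.2
  have : (fun a => H.presheaf.germ ⊤ v (Opens.mem_top _) (c' a)) =
      fun a => stalkMapAlong V.inclusion' ψ v (stalkMapAlong f θ v.1
        (F.presheaf.germ W (f v.1) hW (c a))) := by
    funext a
    refine Eq.trans ?_ (congrArg (stalkMapAlong V.inclusion' ψ v)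
      (stalkMapAlong_germ f θ v.1 W hW (c a))).symm
    refine Eq.trans ?_ (stalkMapAlong_germ V.inclusion' ψ v _ hW _).symm
    exact H.presheaf.germ_res_apply j v (Opens.mem_top _) _
  change Function.Bijective (fun a => H.presheaf.germ ⊤ v (Opens.mem_top _) (c' a))
  rw [this]
  exact (hψ v).comp ((hθ v.1).comp hc)

/-! ### Convex geometry of rational cones -/

/-- Farkas' lemma: a vector outside a finitely generated cone is separated from it by a linear
functional. -/
theorem farkas {K E ι : Type*} [Field K] [LinearOrder K] [IsStrictOrderedRing K] [AddCommGroup E]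
    [Module K E] [DecidableEq ι] (s : Finset ι) (v : ι → E) (b : E)
    (hb : b ∉ PointedCone.hull K (v '' (s : Set ι))) :
    ∃ φ : E →ₗ[K] K, (∀ i ∈ s, 0 ≤ φ (v i)) ∧ φ b < 0 := by
  induction s using Finset.induction_on generalizing v b with
  | empty =>
    have hb' : b ≠ 0 := by simpa using hb
    obtain ⟨φ, hφ⟩ : ∃ φ : Module.Dual K E, φ b ≠ 0 := by
      by_contra! h
      exact hb' ((Module.forall_dual_apply_eq_zero_iff K b).mp h)
    rcases hφ.lt_or_gt with h | h
    · exact ⟨φ, by simp, h⟩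
    · exact ⟨-φ, by simp, by simpa using h⟩
  | insert j s hj ih =>
    obtain ⟨φ, hφ, hφb⟩ := ih v b fun h => hb (Submodule.span_mono (by gcongr; simp) h)
    rcases le_or_gt 0 (φ (v j)) with hv | hv
    · exact ⟨φ, by simpa [hv] using hφ, hφb⟩
    -- When φ is negative on the new generator, project along that generator onto the kernel of φ
    -- and apply induction to the images.
    let π : E →ₗ[K] E := LinearMap.id - (φ.smulRight ((φ (v j))⁻¹ • v j))
    have hπ : ∀ x, π x = x - φ x • (φ (v j))⁻¹ • v j := fun x => rfl
    -- If π b were in the cone of the π (v i), then b would be in the original cone: the coefficient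
    -- of `v j` that appears is nonnegative, since φ is negative on both b and `v j`.
    obtain ⟨ψ, hψ, hψb⟩ := ih (π ∘ v) (π b) fun h => hb <| by
      have key : ∀ x ∈ PointedCone.hull K ((π ∘ v) '' (s : Set ι)),
          ∃ y ∈ PointedCone.hull K (v '' (s : Set ι)), ∃ c : K, 0 ≤ c ∧ x = y + c • v j := by
        intro x hx
        induction hx using Submodule.span_induction with
        | mem x hx =>
          obtain ⟨i, hi, rfl⟩ := hx
          refine ⟨v i, Submodule.subset_span ⟨i, hi, rfl⟩, -(φ (v i) * (φ (v j))⁻¹), ?_, ?_⟩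
          · have := hφ i hi
            have h2 := (inv_lt_zero.mpr hv).le
            nlinarith
          · simp [hπ, smul_smul, sub_eq_add_neg]
        | zero => exact ⟨0, zero_mem _, 0, le_rfl, by simp⟩
        | add x y _ _ hx hy =>
          obtain ⟨x', hx', c, hc, rfl⟩ := hx
          obtain ⟨y', hy', d, hd, rfl⟩ := hy
          exact ⟨x' + y', add_mem hx' hy', c + d, add_nonneg hc hd, by rw [add_smul]; abel⟩
        | smul a x _ hx =>
          obtain ⟨x', hx', c, hc, rfl⟩ := hx
          refine ⟨a • x', Submodule.smul_mem _ _ hx', a.1 * c, mul_nonneg a.2 hc, ?_⟩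
          rw [smul_add, mul_smul]
          rfl
      obtain ⟨y, hy, c, hc, hyc⟩ := key _ h
      have hbe : b = y + (c + φ b * (φ (v j))⁻¹) • v j := by
        rw [add_smul, ← add_assoc, ← hyc, hπ, smul_smul]
        abel
      rw [hbe]
      refine add_mem (Submodule.span_mono (by gcongr; simp) hy) ?_
      refine Submodule.smul_mem _ (⟨c + φ b * (φ (v j))⁻¹, add_nonneg hc
        (mul_nonneg_of_nonpos_of_nonpos hφb.le (inv_lt_zero.mpr hv).le)⟩ : {c : K // 0 ≤ c})
        (Submodule.subset_span ⟨j, by simp, rfl⟩)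
    refine ⟨ψ.comp π, fun i hi => ?_, hψb⟩
    rcases Finset.mem_insert.mp hi with rfl | hi
    · have : π (v i) = 0 := by rw [hπ, smul_smul, mul_inv_cancel₀ hv.ne, one_smul, sub_self]
      simp [this]
    · exact hψ i hi

section Cones

variable {n : ℕ} {σ τ : PointedCone ℝ (Fin n → ℝ)}

theorem latticePairing_add_left (m m' : Fin n → ℤ) (v : Fin n → ℝ) :
    latticePairing (m + m') v = latticePairing m v + latticePairing m' v := by
  simp [latticePairing, add_mul, Finset.sum_add_distrib]

theorem latticePairing_neg_left (m : Fin n → ℤ) (v : Fin n → ℝ) :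
    latticePairing (-m) v = -latticePairing m v := by
  simp [latticePairing]

theorem latticePairing_add_right (m : Fin n → ℤ) (v v' : Fin n → ℝ) :
    latticePairing m (v + v') = latticePairing m v + latticePairing m v' := by
  simp [latticePairing, mul_add, Finset.sum_add_distrib]

theorem latticePairing_smul_right (m : Fin n → ℤ) (c : ℝ) (v : Fin n → ℝ) :
    latticePairing m (c • v) = c * latticePairing m v := by
  simp [latticePairing, Finset.mul_sum, mul_left_comm]

theorem latticePairing_nsmul_left (k : ℕ) (m : Fin n → ℤ) (v : Fin n → ℝ) :
    latticePairing (k • m) v = k * latticePairing m v := by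
  simp [latticePairing, Finset.mul_sum, mul_assoc]

theorem latticePairing_sum_left {ι : Type*} (s : Finset ι) (m : ι → Fin n → ℤ) (v : Fin n → ℝ) :
    latticePairing (∑ i ∈ s, m i) v = ∑ i ∈ s, latticePairing (m i) v := by
  classical
  induction s using Finset.induction_on with
  | empty => simp [latticePairing]
  | insert i s hi ih => rw [Finset.sum_insert hi, Finset.sum_insert hi, latticePairing_add_left, ih]

theorem latticePairing_sum_right {ι : Type*} (s : Finset ι) (m : Fin n → ℤ) (v : ι → Fin n → ℝ) :
    latticePairing m (∑ i ∈ s, v i) = ∑ i ∈ s, latticePairing m (v i) := by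
  classical
  induction s using Finset.induction_on with
  | empty => simp [latticePairing]
  | insert i s hi ih =>
    rw [Finset.sum_insert hi, Finset.sum_insert hi, latticePairing_add_right, ih]

/-- The real vector of a lattice point. -/
def latticeVec (v : Fin n → ℤ) : Fin n → ℝ := fun i => (v i : ℝ)

/-- `S` is a finite set of lattice points that generates the cone `σ`. -/
def IsGeneratedBy (σ : PointedCone ℝ (Fin n → ℝ)) (S : Finset (Fin n → ℤ)) : Prop :=
  σ = PointedCone.hull ℝ (latticeVec '' (S : Set (Fin n → ℤ)))

theorem IsGeneratedBy.mem {S : Finset (Fin n → ℤ)} (hS : IsGeneratedBy σ S) {g : Fin n → ℤ}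
    (hg : g ∈ S) : latticeVec g ∈ σ := by
  rw [hS]
  exact Submodule.subset_span ⟨g, hg, rfl⟩

theorem IsGeneratedBy.mem_dualMonoid_iff {S : Finset (Fin n → ℤ)} (hS : IsGeneratedBy σ S)
    {m : Fin n → ℤ} :
    m ∈ dualMonoid σ ↔ ∀ g ∈ S, 0 ≤ latticePairing m (latticeVec g) := by
  refine ⟨fun h g hg => h _ (hS.mem hg), fun h v hv => ?_⟩
  rw [hS] at hv
  induction hv using Submodule.span_induction with
  | mem x hx => obtain ⟨g, hg, rfl⟩ := hx; exact h g hg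
  | zero => simp [latticePairing]
  | add x y _ _ hx hy => rw [latticePairing_add_right]; exact add_nonneg hx hy
  | smul a x _ hx =>
    change 0 ≤ latticePairing m (a.1 • x)
    rw [latticePairing_smul_right]; exact mul_nonneg a.2 hx

theorem IsGeneratedBy.isPerp_iff {S : Finset (Fin n → ℤ)} (hS : IsGeneratedBy σ S)
    {m : Fin n → ℤ} : IsPerp σ m ↔ ∀ g ∈ S, latticePairing m (latticeVec g) = 0 := by
  refine ⟨fun h g hg => h _ (hS.mem hg), fun h v hv => ?_⟩
  have h1 : m ∈ dualMonoid σ := hS.mem_dualMonoid_iff.mpr fun g hg => (h g hg).ge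
  have h2 : -m ∈ dualMonoid σ := hS.mem_dualMonoid_iff.mpr fun g hg => by
    rw [latticePairing_neg_left, h g hg, neg_zero]
  have h3 := h1 v hv
  have h4 := h2 v hv
  rw [latticePairing_neg_left] at h4
  linarith

theorem IsPerp.mem_dualMonoid {m : Fin n → ℤ} (h : IsPerp σ m) : m ∈ dualMonoid σ :=
  fun v hv => (h v hv).ge

theorem IsPerp.neg {m : Fin n → ℤ} (h : IsPerp σ m) : IsPerp σ (-m) := fun v hv => by
  rw [latticePairing_neg_left, h v hv, neg_zero]

theorem IsPerp.add {m m' : Fin n → ℤ} (h : IsPerp σ m) (h' : IsPerp σ m') : IsPerp σ (m + m') :=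
  fun v hv => by rw [latticePairing_add_left, h v hv, h' v hv, add_zero]

theorem IsPerp.nsmul {m : Fin n → ℤ} (h : IsPerp σ m) (k : ℕ) : IsPerp σ (k • m) :=
  fun v hv => by rw [latticePairing_nsmul_left, h v hv, mul_zero]

theorem IsPerp.anti (h : τ ≤ σ) {m : Fin n → ℤ} (hm : IsPerp σ m) : IsPerp τ m :=
  fun v hv => hm v (h hv)

/-- The lattice `σ^⊥ ∩ M` is a retract of `M`. -/
theorem exists_perp_retraction {S : Finset (Fin n → ℤ)} (hS : IsGeneratedBy σ S) :
    ∃ r : (Fin n → ℤ) →ₗ[ℤ] (Fin n → ℤ), (∀ m, IsPerp σ (r m)) ∧ ∀ m, IsPerp σ m → r m = m := by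
  let φ : (Fin n → ℤ) →ₗ[ℤ] (S → ℤ) :=
    LinearMap.pi fun g => ∑ i, (g.1 i) • LinearMap.proj (R := ℤ) (φ := fun _ : Fin n => ℤ) i
  have hφ : ∀ m, IsPerp σ m ↔ φ m = 0 := fun m => by
    rw [hS.isPerp_iff, funext_iff, Subtype.forall]
    refine forall₂_congr fun g hg => ?_
    have : latticePairing m (latticeVec g) = ((φ m ⟨g, hg⟩ : ℤ) : ℝ) := by
      simp [φ, latticePairing, latticeVec, mul_comm]
    rw [this]
    simp
  -- The range of φ is a subgroup of a free abelian group of finite rank, hence projective, so σ^⊥ ∩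
  -- M, the kernel of φ, splits off.
  obtain ⟨s, hs⟩ := Module.projective_lifting_property φ.rangeRestrict LinearMap.id
    φ.surjective_rangeRestrict
  have hs' : ∀ x, φ (s x) = x.1 := fun x => congrArg Subtype.val (LinearMap.congr_fun hs x)
  refine ⟨LinearMap.id - s.comp φ.rangeRestrict, fun m => ?_, fun m hm => ?_⟩
  · rw [hφ]
    simp [hs']
  · have : φ.rangeRestrict m = 0 := Subtype.ext ((hφ m).mp hm)
    simp [this]

/-- A lattice point in the relative interior of a rational cone. -/
theorem exists_interior {S : Finset (Fin n → ℤ)} (hS : IsGeneratedBy σ S) :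
    ∃ v ∈ σ, ∀ m ∈ dualMonoid σ, latticePairing m v = 0 → IsPerp σ m := by
  refine ⟨∑ g ∈ S, latticeVec g, Submodule.sum_mem _ fun g hg => hS.mem hg, fun m hm h => ?_⟩
  rw [latticePairing_sum_right, Finset.sum_eq_zero_iff_of_nonneg fun g hg => hm _ (hS.mem hg)] at h
  exact hS.isPerp_iff.mpr h

/-- Where b is positive a large multiple of it outweighs a, and only finitely many indices have to
be served at once. -/
theorem exists_nat_common_bound {ι : Type*} (S : Finset ι) (a b : ι → ℝ)
    (h : ∀ i ∈ S, 0 < b i ∨ b i = 0 ∧ 0 ≤ a i) : ∃ k : ℕ, ∀ i ∈ S, 0 ≤ a i + k * b i := by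
  classical
  induction S using Finset.induction_on with
  | empty => exact ⟨0, by simp⟩
  | insert i S hi ih =>
    obtain ⟨k, hk⟩ := ih fun j hj => h j (Finset.mem_insert_of_mem hj)
    obtain ⟨l, hl⟩ : ∃ l : ℕ, ∀ l' ≥ l, 0 ≤ a i + l' * b i := by
      rcases h i (Finset.mem_insert_self _ _) with hb | ⟨hb, ha⟩
      · obtain ⟨l, hl⟩ := exists_nat_ge (-a i / b i)
        refine ⟨l, fun l' hl' => ?_⟩
        have : (l : ℝ) ≤ l' := by exact_mod_cast hl'
        rw [div_le_iff₀ hb] at hl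
        nlinarith
      · exact ⟨0, fun l' _ => by simpa [hb] using ha⟩
    refine ⟨max k l, fun j hj => ?_⟩
    rcases Finset.mem_insert.mp hj with rfl | hj
    · exact hl _ (le_max_right _ _)
    · have h1 := hk j hj
      have h2 : (k : ℝ) ≤ (max k l : ℕ) := by exact_mod_cast le_max_left _ _
      have h3 : 0 ≤ b j := by
        rcases h j (Finset.mem_insert_of_mem hj) with h | h
        exacts [h.le, h.1.ge]
      nlinarith

/-- Clear denominators: D is the product of the denominators of the coefficients. -/
theorem exists_int_functional (φ : (Fin n → ℚ) →ₗ[ℚ] ℚ) :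
    ∃ (m : Fin n → ℤ) (D : ℝ), 0 < D ∧ ∀ g : Fin n → ℤ,
      latticePairing m (latticeVec g) = D * (φ (fun i => (g i : ℚ)) : ℚ) := by
  let a : Fin n → ℚ := fun i => φ (Pi.single i 1)
  let D : ℕ := ∏ i, (a i).den
  have hD : 0 < D := Finset.prod_pos fun i _ => (a i).den_pos
  have hm : ∀ i, ∃ k : ℤ, (k : ℚ) = D * a i := fun i => by
    obtain ⟨c, hc⟩ : (a i).den ∣ D := Finset.dvd_prod_of_mem _ (Finset.mem_univ i)
    refine ⟨c * (a i).num, ?_⟩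
    rw [hc]
    push_cast
    have := Rat.den_mul_eq_num (a i)
    linear_combination (-(c : ℚ)) * this
  choose m hm using hm
  refine ⟨m, D, by exact_mod_cast hD, fun g => ?_⟩
  have hg : φ (fun i => (g i : ℚ)) = ∑ i, (g i : ℚ) * a i := by
    have h1 : (fun i => (g i : ℚ)) = ∑ i, (g i : ℚ) • (Pi.single i 1 : Fin n → ℚ) := by
      ext j
      simp [Finset.sum_apply, Pi.single_apply]
    rw [h1, map_sum]
    simp [a]
  rw [hg, latticePairing]
  push_cast
  rw [Finset.mul_sum]
  refine Finset.sum_congr rfl fun i _ => ?_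
  have h1 : ((m i : ℤ) : ℝ) = D * (a i : ℝ) := by exact_mod_cast congrArg (fun q : ℚ => (q : ℝ)) (hm i)
  rw [h1, latticeVec]
  ring

/-- Faces of rational cones are exposed by lattice functionals. -/
theorem exists_exposing {S : Finset (Fin n → ℤ)} (hS : IsGeneratedBy σ S) (hτ : τ.IsFaceOf σ) :
    ∃ m ∈ dualMonoid σ, ∀ v ∈ σ, v ∈ τ ↔ latticePairing m v = 0 := by
  classical
  have sep : ∀ g ∈ S, latticeVec g ∉ τ → ∃ m ∈ dualMonoid σ, IsPerp τ m ∧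
      0 < latticePairing m (latticeVec g) := by
    intro g hg hgτ
    -- Farkas' lemma is applied over ℚ, so that the separating functional can be scaled to a lattice
    -- point.
    let ratVec : (Fin n → ℤ) → Fin n → ℚ := fun v i => (v i : ℚ)
    -- The negatives of the generators in τ force the functional to vanish on τ. If -g were in the
    -- enlarged cone, then g + a would be in τ for some a in σ, and g too because τ is a face.
    let S' : Finset (Fin n → ℤ) := S ∪ (S.filter fun g => latticeVec g ∈ τ).image Neg.neg
    have hnot : ratVec (-g) ∉ PointedCone.hull ℚ (ratVec '' (S' : Set (Fin n → ℤ))) := by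
      intro h
      have key : ∀ x ∈ PointedCone.hull ℚ (ratVec '' (S' : Set (Fin n → ℤ))),
          ∃ a ∈ σ, ∃ t ∈ τ, (fun i => (x i : ℝ)) = a - t := by
        intro x hx
        induction hx using Submodule.span_induction with
        | mem x hx =>
          obtain ⟨g, hg, rfl⟩ := hx
          rcases Finset.mem_union.mp hg with hg | hg
          · exact ⟨latticeVec g, hS.mem hg, 0, zero_mem _, by ext i; simp [ratVec, latticeVec]⟩
          · obtain ⟨g, hgτ', rfl⟩ := Finset.mem_image.mp hg
            exact ⟨0, zero_mem _, latticeVec g, (Finset.mem_filter.mp hgτ').2, by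
              ext i; simp [ratVec, latticeVec]⟩
        | zero => exact ⟨0, zero_mem _, 0, zero_mem _, by ext i; simp⟩
        | add x y _ _ hx hy =>
          obtain ⟨a, ha, t, ht, h⟩ := hx
          obtain ⟨a', ha', t', ht', h'⟩ := hy
          refine ⟨a + a', add_mem ha ha', t + t', add_mem ht ht', ?_⟩
          rw [add_sub_add_comm, ← h, ← h']
          ext i
          simp
        | smul c x _ hx =>
          obtain ⟨a, ha, t, ht, h⟩ := hx
          have hc : (0 : ℝ) ≤ (c.1 : ℝ) := by exact_mod_cast c.2
          refine ⟨(⟨(c.1 : ℝ), hc⟩ : {c : ℝ // 0 ≤ c}) • a, Submodule.smul_mem _ _ ha,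
            (⟨(c.1 : ℝ), hc⟩ : {c : ℝ // 0 ≤ c}) • t, Submodule.smul_mem _ _ ht, ?_⟩
          rw [← smul_sub, ← h]
          ext i
          change (((c.1 * x i : ℚ)) : ℝ) = (c.1 : ℝ) * (x i : ℝ)
          push_cast
          rfl
      obtain ⟨a, ha, t, ht, h⟩ := key _ h
      have h' : (1 : ℝ) • latticeVec g + a = t := by
        have : (fun i => ((ratVec (-g) i : ℚ) : ℝ)) = -latticeVec g := by
          ext i; simp [ratVec, latticeVec]
        rw [this] at h
        rw [one_smul, eq_sub_iff_add_eq] at *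
        rw [← h]
        abel
      exact hgτ (hτ.mem_of_smul_add_mem (hS.mem hg) ha one_pos (h' ▸ ht))
    obtain ⟨φ, hφ, hφg⟩ := farkas S' ratVec _ hnot
    obtain ⟨m, D, hD, hm⟩ := exists_int_functional φ
    have hmσ : m ∈ dualMonoid σ := hS.mem_dualMonoid_iff.mpr fun g hg => by
      rw [hm]
      have := hφ g (Finset.mem_union_left _ hg)
      exact mul_nonneg hD.le (by exact_mod_cast this)
    refine ⟨m, hmσ, ?_, ?_⟩
    · have key : ∀ v ∈ σ, v ∈ τ → latticePairing m v = 0 := by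
        intro v hv
        rw [hS] at hv
        induction hv using Submodule.span_induction with
        | mem x hx =>
          obtain ⟨g', hg', rfl⟩ := hx
          intro hgτ'
          have h1 := hφ g' (Finset.mem_union_left _ hg')
          have h2 := hφ (-g') (Finset.mem_union_right _
            (Finset.mem_image_of_mem _ (Finset.mem_filter.mpr ⟨hg', hgτ'⟩)))
          have h3 : ratVec (-g') = -ratVec g' := by ext i; simp [ratVec]
          rw [h3, map_neg] at h2
          have h4 : φ (ratVec g') = 0 := by linarith
          rw [hm]
          simp only [ratVec] at h4
          simp [h4]
        | zero => intro _; simp [latticePairing]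
        | add x y hx hy ihx ihy =>
          intro hxy
          rw [latticePairing_add_right]
          have hx' : x ∈ σ := by rw [hS]; exact hx
          have hy' : y ∈ σ := by rw [hS]; exact hy
          rw [ihx (hτ.mem_of_smul_add_mem hx' hy' one_pos (by rwa [one_smul])),
            ihy (hτ.mem_of_smul_add_mem hy' hx' one_pos (by rwa [one_smul, add_comm])), add_zero]
        | smul c x hx ihx =>
          intro hcx
          change latticePairing m (c.1 • x) = 0
          rw [latticePairing_smul_right]
          rcases c.2.eq_or_lt with hc | hc
          · rw [← hc, zero_mul]
          · have hx' : x ∈ σ := by rw [hS]; exact hx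
            rw [ihx (hτ.mem_of_smul_add_mem hx' (zero_mem σ) hc (by rw [add_zero]; exact hcx)),
              mul_zero]
      exact fun v hv => key v (hτ.le hv) hv
    · rw [hm]
      have h3 : ratVec (-g) = -ratVec g := by ext i; simp [ratVec]
      rw [h3, map_neg, neg_lt_zero] at hφg
      exact mul_pos hD (by exact_mod_cast hφg)
  choose! f hf hfτ hfpos using sep
  -- The sum of the separating functionals, one for each generator outside τ, is positive on all of
  -- those generators.
  let T := S.filter fun g => latticeVec g ∉ τ
  have hT : ∀ g ∈ T, g ∈ S ∧ latticeVec g ∉ τ := fun g hg => Finset.mem_filter.mp hg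
  have hmem : ∑ g ∈ T, f g ∈ dualMonoid σ :=
    sum_mem fun g hg => hf g (hT g hg).1 (hT g hg).2
  refine ⟨∑ g ∈ T, f g, hmem, fun v hv => ⟨fun hvτ => ?_, ?_⟩⟩
  · rw [latticePairing_sum_left]
    exact Finset.sum_eq_zero fun g hg => hfτ g (hT g hg).1 (hT g hg).2 v hvτ
  · rw [hS] at hv
    induction hv using Submodule.span_induction with
    | mem x hx =>
      obtain ⟨g, hg, rfl⟩ := hx
      intro h
      by_contra hgτ
      have hgT : g ∈ T := Finset.mem_filter.mpr ⟨hg, hgτ⟩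
      rw [latticePairing_sum_left, Finset.sum_eq_zero_iff_of_nonneg
        fun i hi => hf i (hT i hi).1 (hT i hi).2 _ (hS.mem hg)] at h
      exact (hfpos g hg hgτ).ne' (h g hgT)
    | zero => exact fun _ => zero_mem _
    | add x y hx hy ihx ihy =>
      rw [latticePairing_add_right]
      intro h
      have hx' := hmem x (by rw [hS]; exact hx)
      have hy' := hmem y (by rw [hS]; exact hy)
      exact add_mem (ihx (by linarith)) (ihy (by linarith))
    | smul c x hx ihx =>
      change latticePairing _ (c.1 • x) = 0 → _
      rw [latticePairing_smul_right]
      intro h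
      rcases mul_eq_zero.mp h with h | h
      · have : c = 0 := Subtype.ext h
        rw [this, zero_smul]
        exact zero_mem _
      · exact Submodule.smul_mem _ _ (ihx h)

/-- Multiples of an exposing functional move the dual monoid of a face into that of the cone. -/
theorem exists_nsmul_add_mem_dualMonoid {S : Finset (Fin n → ℤ)} (hS : IsGeneratedBy σ S)
    {f : Fin n → ℤ} (hf : f ∈ dualMonoid σ) (hfτ : ∀ v ∈ σ, v ∈ τ ↔ latticePairing f v = 0)
    {m : Fin n → ℤ} (hm : m ∈ dualMonoid τ) : ∃ k : ℕ, m + k • f ∈ dualMonoid σ := by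
  obtain ⟨k, hk⟩ := exists_nat_common_bound S (fun g => latticePairing m (latticeVec g))
    (fun g => latticePairing f (latticeVec g)) fun g hg => by
      rcases (hf _ (hS.mem hg)).eq_or_lt with h | h
      · exact Or.inr ⟨h.symm, hm _ ((hfτ _ (hS.mem hg)).mpr h.symm)⟩
      · exact Or.inl h
  refine ⟨k, hS.mem_dualMonoid_iff.mpr fun g hg => ?_⟩
  rw [latticePairing_add_left, latticePairing_nsmul_left]
  exact hk g hg

/-- The face of a cone cut out by a functional that is nonnegative on it. -/
theorem exists_face_of_mem_dualMonoid {f : Fin n → ℤ} (hf : f ∈ dualMonoid σ) :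
    ∃ τ : PointedCone ℝ (Fin n → ℝ), τ.IsFaceOf σ ∧
      ∀ v ∈ σ, v ∈ τ ↔ latticePairing f v = 0 := by
  refine ⟨{ carrier := {v | v ∈ σ ∧ latticePairing f v = 0}
            add_mem' := fun {a b} ha hb => ⟨add_mem ha.1 hb.1, by
              rw [latticePairing_add_right, ha.2, hb.2, add_zero]⟩
            zero_mem' := ⟨zero_mem _, by simp [latticePairing]⟩
            smul_mem' := fun c v hv => ⟨Submodule.smul_mem _ _ hv.1, by
              change latticePairing f (c.1 • v) = 0
              rw [latticePairing_smul_right, hv.2, mul_zero]⟩ },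
    ⟨fun v hv => hv.1, fun {x y a} hx hy ha h => ⟨hx, ?_⟩⟩, fun v hv => ⟨fun h => h.2, fun h => ⟨hv, h⟩⟩⟩
  have h1 := h.2
  rw [latticePairing_add_right, latticePairing_smul_right] at h1
  have h2 := hf x hx
  have h3 := hf y hy
  nlinarith [mul_nonneg ha.le h2]

end Cones

/-! ### Exponential coordinates on orbits -/

section ExpCoordinates

variable {n : ℕ} {σ τ : PointedCone ℝ (Fin n → ℝ)}

/-- The complexified pairing between characters and `N ⊗ ℂ`. -/
def complexPairing (m : Fin n → ℤ) (w : Fin n → ℂ) : ℂ := ∑ i, (m i : ℂ) * w i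

theorem complexPairing_add_left (m m' : Fin n → ℤ) (w : Fin n → ℂ) :
    complexPairing (m + m') w = complexPairing m w + complexPairing m' w := by
  simp [complexPairing, add_mul, Finset.sum_add_distrib]

theorem complexPairing_add_right (m : Fin n → ℤ) (w w' : Fin n → ℂ) :
    complexPairing m (w + w') = complexPairing m w + complexPairing m w' := by
  simp [complexPairing, mul_add, Finset.sum_add_distrib]

theorem complexPairing_neg_right (m : Fin n → ℤ) (w : Fin n → ℂ) :
    complexPairing m (-w) = -complexPairing m w := by
  simp [complexPairing]

theorem complexPairing_sub_right (m : Fin n → ℤ) (w w' : Fin n → ℂ) :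
    complexPairing m (w - w') = complexPairing m w - complexPairing m w' := by
  rw [sub_eq_add_neg, complexPairing_add_right, complexPairing_neg_right, sub_eq_add_neg]

theorem complexPairing_smul_right (m : Fin n → ℤ) (c : ℂ) (w : Fin n → ℂ) :
    complexPairing m (c • w) = c * complexPairing m w := by
  simp [complexPairing, Finset.mul_sum, mul_left_comm]

theorem complexPairing_zero_right (m : Fin n → ℤ) : complexPairing m 0 = 0 := by
  simp [complexPairing]

theorem continuous_complexPairing (m : Fin n → ℤ) : Continuous (complexPairing m) := by
  unfold complexPairing
  fun_prop

theorem complexPairing_ofReal (m : Fin n → ℤ) (v : Fin n → ℝ) :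
    complexPairing m (fun i => (v i : ℂ)) = latticePairing m v := by
  simp [complexPairing, latticePairing]

/-- The exponential map of the torus. -/
noncomputable def torusExp (w : Fin n → ℂ) : Fin n → ℂˣ := fun i =>
  Units.mk0 (Complex.exp (w i)) (Complex.exp_ne_zero _)

theorem prod_torusExp_zpow (w : Fin n → ℂ) (m : Fin n → ℤ) :
    ∏ i, (torusExp w i : ℂ) ^ (m i) = Complex.exp (complexPairing m w) := by
  rw [complexPairing, Complex.exp_sum]
  refine Finset.prod_congr rfl fun i _ => ?_
  rw [Complex.exp_int_mul]
  rfl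

theorem torusExp_surjective : Function.Surjective (torusExp (n := n)) := fun t =>
  ⟨fun i => Complex.log (t i), funext fun i => Units.ext (Complex.exp_log (t i).ne_zero)⟩

namespace Chart

/-- The point `exp(w) • x_σ` of the orbit `O_σ`. -/
noncomputable def expPoint (σ : PointedCone ℝ (Fin n → ℝ)) (w : Fin n → ℂ) : Chart σ :=
  torusExp w • dist σ

open Classical in
theorem expPoint_apply (w : Fin n → ℂ) (m : dualMonoid σ) :
    (expPoint σ w).1 m = if IsPerp σ m then Complex.exp (complexPairing m w) else 0 := by
  rw [expPoint, smul_apply, prod_torusExp_zpow]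
  change _ * (if IsPerp σ m then 1 else 0) = _
  split_ifs <;> simp

theorem expPoint_apply_of_isPerp (w : Fin n → ℂ) {m : dualMonoid σ} (hm : IsPerp σ m) :
    (expPoint σ w).1 m = Complex.exp (complexPairing m w) := by
  classical
  rw [expPoint_apply, if_pos hm]

theorem expPoint_apply_of_not_isPerp (w : Fin n → ℂ) {m : dualMonoid σ} (hm : ¬ IsPerp σ m) :
    (expPoint σ w).1 m = 0 := by
  classical
  rw [expPoint_apply, if_neg hm]

theorem expPoint_zero : expPoint σ 0 = dist σ := by
  have : torusExp (0 : Fin n → ℂ) = 1 := funext fun i => Units.ext (by simp [torusExp])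
  rw [expPoint, this, one_smul]

theorem continuous_expPoint : Continuous (expPoint σ) := by
  classical
  refine Continuous.subtype_mk (continuous_pi fun m => ?_) _
  change Continuous fun w => (expPoint σ w).1 m
  simp only [expPoint_apply]
  split_ifs
  · exact Complex.continuous_exp.comp (continuous_complexPairing _)
  · exact continuous_const

theorem apply_nsmul (x : Chart σ) (k : ℕ) (m : dualMonoid σ) : x.1 (k • m) = x.1 m ^ k := by
  induction k with
  | zero => rw [zero_smul, x.2.1, pow_zero]
  | succ k ih => rw [succ_nsmul, x.2.2, ih, pow_succ]

/-- A monomial whose inverse is regular on `U_σ` does not vanish. -/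
theorem apply_ne_zero (x : Chart σ) {m : dualMonoid σ} (hm : IsPerp σ m) : x.1 m ≠ 0 := by
  intro h
  have h1 : x.1 (m + ⟨-m, hm.neg.mem_dualMonoid⟩) = 1 := by
    exact (congrArg x.1 (Subtype.ext (add_neg_cancel _))).trans x.2.1
  rw [x.2.2, h, zero_mul] at h1
  exact zero_ne_one h1

/-! ### The chart of a face as a principal open subset -/

section Localization

theorem isPerp_of_exposing {f : Fin n → ℤ} (hfτ : ∀ v ∈ σ, v ∈ τ ↔ latticePairing f v = 0)
    (hτσ : τ ≤ σ) : IsPerp τ f := fun v hv => (hfτ v (hτσ hv)).mp hv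

variable {S : Finset (Fin n → ℤ)} (hS : IsGeneratedBy σ S) {f : Fin n → ℤ} (hf : f ∈ dualMonoid σ)
  (hfτ : ∀ v ∈ σ, v ∈ τ ↔ latticePairing f v = 0)

/-- The value at `m ∈ S_τ` of the extension to `S_τ` of a point of `U_σ` where the exposing
function `f` of `τ` does not vanish. -/
noncomputable def locValue (y : Chart σ) (m : dualMonoid τ) : ℂ :=
  y.1 ⟨m + (exists_nsmul_add_mem_dualMonoid hS hf hfτ m.2).choose • f,
    (exists_nsmul_add_mem_dualMonoid hS hf hfτ m.2).choose_spec⟩ /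
    y.1 ⟨f, hf⟩ ^ (exists_nsmul_add_mem_dualMonoid hS hf hfτ m.2).choose

/-- Cross-multiplication and multiplicativity of `y` show that the quotient does not depend on the
exponent; this frees `locValue` from the choice in its definition. -/
theorem locValue_eq (y : Chart σ) (hy : y.1 ⟨f, hf⟩ ≠ 0) (m : dualMonoid τ) (k : ℕ)
    (hk : m.1 + k • f ∈ dualMonoid σ) :
    locValue hS hf hfτ y m = y.1 ⟨m.1 + k • f, hk⟩ / y.1 ⟨f, hf⟩ ^ k := by
  rw [locValue]
  generalize_proofs h1 h2
  generalize h1.choose = l at h2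
  rw [div_eq_div_iff (pow_ne_zero _ hy) (pow_ne_zero _ hy), ← apply_nsmul, ← apply_nsmul, ← y.2.2,
    ← y.2.2]
  refine congrArg y.1 (Subtype.ext ?_)
  change m.1 + l • f + k • f = m.1 + k • f + l • f
  abel

/-- The extension to `S_τ` of a point of `U_σ` where the exposing function of `τ` does not
vanish. -/
noncomputable def loc (y : {y : Chart σ // y.1 ⟨f, hf⟩ ≠ 0}) : Chart τ :=
  ⟨locValue hS hf hfτ y.1, by
    rw [locValue_eq hS hf hfτ y.1 y.2 0 0 (by simp)]
    have : (⟨((0 : dualMonoid τ) : Fin n → ℤ) + 0 • f, by simp⟩ : dualMonoid σ) = 0 :=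
      Subtype.ext (by simp)
    rw [this, y.1.2.1]
    simp, fun m m' => by
    obtain ⟨k, hk⟩ := exists_nsmul_add_mem_dualMonoid hS hf hfτ m.2
    obtain ⟨l, hl⟩ := exists_nsmul_add_mem_dualMonoid hS hf hfτ m'.2
    have hkl : (m + m').1 + (k + l) • f ∈ dualMonoid σ := by
      have := add_mem hk hl
      convert this using 1
      simp only [AddSubmonoid.coe_add, add_smul]
      abel
    rw [locValue_eq hS hf hfτ y.1 y.2 m k hk, locValue_eq hS hf hfτ y.1 y.2 m' l hl,
      locValue_eq hS hf hfτ y.1 y.2 (m + m') (k + l) hkl, div_mul_div_comm, ← pow_add, ← y.1.2.2]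
    refine congrArg₂ _ (congrArg y.1.1 (Subtype.ext ?_)) rfl
    simp only [AddSubmonoid.coe_add, add_smul]
    abel⟩

theorem continuous_loc : Continuous (loc hS hf hfτ) := by
  refine Continuous.subtype_mk (continuous_pi fun m => ?_) _
  refine Continuous.div ?_ ?_ fun y => pow_ne_zero _ y.2
  · exact (continuous_eval _).comp continuous_subtype_val
  · exact ((continuous_eval _).comp continuous_subtype_val).pow _

theorem incl_loc (hτσ : τ ≤ σ) (y : {y : Chart σ // y.1 ⟨f, hf⟩ ≠ 0}) :
    incl hτσ (loc hS hf hfτ y) = y.1 := by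
  refine Subtype.ext (funext fun m => ?_)
  refine (locValue_eq hS hf hfτ y.1 y.2 ⟨m, dualMonoid_anti hτσ m.2⟩ 0 (by simp)).trans ?_
  rw [pow_zero, div_one]
  exact congrArg y.1.1 (Subtype.ext (by simp))

end Localization

/-- On U_τ the function f is invertible, so x(m) = x(m + kf) / x(f)^k is determined by values on
S_σ. -/
theorem incl_injective_of_exposing {S : Finset (Fin n → ℤ)}
    (hS : IsGeneratedBy σ S) {f : Fin n → ℤ} (hf : f ∈ dualMonoid σ)
    (hfτ : ∀ v ∈ σ, v ∈ τ ↔ latticePairing f v = 0) (hτσ : τ ≤ σ) :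
    Function.Injective (incl hτσ) := fun x y h => by
  have hfp := isPerp_of_exposing hfτ hτσ
  have key : ∀ m : dualMonoid σ,
      x.1 ⟨m, dualMonoid_anti hτσ m.2⟩ = y.1 ⟨m, dualMonoid_anti hτσ m.2⟩ := fun m => congrArg (fun z => z.1 m) h
  refine Subtype.ext (funext fun m => ?_)
  obtain ⟨k, hk⟩ := exists_nsmul_add_mem_dualMonoid hS hf hfτ m.2
  have h1 := key ⟨_, hk⟩
  have hsplit : ∀ x : Chart τ, x.1 ⟨m.1 + k • f, dualMonoid_anti hτσ hk⟩ =
      x.1 m * x.1 ⟨f, dualMonoid_anti hτσ hf⟩ ^ k := fun x => by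
    rw [← apply_nsmul, ← x.2.2]
    rfl
  rw [hsplit, hsplit, ← key ⟨f, hf⟩] at h1
  exact mul_right_cancel₀ (pow_ne_zero _ (apply_ne_zero x hfp)) h1

/-- The image of U_τ is the open locus f ≠ 0 of U_σ, where `loc` is a continuous inverse. -/
theorem isOpenMap_incl_of_exposing {S : Finset (Fin n → ℤ)}
    (hS : IsGeneratedBy σ S) {f : Fin n → ℤ} (hf : f ∈ dualMonoid σ)
    (hfτ : ∀ v ∈ σ, v ∈ τ ↔ latticePairing f v = 0) (hτσ : τ ≤ σ) :
    IsOpenMap (incl hτσ) := fun O hO => by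
  have hfp := isPerp_of_exposing hfτ hτσ
  have : incl hτσ '' O = Subtype.val '' (loc hS hf hfτ ⁻¹' O) := by
    ext y
    constructor
    · rintro ⟨x, hx, rfl⟩
      have hy : (incl hτσ x).1 ⟨f, hf⟩ ≠ 0 :=
        apply_ne_zero x (m := ⟨f, dualMonoid_anti hτσ hf⟩) hfp
      refine ⟨⟨incl hτσ x, hy⟩, ?_, rfl⟩
      rwa [Set.mem_preimage, incl_injective_of_exposing hS hf hfτ hτσ
        (incl_loc hS hf hfτ hτσ ⟨incl hτσ x, hy⟩)]
    · rintro ⟨y, hy, rfl⟩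
      exact ⟨_, hy, incl_loc hS hf hfτ hτσ y⟩
  rw [this]
  have hopen : IsOpen {y : Chart σ | y.1 ⟨f, hf⟩ ≠ 0} :=
    isOpen_compl_singleton.preimage (continuous_eval _)
  exact hopen.isOpenMap_subtype_val _ (hO.preimage (continuous_loc hS hf hfτ))

/-- A point of `U_τ` that vanishes outside `τ^⊥` lies in the orbit `O_τ`. -/
theorem exists_eq_expPoint {S : Finset (Fin n → ℤ)} (hS : IsGeneratedBy τ S) (x : Chart τ)
    (hx : ∀ m : dualMonoid τ, ¬ IsPerp τ m → x.1 m = 0) : ∃ w, expPoint τ w = x := by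
  obtain ⟨r, hr, hr'⟩ := exists_perp_retraction hS
  -- The restriction of x to τ^⊥ ∩ M has nonzero values and extends, through the retraction, to a
  -- character of all of M, that is, to a point of the torus.
  let φ : (Fin n → ℤ) →+ Additive ℂˣ := AddMonoidHom.mk' (fun m => Additive.ofMul
    (Units.mk0 (x.1 ⟨r m, (hr m).mem_dualMonoid⟩) (apply_ne_zero x (hr m)))) fun a b => by
      rw [← ofMul_mul]
      refine congrArg _ (Units.ext ?_)
      rw [Units.val_mul, Units.val_mk0, Units.val_mk0, Units.val_mk0, ← x.2.2]
      exact congrArg x.1 (Subtype.ext (map_add r a b))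
  obtain ⟨w, hw⟩ := torusExp_surjective fun i => (φ (Pi.single i 1)).toMul
  refine ⟨w, Subtype.ext (funext fun m => ?_)⟩
  by_cases hm : IsPerp τ m
  · rw [expPoint_apply_of_isPerp w hm, ← prod_torusExp_zpow, hw]
    have h1 : m.1 = ∑ i, m.1 i • (Pi.single i 1 : Fin n → ℤ) := by
      ext j
      simp [Finset.sum_apply, Pi.single_apply]
    have h2 : (φ m.1).toMul = ∏ i, (φ (Pi.single i 1)).toMul ^ m.1 i := by
      conv_lhs => rw [h1, map_sum]
      rw [toMul_sum]
      refine Finset.prod_congr rfl fun i _ => ?_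
      rw [map_zsmul, toMul_zsmul]
    have h3 : ((φ m.1).toMul : ℂ) = x.1 m := congrArg x.1 (Subtype.ext (hr' m hm))
    rw [← h3, h2]
    simp
  · rw [expPoint_apply_of_not_isPerp w hm, hx m hm]

/-- Every point of `U_σ` lies in the orbit of a face of `σ`. -/
theorem exists_face_support {S : Finset (Fin n → ℤ)} (hS : IsGeneratedBy σ S) (x : Chart σ) :
    ∃ τ : PointedCone ℝ (Fin n → ℝ), τ.IsFaceOf σ ∧ ∃ (f : Fin n → ℤ) (hf : f ∈ dualMonoid σ),
      (∀ v ∈ σ, v ∈ τ ↔ latticePairing f v = 0) ∧ x.1 ⟨f, hf⟩ ≠ 0 ∧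
      ∀ m : dualMonoid σ, x.1 m ≠ 0 → IsPerp τ m := by
  classical
  let F : AddSubmonoid (Fin n → ℤ) :=
    { carrier := {m | ∃ h : m ∈ dualMonoid σ, x.1 ⟨m, h⟩ ≠ 0}
      zero_mem' := ⟨zero_mem _, by
        have := x.2.1
        exact fun h => one_ne_zero (this.symm.trans h)⟩
      add_mem' := fun {a b} ⟨ha, ha'⟩ ⟨hb, hb'⟩ => ⟨add_mem ha hb, by
        have := x.2.2 ⟨a, ha⟩ ⟨b, hb⟩
        exact fun h => mul_ne_zero ha' hb' (this.symm.trans h)⟩ }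
  -- For each g pick a monomial not vanishing at x that pairs nontrivially with g, if there is one.
  -- The sum of these over the generators cuts out the smallest face on which all monomials in `F`
  -- vanish.
  have hg : ∀ g : Fin n → ℤ, ∃ m ∈ F, latticePairing m (latticeVec g) = 0 →
      ∀ m' ∈ F, latticePairing m' (latticeVec g) = 0 := fun g => by
    by_cases h : ∃ m ∈ F, latticePairing m (latticeVec g) ≠ 0
    · obtain ⟨m, hm, h⟩ := h
      exact ⟨m, hm, fun h' => (h h').elim⟩
    · push Not at h
      exact ⟨0, zero_mem _, fun _ => h⟩
  choose p hp hp' using hg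
  obtain ⟨hf, hf'⟩ : ∑ g ∈ S, p g ∈ F := sum_mem fun g _ => hp g
  obtain ⟨τ, hτ, hfτ⟩ := exists_face_of_mem_dualMonoid hf
  refine ⟨τ, hτ, _, hf, hfτ, hf', fun m hm v hv => ?_⟩
  -- A multiple of the exposing function dominates m on σ; on τ the exposing function is 0, whence m
  -- ≤ 0 there.
  obtain ⟨k, hk⟩ := exists_nat_common_bound S (fun g => latticePairing (-m.1) (latticeVec g))
    (fun g => latticePairing (∑ g ∈ S, p g) (latticeVec g)) fun g hg => by
      rcases (hf _ (hS.mem hg)).eq_or_lt with h | h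
      · refine Or.inr ⟨h.symm, ?_⟩
        have h' := h.symm
        rw [latticePairing_sum_left, Finset.sum_eq_zero_iff_of_nonneg
          fun i _ => (hp i).1 _ (hS.mem hg)] at h'
        rw [latticePairing_neg_left, hp' g (h' g hg) m.1 ⟨m.2, hm⟩, neg_zero]
      · exact Or.inl h
  have hmem : -m.1 + k • ∑ g ∈ S, p g ∈ dualMonoid σ := hS.mem_dualMonoid_iff.mpr fun g hg => by
    rw [latticePairing_add_left, latticePairing_nsmul_left]
    exact hk g hg
  have h1 := hmem v (hτ.le hv)
  rw [latticePairing_add_left, latticePairing_nsmul_left, (hfτ v (hτ.le hv)).mp hv,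
    latticePairing_neg_left] at h1
  have h2 := m.2 v (hτ.le hv)
  linarith

end Chart

end ExpCoordinates

/-! ### Complex spans and period groups of cones -/

section Lattices

variable {n : ℕ} {σ τ : PointedCone ℝ (Fin n → ℝ)}

/-- The complexification of the linear span of `σ`, as the annihilator of `σ^⊥`. -/
def spanC (σ : PointedCone ℝ (Fin n → ℝ)) : Submodule ℂ (Fin n → ℂ) where
  carrier := {k | ∀ m, IsPerp σ m → complexPairing m k = 0}
  add_mem' := fun ha hb m hm => by rw [complexPairing_add_right, ha m hm, hb m hm, add_zero]
  zero_mem' := fun m _ => complexPairing_zero_right m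
  smul_mem' := fun c k hk m hm => by rw [complexPairing_smul_right, hk m hm, mul_zero]

/-- The kernel of the exponential parametrization of the orbit `O_σ`. -/
def periods (σ : PointedCone ℝ (Fin n → ℝ)) : AddSubgroup (Fin n → ℂ) where
  carrier := {l | ∀ m, IsPerp σ m → ∃ k : ℤ, complexPairing m l = k * (2 * Real.pi * Complex.I)}
  add_mem' := fun {a b} ha hb m hm => by
    obtain ⟨k, hk⟩ := ha m hm
    obtain ⟨l, hl⟩ := hb m hm
    exact ⟨k + l, by rw [complexPairing_add_right, hk, hl]; push_cast; ring⟩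
  zero_mem' := fun m _ => ⟨0, by simp [complexPairing_zero_right]⟩
  neg_mem' := fun {a} ha m hm => by
    obtain ⟨k, hk⟩ := ha m hm
    exact ⟨-k, by rw [complexPairing_neg_right, hk]; push_cast; ring⟩

theorem spanC_mono (h : τ ≤ σ) : spanC τ ≤ spanC σ := fun _ hk m hm => hk m (hm.anti h)

theorem periods_mono (h : τ ≤ σ) : periods τ ≤ periods σ := fun _ hk m hm => hk m (hm.anti h)

theorem mem_periods_of_mem_spanC {k : Fin n → ℂ} (hk : k ∈ spanC σ) : k ∈ periods σ :=
  fun m hm => ⟨0, by simp [hk m hm]⟩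

theorem re_complexPairing_of_mem_periods {l : Fin n → ℂ} (hl : l ∈ periods σ) {m : Fin n → ℤ}
    (hm : IsPerp σ m) : (complexPairing m l).re = 0 := by
  obtain ⟨k, hk⟩ := hl m hm
  rw [hk]
  simp

/-- The period of an integral cocharacter. -/
noncomputable def intPeriod (ν : Fin n → ℤ) : Fin n → ℂ := fun i => ν i * (2 * Real.pi * Complex.I)

theorem complexPairing_intPeriod (m ν : Fin n → ℤ) :
    complexPairing m (intPeriod ν) = (∑ i, m i * ν i : ℤ) * (2 * Real.pi * Complex.I) := by
  simp only [complexPairing, intPeriod]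
  push_cast
  rw [Finset.sum_mul]
  exact Finset.sum_congr rfl fun i _ => by ring

theorem intPeriod_mem_periods (ν : Fin n → ℤ) : intPeriod ν ∈ periods σ :=
  fun m _ => ⟨_, complexPairing_intPeriod m ν⟩

/-- The vector on the right is the transpose of `r` applied to `w`. -/
theorem complexPairing_retraction (r : (Fin n → ℤ) →ₗ[ℤ] (Fin n → ℤ)) (m : Fin n → ℤ)
    (w : Fin n → ℂ) : complexPairing (r m) w =
      complexPairing m fun i => complexPairing (r (Pi.single i 1)) w := by
  let φ : (Fin n → ℤ) →+ ℂ := AddMonoidHom.mk' (fun m => complexPairing m w)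
    fun a b => complexPairing_add_left a b w
  have h1 : m = ∑ i, m i • (Pi.single i 1 : Fin n → ℤ) := by
    ext j
    simp [Finset.sum_apply, Pi.single_apply]
  change φ (r m) = _
  conv_lhs => rw [h1, map_sum, map_sum]
  refine Finset.sum_congr rfl fun i _ => ?_
  rw [map_zsmul, map_zsmul, zsmul_eq_mul]
  rfl

/-- Periods of `O_σ` are integral modulo the span of `σ`. -/
theorem exists_intPeriod {S : Finset (Fin n → ℤ)} (hS : IsGeneratedBy σ S) {l : Fin n → ℂ}
    (hl : l ∈ periods σ) : ∃ ν, l - intPeriod ν ∈ spanC σ := by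
  obtain ⟨r, hr, hr'⟩ := exists_perp_retraction hS
  -- The transpose of the retraction takes l to an integral period, and differs from the identity by
  -- vectors in the span.
  choose ν hν using fun i => hl (r (Pi.single i 1)) (hr _)
  refine ⟨ν, fun m hm => ?_⟩
  have : (fun i => complexPairing (r (Pi.single i 1)) l) = intPeriod ν := funext hν
  rw [complexPairing_sub_right]
  nth_rw 1 [← hr' m hm]
  rw [complexPairing_retraction, this, sub_self]

/-- Small periods lie in the span. -/
theorem exists_pos_mem_spanC {S : Finset (Fin n → ℤ)} (hS : IsGeneratedBy σ S) :
    ∃ ε > 0, ∀ l ∈ periods σ, ‖l‖ < ε → l ∈ spanC σ := by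
  obtain ⟨r, hr, hr'⟩ := exists_perp_retraction hS
  -- A period takes values in 2πiℤ on the characters r(e_i), so values of norm less than 1 vanish;
  -- these values determine the pairing with all of σ^⊥.
  have h : ∀ᶠ l : Fin n → ℂ in nhds 0, ∀ i, ‖complexPairing (r (Pi.single i 1)) l‖ < 1 := by
    rw [Filter.eventually_all]
    intro i
    have hc := (continuous_complexPairing (r (Pi.single i 1))).norm.tendsto (0 : Fin n → ℂ)
    rw [complexPairing_zero_right, norm_zero] at hc
    exact hc.eventually (gt_mem_nhds one_pos)
  obtain ⟨ε, hε, h⟩ := Metric.eventually_nhds_iff.mp h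
  refine ⟨ε, hε, fun l hl hlε m hm => ?_⟩
  have h0 : (fun i => complexPairing (r (Pi.single i 1)) l) = 0 := by
    funext i
    obtain ⟨k, hk⟩ := hl _ (hr (Pi.single i 1))
    have h1 := h (by rwa [dist_zero_right]) i
    rw [hk, norm_mul, norm_mul, norm_mul, Complex.norm_I, mul_one] at h1
    have hk0 : k = 0 := by
      by_contra hk0
      have h2 : (1 : ℝ) ≤ ‖(k : ℂ)‖ := by
        rw [Complex.norm_intCast]
        exact_mod_cast Int.one_le_abs hk0
      have h3 : (1 : ℝ) ≤ ‖(2 : ℂ)‖ * ‖(Real.pi : ℂ)‖ := by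
        rw [Complex.norm_real, Real.norm_of_nonneg Real.pi_pos.le]
        have := Real.pi_gt_three
        norm_num
        linarith
      nlinarith
    simp [hk, hk0]
  rw [← hr' m hm, complexPairing_retraction, h0, complexPairing_zero_right]

namespace Chart

theorem expPoint_eq_iff {z w : Fin n → ℂ} :
    expPoint σ z = expPoint σ w ↔ z - w ∈ periods σ := by
  constructor
  · intro h m hm
    have h1 : (expPoint σ z).1 ⟨m, hm.mem_dualMonoid⟩ = (expPoint σ w).1 ⟨m, hm.mem_dualMonoid⟩ :=
      congrArg (fun x => x.1 ⟨m, hm.mem_dualMonoid⟩) h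
    rw [expPoint_apply_of_isPerp z (m := ⟨m, hm.mem_dualMonoid⟩) hm,
      expPoint_apply_of_isPerp w (m := ⟨m, hm.mem_dualMonoid⟩) hm,
      Complex.exp_eq_exp_iff_exists_int] at h1
    obtain ⟨k, hk⟩ := h1
    exact ⟨k, by rw [complexPairing_sub_right]; linear_combination hk⟩
  · intro h
    refine Subtype.ext (funext fun m => ?_)
    by_cases hm : IsPerp σ m
    · rw [expPoint_apply_of_isPerp z hm, expPoint_apply_of_isPerp w hm,
        Complex.exp_eq_exp_iff_exists_int]
      obtain ⟨k, hk⟩ := h m hm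
      exact ⟨k, by rw [complexPairing_sub_right] at hk; linear_combination hk⟩
    · rw [expPoint_apply_of_not_isPerp z hm, expPoint_apply_of_not_isPerp w hm]

theorem proj_incl_expPoint (h : τ ≤ σ) (w : Fin n → ℂ) :
    proj σ (incl h (expPoint τ w)) = expPoint σ w := proj_incl_smul_dist h _

end Chart

end Lattices

/-! ### Orbit decomposition and topology of the toric variety -/

namespace Fan

variable {n : ℕ} (Δ : Fan n)

instance : Finite Δ.Cone := Δ.finite

theorem exists_generators (σ : Δ.Cone) : ∃ S, IsGeneratedBy σ.1 S := Δ.rational σ.1 σ.2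

theorem isFaceOf {τ σ : Δ.Cone} (h : τ ≤ σ) : τ.1.IsFaceOf σ.1 := by
  have := Δ.inter_isFaceOf σ.1 σ.2 τ.1 τ.2
  rwa [inf_eq_right.mpr (show τ.1 ≤ σ.1 from h)] at this

theorem exists_exposing {τ σ : Δ.Cone} (h : τ ≤ σ) :
    ∃ m ∈ dualMonoid σ.1, ∀ v ∈ σ.1, v ∈ τ.1 ↔ latticePairing m v = 0 := by
  obtain ⟨S, hS⟩ := Δ.exists_generators σ
  exact _root_.exists_exposing hS (Δ.isFaceOf h)

theorem isOpenMap_incl {τ σ : Δ.Cone} (h : τ ≤ σ) : IsOpenMap (Chart.incl (show τ.1 ≤ σ.1 from h)) := by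
  obtain ⟨S, hS⟩ := Δ.exists_generators σ
  obtain ⟨f, hf, hfτ⟩ := Δ.exists_exposing h
  exact Chart.isOpenMap_incl_of_exposing hS hf hfτ h

theorem incl_injective {τ σ : Δ.Cone} (h : τ ≤ σ) :
    Function.Injective (Chart.incl (show τ.1 ≤ σ.1 from h)) := by
  obtain ⟨S, hS⟩ := Δ.exists_generators σ
  obtain ⟨f, hf, hfτ⟩ := Δ.exists_exposing h
  exact Chart.incl_injective_of_exposing hS hf hfτ h

theorem chartMap_incl {τ σ : Δ.Cone} (h : τ ≤ σ) (x : Chart τ.1) :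
    Δ.chartMap σ (Chart.incl h x) = Δ.chartMap τ x :=
  (Quot.sound ⟨h, rfl⟩ : Quot.mk _ (⟨τ, x⟩ : Σ σ : Δ.Cone, Chart σ.1) = Quot.mk _ ⟨σ, _⟩).symm

/-- The orbit decomposition of `U_σ`. -/
theorem exists_incl_expPoint (σ : Δ.Cone) (x : Chart σ.1) :
    ∃ (τ : Δ.Cone) (h : τ ≤ σ) (w : Fin n → ℂ), Chart.incl h (Chart.expPoint τ.1 w) = x := by
  obtain ⟨S, hS⟩ := Δ.exists_generators σ
  obtain ⟨τ, hτ, f, hf, hfτ, hxf, hx⟩ := Chart.exists_face_support hS x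
  let τ' : Δ.Cone := ⟨τ, Δ.face_mem σ.1 σ.2 τ hτ⟩
  obtain ⟨S', hS'⟩ := Δ.exists_generators τ'
  have hfp : IsPerp τ f := Chart.isPerp_of_exposing hfτ hτ.le
  obtain ⟨w, hw⟩ := Chart.exists_eq_expPoint hS' (Chart.loc hS hf hfτ ⟨x, hxf⟩) fun m hm => by
    obtain ⟨k, hk⟩ := exists_nsmul_add_mem_dualMonoid hS hf hfτ m.2
    refine (Chart.locValue_eq hS hf hfτ x hxf m k hk).trans ?_
    by_contra h
    refine hm ?_
    have h1 : IsPerp τ (m.1 + k • f) := hx ⟨_, hk⟩ fun h0 => h (by rw [h0, zero_div])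
    have h2 := h1.add (hfp.nsmul k).neg
    rwa [add_neg_cancel_right] at h2
  refine ⟨τ', hτ.le, w, ?_⟩
  rw [hw]
  exact Chart.incl_loc hS hf hfτ hτ.le ⟨x, hxf⟩

/-- A character exposing τ does not vanish on O_τ; if it does not vanish on O_τ' either, it is
orthogonal to τ', which places τ' in the face τ. -/
theorem le_of_incl_expPoint_eq {τ τ' σ : Δ.Cone} (h : τ ≤ σ) (h' : τ' ≤ σ) {w w' : Fin n → ℂ}
    (he : Chart.incl h (Chart.expPoint τ.1 w) = Chart.incl h' (Chart.expPoint τ'.1 w')) :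
    τ' ≤ τ := by
  obtain ⟨f, hf, hfτ⟩ := Δ.exists_exposing h
  have hfp : IsPerp τ.1 f := Chart.isPerp_of_exposing hfτ h
  have h1 : (Chart.expPoint τ.1 w).1 ⟨f, dualMonoid_anti h hf⟩ =
      (Chart.expPoint τ'.1 w').1 ⟨f, dualMonoid_anti h' hf⟩ := congrArg (fun x => x.1 ⟨f, hf⟩) he
  have h2 : IsPerp τ'.1 f := by
    by_contra hn
    rw [Chart.expPoint_apply_of_not_isPerp w' (m := ⟨f, dualMonoid_anti h' hf⟩) hn] at h1
    exact Chart.apply_ne_zero _ (m := ⟨f, dualMonoid_anti h hf⟩) hfp h1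
  exact fun v hv => (hfτ v (h' hv)).mpr (h2 v hv)

theorem eq_of_incl_expPoint_eq {τ τ' σ : Δ.Cone} (h : τ ≤ σ) (h' : τ' ≤ σ) {w w' : Fin n → ℂ}
    (he : Chart.incl h (Chart.expPoint τ.1 w) = Chart.incl h' (Chart.expPoint τ'.1 w')) :
    (⟨τ, Chart.expPoint τ.1 w⟩ : Σ σ : Δ.Cone, Chart σ.1) = ⟨τ', Chart.expPoint τ'.1 w'⟩ := by
  obtain rfl : τ = τ' :=
    le_antisymm (Δ.le_of_incl_expPoint_eq h' h he.symm) (Δ.le_of_incl_expPoint_eq h h' he)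
  rw [Δ.incl_injective h he]

/-- The orbit point underlying a point of a chart. -/
noncomputable def orbitRep (x : Σ σ : Δ.Cone, Chart σ.1) : Σ σ : Δ.Cone, Chart σ.1 :=
  ⟨(Δ.exists_incl_expPoint x.1 x.2).choose,
    Chart.expPoint _ (Δ.exists_incl_expPoint x.1 x.2).choose_spec.choose_spec.choose⟩

theorem orbitRep_eq (σ : Δ.Cone) (x : Chart σ.1) {τ : Δ.Cone} (h : τ ≤ σ) {w : Fin n → ℂ}
    (hx : Chart.incl h (Chart.expPoint τ.1 w) = x) :
    Δ.orbitRep ⟨σ, x⟩ = ⟨τ, Chart.expPoint τ.1 w⟩ :=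
  Δ.eq_of_incl_expPoint_eq (Δ.exists_incl_expPoint σ x).choose_spec.choose h
    ((Δ.exists_incl_expPoint σ x).choose_spec.choose_spec.choose_spec.trans hx.symm)

/-- The orbit point underlying a point of the toric variety. -/
noncomputable def varietyRep (x : Δ.Variety) : Σ σ : Δ.Cone, Chart σ.1 :=
  Quot.lift Δ.orbitRep (fun a b => by
    rintro ⟨h, hab⟩
    obtain ⟨α, x⟩ := a
    obtain ⟨β, y⟩ := b
    obtain ⟨τ, hτ, w, rfl⟩ := Δ.exists_incl_expPoint α x
    rw [Δ.orbitRep_eq α _ hτ rfl]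
    exact (Δ.orbitRep_eq β y (hτ.trans h) hab).symm) x

/-- The parametrization `w ↦ exp(w) • x_σ` of the orbit `O_σ`. -/
noncomputable def orbitExp (σ : Δ.Cone) : C(Fin n → ℂ, Δ.Orbit σ) where
  toFun w := ⟨Chart.expPoint σ.1 w, ⟨torusExp w, rfl⟩⟩
  continuous_toFun := Chart.continuous_expPoint.subtype_mk _

/-- The parametrization `w ↦ exp(w) • x_σ` of the orbit `O_σ` in the toric variety. -/
noncomputable def expMap (σ : Δ.Cone) : C(Fin n → ℂ, Δ.Variety) := (Δ.orbitMap σ).comp (Δ.orbitExp σ)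

theorem expMap_apply (σ : Δ.Cone) (w : Fin n → ℂ) :
    Δ.expMap σ w = Δ.chartMap σ (Chart.expPoint σ.1 w) := rfl

theorem chartMap_incl_expPoint {τ σ : Δ.Cone} (h : τ ≤ σ) (w : Fin n → ℂ) :
    Δ.chartMap σ (Chart.incl h (Chart.expPoint τ.1 w)) = Δ.expMap τ w := Δ.chartMap_incl h _

theorem varietyRep_expMap (σ : Δ.Cone) (w : Fin n → ℂ) :
    Δ.varietyRep (Δ.expMap σ w) = ⟨σ, Chart.expPoint σ.1 w⟩ :=
  Δ.orbitRep_eq σ _ le_rfl rfl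

theorem expMap_eq_of_mem {σ : Δ.Cone} {z w : Fin n → ℂ} (h : z - w ∈ periods σ.1) :
    Δ.expMap σ z = Δ.expMap σ w := by
  rw [expMap_apply, expMap_apply, Chart.expPoint_eq_iff.mpr h]

/-- The gluing makes no further identifications: `varietyRep` is well defined on the quotient and
recovers the cone and the point of the orbit. -/
theorem expMap_eq_iff {σ : Δ.Cone} {z w : Fin n → ℂ} :
    Δ.expMap σ z = Δ.expMap σ w ↔ z - w ∈ periods σ.1 := by
  refine ⟨fun h => ?_, Δ.expMap_eq_of_mem⟩
  have h1 := congrArg Δ.varietyRep h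
  rw [varietyRep_expMap, varietyRep_expMap] at h1
  exact Chart.expPoint_eq_iff.mp (eq_of_heq (Sigma.mk.inj h1).2)

theorem cone_eq_of_expMap_eq {σ τ : Δ.Cone} {z w : Fin n → ℂ} (h : Δ.expMap σ z = Δ.expMap τ w) :
    σ = τ := by
  have h1 := congrArg Δ.varietyRep h
  rw [varietyRep_expMap, varietyRep_expMap] at h1
  exact (Sigma.mk.inj h1).1

theorem exists_expMap_eq (x : Δ.Variety) : ∃ σ w, Δ.expMap σ w = x := by
  obtain ⟨⟨σ, x⟩, rfl⟩ := Quot.exists_rep x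
  obtain ⟨τ, h, w, rfl⟩ := Δ.exists_incl_expPoint σ x
  exact ⟨τ, w, (Δ.chartMap_incl_expPoint h w).symm⟩

theorem exists_orbitExp_eq {σ : Δ.Cone} (x : Δ.Orbit σ) : ∃ w, Δ.orbitExp σ w = x := by
  obtain ⟨x, t, rfl⟩ := x
  obtain ⟨w, rfl⟩ := torusExp_surjective t
  exact ⟨w, rfl⟩

theorem orbitExp_eq_iff {σ : Δ.Cone} {z w : Fin n → ℂ} :
    Δ.orbitExp σ z = Δ.orbitExp σ w ↔ z - w ∈ periods σ.1 := by
  rw [← Chart.expPoint_eq_iff]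
  exact Subtype.ext_iff

theorem orbitExp_zero (σ : Δ.Cone) : Δ.orbitExp σ 0 = Δ.basePoint σ :=
  Subtype.ext Chart.expPoint_zero

theorem orbitProj_orbitExp {τ σ : Δ.Cone} (h : τ ≤ σ) (w : Fin n → ℂ) :
    Δ.orbitProj h (Δ.orbitExp τ w) = Δ.orbitExp σ w :=
  Subtype.ext (Chart.proj_incl_expPoint h w)

/-- Two charts meet exactly along the charts of their common faces, so the trace of `O` on another
chart is a union of images of open sets under the open maps `incl`. -/
theorem isOpenMap_chartMap (σ : Δ.Cone) : IsOpenMap (Δ.chartMap σ) := by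
  intro O hO
  refine isOpen_coinduced.mpr (isOpen_sigma_iff.mpr fun σ' => ?_)
  have : Sigma.mk σ' ⁻¹' (Quot.mk _ ⁻¹' (Δ.chartMap σ '' O)) =
      ⋃ (τ : Δ.Cone) (h : τ ≤ σ) (h' : τ ≤ σ'),
        Set.image (Chart.incl h') (Chart.incl h ⁻¹' O) := by
    ext y
    simp only [Set.mem_preimage, Set.mem_iUnion, Set.mem_image]
    constructor
    · rintro ⟨x, hx, hxy⟩
      change Δ.chartMap σ x = Δ.chartMap σ' y at hxy
      obtain ⟨τ, h, w, rfl⟩ := Δ.exists_incl_expPoint σ x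
      obtain ⟨τ', h', w', rfl⟩ := Δ.exists_incl_expPoint σ' y
      rw [chartMap_incl_expPoint, chartMap_incl_expPoint] at hxy
      obtain rfl := Δ.cone_eq_of_expMap_eq hxy
      rw [expMap_eq_iff, ← Chart.expPoint_eq_iff] at hxy
      exact ⟨τ, h, h', _, hx, by rw [hxy]⟩
    · rintro ⟨τ, h, h', x, hx, rfl⟩
      exact ⟨_, hx, (Δ.chartMap_incl h x).trans (Δ.chartMap_incl h' x).symm⟩
  refine (congrArg IsOpen this).mpr ?_
  exact isOpen_iUnion fun τ => isOpen_iUnion fun h => isOpen_iUnion fun h' =>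
    Δ.isOpenMap_incl h' _ (hO.preimage (Chart.incl h).continuous)

theorem proj_mem_orbit (σ : Δ.Cone) (x : Chart σ.1) :
    Chart.proj σ.1 x ∈ MulAction.orbit (Fin n → ℂˣ) (Chart.dist σ.1) := by
  obtain ⟨τ, h, w, rfl⟩ := Δ.exists_incl_expPoint σ x
  rw [Chart.proj_incl_expPoint]
  exact ⟨torusExp w, rfl⟩

/-- The canonical retraction `U_σ → O_σ`. -/
noncomputable def orbitRetraction (σ : Δ.Cone) : C(Chart σ.1, Δ.Orbit σ) where
  toFun x := ⟨Chart.proj σ.1 x, Δ.proj_mem_orbit σ x⟩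
  continuous_toFun := (Chart.proj σ.1).continuous.subtype_mk _

theorem orbitRetraction_incl_expPoint {τ σ : Δ.Cone} (h : τ ≤ σ) (w : Fin n → ℂ) :
    Δ.orbitRetraction σ (Chart.incl h (Chart.expPoint τ.1 w)) = Δ.orbitExp σ w :=
  Subtype.ext (Chart.proj_incl_expPoint h w)

/-- The coordinates of the orbit given by the characters r(e_i) turn the map into the coordinatewise
exponential, which is open; the directions lost in these coordinates lie in `spanC σ`, along which
the map is constant. -/
theorem isOpenMap_orbitExp (σ : Δ.Cone) : IsOpenMap (Δ.orbitExp σ) := by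
  obtain ⟨S, hS⟩ := Δ.exists_generators σ
  obtain ⟨r, hr, hr'⟩ := exists_perp_retraction hS
  rw [isOpenMap_iff_nhds_le]
  intro w₀ U hU
  -- R is the transpose of the retraction; it is the identity modulo `spanC σ`.
  let R : (Fin n → ℂ) → Fin n → ℂ := fun w i => complexPairing (r (Pi.single i 1)) w
  have hR : ∀ m, IsPerp σ.1 m → ∀ w, complexPairing m (R w) = complexPairing m w := fun m hm w => by
    rw [← complexPairing_retraction, hr' m hm]
  let q : Δ.Orbit σ → Fin n → ℂ := fun y i => y.1.1 ⟨r (Pi.single i 1), (hr _).mem_dualMonoid⟩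
  have hq : Continuous q := continuous_pi fun i => (Chart.continuous_eval _).comp continuous_subtype_val
  have hqE : ∀ w, q (Δ.orbitExp σ w) = fun i => Complex.exp (R w i) := fun w => funext fun i =>
    Chart.expPoint_apply_of_isPerp w (m := ⟨r (Pi.single i 1), (hr _).mem_dualMonoid⟩) (hr _)
  have hopen : IsOpenMap fun u : Fin n → ℂ => fun i => Complex.exp (u i) :=
    IsOpenMap.piMap (fun _ => Complex.isOpenMap_exp) (by simp)
  -- Only points of the form w₀ - R w₀ + u are needed, and u = R w₀ gives w₀ itself.
  have hU' : (fun u => w₀ - R w₀ + u) ⁻¹' (Δ.orbitExp σ ⁻¹' U) ∈ nhds (R w₀) := by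
    have hc : Continuous fun u : Fin n → ℂ => w₀ - R w₀ + u := by fun_prop
    refine hc.continuousAt ?_
    rw [sub_add_cancel]
    exact hU
  have hnear := hopen.image_mem_nhds hU'
  rw [← hqE] at hnear
  filter_upwards [hq.continuousAt hnear] with y hy
  obtain ⟨u, hu, huy⟩ := hy
  obtain ⟨w, rfl⟩ := Δ.exists_orbitExp_eq y
  rw [hqE] at huy
  have : Δ.orbitExp σ w = Δ.orbitExp σ (w₀ - R w₀ + u) := by
    rw [orbitExp_eq_iff, ← add_sub_cancel_left (R w) w]
    have h1 : R w - u ∈ periods σ.1 := fun m hm => by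
      choose k hk using fun i => Complex.exp_eq_exp_iff_exists_int.mp (congrFun huy i)
      refine ⟨-∑ i, m i * k i, ?_⟩
      have h2 : u = R w + intPeriod k := funext hk
      rw [h2, sub_add_cancel_left, complexPairing_neg_right, complexPairing_intPeriod]
      push_cast
      ring
    have h2 : ∀ w, w - R w ∈ spanC σ.1 := fun w m hm => by
      rw [complexPairing_sub_right, hR m hm, sub_self]
    have h3 := add_mem h1 (mem_periods_of_mem_spanC ((spanC σ.1).sub_mem (h2 w) (h2 w₀)))
    convert h3 using 1
    abel
  rw [this]
  exact hu

/-! ### Neighbourhoods in the toric variety -/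

/-- The logarithmic coordinates `w` for which `exp(w) • x_τ` is close to `exp(z) • x_σ`: up to the
span of `σ` the distance from `w` to `z` is less than `δ`, and the monomials in `A` that vanish at
`x_σ` have absolute value less than `δ`. -/
def nearSet (τ σ : Δ.Cone) (z : Fin n → ℂ) (A : Finset (Fin n → ℤ)) (δ : ℝ) : Set (Fin n → ℂ) :=
  {w | (∃ k ∈ spanC σ.1, w - k ∈ Metric.ball z δ) ∧
    ∀ m ∈ A, IsPerp τ.1 m → ¬ IsPerp σ.1 m → (complexPairing m w).re < Real.log δ}

variable {Δ}

theorem nearSet_mono {τ σ : Δ.Cone} {z : Fin n → ℂ} {A A' : Finset (Fin n → ℤ)} {δ δ' : ℝ}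
    (hA : A ⊆ A') (hδ' : 0 < δ') (hδ : δ' ≤ δ) : Δ.nearSet τ σ z A' δ' ⊆ Δ.nearSet τ σ z A δ := by
  rintro w ⟨⟨k, hk, hkw⟩, h⟩
  exact ⟨⟨k, hk, Metric.ball_subset_ball hδ hkw⟩, fun m hm h1 h2 =>
    (h m (hA hm) h1 h2).trans_le (Real.log_le_log hδ' hδ)⟩

/-- Both conditions are convex: a ball thickened by a linear subspace, and upper bounds on
real-linear functions. Convexity gives the connectedness on which cospecialization depends. -/
theorem convex_nearSet {τ σ : Δ.Cone} {z : Fin n → ℂ} {A : Finset (Fin n → ℤ)} {δ : ℝ} :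
    Convex ℝ (Δ.nearSet τ σ z A δ) := by
  rintro w ⟨⟨k, hk, hkw⟩, h⟩ w' ⟨⟨k', hk', hkw'⟩, h'⟩ a b ha hb hab
  refine ⟨⟨(a : ℂ) • k + (b : ℂ) • k', add_mem (Submodule.smul_mem _ _ hk)
    (Submodule.smul_mem _ _ hk'), ?_⟩, fun m hm h1 h2 => ?_⟩
  · have := convex_ball z δ hkw hkw' ha hb hab
    convert this using 1
    ext i
    simp
    ring
  · have e : complexPairing m (a • w + b • w') = a * complexPairing m w + b * complexPairing m w' := by
      rw [complexPairing_add_right, ← complexPairing_smul_right, ← complexPairing_smul_right]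
      rfl
    rw [e, Complex.add_re, Complex.re_ofReal_mul, Complex.re_ofReal_mul]
    have h3 := h m hm h1 h2
    have h4 := h' m hm h1 h2
    have h5 : a * Real.log δ + b * Real.log δ = Real.log δ := by rw [← add_mul, hab, one_mul]
    rcases ha.eq_or_lt with rfl | ha
    · rw [zero_add] at hab
      subst hab
      linarith
    · nlinarith [mul_lt_mul_of_pos_left h3 ha, mul_le_mul_of_nonneg_left h4.le hb]

/-- Start at z and move far in the direction -v, with v in the relative interior of σ: the class
modulo `spanC σ` is kept and every monomial of A outside σ^⊥ becomes small. -/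
theorem nearSet_nonempty {τ σ : Δ.Cone} (z : Fin n → ℂ) {A : Finset (Fin n → ℤ)}
    (hA : ∀ m ∈ A, m ∈ dualMonoid σ.1) {δ : ℝ} (hδ : 0 < δ) : (Δ.nearSet τ σ z A δ).Nonempty := by
  classical
  obtain ⟨S, hS⟩ := Δ.exists_generators σ
  obtain ⟨v, hv, hvm⟩ := exists_interior hS
  have hvk : (fun i => (v i : ℂ)) ∈ spanC σ.1 := fun m hm => by
    rw [complexPairing_ofReal, hm v hv, Complex.ofReal_zero]
  obtain ⟨s, hs⟩ := exists_nat_common_bound (A.filter fun m => ¬ IsPerp σ.1 m)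
    (fun m => Real.log δ - 1 - (complexPairing m z).re) (fun m => latticePairing m v) fun m hm => by
      obtain ⟨hmA, hm⟩ := Finset.mem_filter.mp hm
      exact Or.inl (((hA m hmA) v hv).lt_of_ne fun h => hm (hvm m (hA m hmA) h.symm))
  refine ⟨z - (s : ℂ) • fun i => (v i : ℂ), ⟨-((s : ℂ) • fun i => (v i : ℂ)),
    neg_mem (Submodule.smul_mem _ _ hvk), ?_⟩, fun m hm _ h2 => ?_⟩
  · rw [sub_neg_eq_add, sub_add_cancel]
    exact Metric.mem_ball_self hδ
  · have := hs m (Finset.mem_filter.mpr ⟨hm, h2⟩)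
    rw [complexPairing_sub_right, complexPairing_smul_right, complexPairing_ofReal,
      Complex.sub_re, ← Complex.ofReal_natCast, ← Complex.ofReal_mul, Complex.ofReal_re]
    linarith

/-- Periods of O_τ pair with τ^⊥ to imaginary numbers, so the bounds on absolute values do not
notice them. -/
theorem nearSet_add_mem {τ σ : Δ.Cone} {z : Fin n → ℂ} {A : Finset (Fin n → ℤ)} {δ : ℝ}
    {l : Fin n → ℂ} (hl : l ∈ periods τ.1) {w : Fin n → ℂ}
    (hw : w ∈ Δ.nearSet τ σ (z + l) A δ) : w - l ∈ Δ.nearSet τ σ z A δ := by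
  obtain ⟨⟨k, hk, hkw⟩, h⟩ := hw
  refine ⟨⟨k, hk, ?_⟩, fun m hm h1 h2 => ?_⟩
  · rw [Metric.mem_ball, dist_eq_norm] at hkw ⊢
    convert hkw using 2
    abel
  · rw [complexPairing_sub_right, Complex.sub_re, re_complexPairing_of_mem_periods hl h1, sub_zero]
    exact h m hm h1 h2

/-- The conditions at w that involve τ^⊥ are open and insensitive to `spanC τ`. The other monomials
of A are controlled by the bound in the inner set, as δ' ≤ δ. -/
theorem exists_nearSet_subset {ρ τ σ : Δ.Cone} (hτ : τ ≤ σ) {z : Fin n → ℂ}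
    {A : Finset (Fin n → ℤ)} {δ : ℝ} (hδ : 0 < δ) {w : Fin n → ℂ}
    (hw : w ∈ Δ.nearSet τ σ z A δ) :
    ∃ δ' > 0, Δ.nearSet ρ τ w A δ' ⊆ Δ.nearSet ρ σ z A δ := by
  obtain ⟨⟨k, hk, hkw⟩, h⟩ := hw
  have hev : ∀ᶠ u in nhds w, u - k ∈ Metric.ball z δ ∧
      ∀ m ∈ A, IsPerp τ.1 m → ¬ IsPerp σ.1 m → (complexPairing m u).re < Real.log δ := by
    refine Filter.Eventually.and ?_ ?_
    · exact (continuous_id.sub continuous_const).continuousAt (Metric.isOpen_ball.mem_nhds hkw)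
    · rw [Finset.eventually_all]
      intro m hm
      by_cases h1 : IsPerp τ.1 m
      · by_cases h2 : IsPerp σ.1 m
        · simp [h2]
        · have hc : Continuous fun u => (complexPairing m u).re :=
            Complex.continuous_re.comp (continuous_complexPairing m)
          filter_upwards [hc.continuousAt (gt_mem_nhds (h m hm h1 h2))] with u hu _ _
          exact hu
      · simp [h1]
  obtain ⟨ε, hε, hball⟩ := Metric.eventually_nhds_iff_ball.mp hev
  refine ⟨min ε δ, lt_min hε hδ, ?_⟩
  rintro w₂ ⟨⟨k₂, hk₂, hkw₂⟩, h₂⟩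
  have hb := hball _ (Metric.ball_subset_ball (min_le_left _ _) hkw₂)
  refine ⟨⟨k₂ + k, add_mem (spanC_mono hτ hk₂) hk, ?_⟩, fun m hm h1 h2 => ?_⟩
  · rw [← sub_sub]
    exact hb.1
  · by_cases h3 : IsPerp τ.1 m
    · have := hb.2 m hm h3 h2
      rwa [complexPairing_sub_right, hk₂ m h3, sub_zero] at this
    · exact (h₂ m hm h1 h3).trans_le (Real.log_le_log (lt_min hε hδ) (min_le_right _ _))

variable (Δ)

/-- The filter of logarithmic coordinates `w` for which `exp(w) • x_τ` tends to `exp(z) • x_σ`. -/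
def nearFilter (τ σ : Δ.Cone) (z : Fin n → ℂ) : Filter (Fin n → ℂ) where
  sets := {s | ∃ A : Finset (Fin n → ℤ), (∀ m ∈ A, m ∈ dualMonoid σ.1) ∧
    ∃ δ > 0, Δ.nearSet τ σ z A δ ⊆ s}
  univ_sets := ⟨∅, by simp, 1, one_pos, Set.subset_univ _⟩
  sets_of_superset := fun ⟨A, hA, δ, hδ, h⟩ hst => ⟨A, hA, δ, hδ, h.trans hst⟩
  inter_sets := fun {s t} ⟨A, hA, δ, hδ, h⟩ ⟨A', hA', δ', hδ', h'⟩ => by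
    classical
    refine ⟨A ∪ A', fun m hm => (Finset.mem_union.mp hm).elim (hA m) (hA' m), min δ δ',
      lt_min hδ hδ', Set.subset_inter ?_ ?_⟩
    · exact (nearSet_mono Finset.subset_union_left (lt_min hδ hδ') (min_le_left _ _)).trans h
    · exact (nearSet_mono Finset.subset_union_right (lt_min hδ hδ') (min_le_right _ _)).trans h'

variable {Δ}

theorem mem_nearFilter {τ σ : Δ.Cone} {z : Fin n → ℂ} {s : Set (Fin n → ℂ)} :
    s ∈ Δ.nearFilter τ σ z ↔ ∃ A : Finset (Fin n → ℤ), (∀ m ∈ A, m ∈ dualMonoid σ.1) ∧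
      ∃ δ > 0, Δ.nearSet τ σ z A δ ⊆ s := Iff.rfl

instance nearFilter_neBot (τ σ : Δ.Cone) (z : Fin n → ℂ) : (Δ.nearFilter τ σ z).NeBot :=
  ⟨fun h => by
    obtain ⟨A, hA, δ, hδ, hs⟩ := mem_nearFilter.mp (Filter.empty_mem_iff_bot.mpr h)
    obtain ⟨w, hw⟩ := nearSet_nonempty (τ := τ) z hA hδ
    exact hs hw⟩

/-- For τ = σ no monomial condition remains. -/
theorem nhds_le_nearFilter (σ : Δ.Cone) (z : Fin n → ℂ) : nhds z ≤ Δ.nearFilter σ σ z := by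
  rintro s ⟨A, _, δ, hδ, hs⟩
  refine Filter.mem_of_superset (Metric.ball_mem_nhds z hδ) fun w hw => hs ?_
  exact ⟨⟨0, zero_mem _, by rwa [sub_zero]⟩, fun m _ h1 h2 => (h2 h1).elim⟩

/-- A property that holds on O_ρ near a point of O_σ holds on O_ρ near the nearby points of O_τ.
This is the source of the transitivity of cospecialization. -/
theorem nearFilter_nested {ρ τ σ : Δ.Cone} (hτ : τ ≤ σ) {z : Fin n → ℂ}
    {p : (Fin n → ℂ) → Prop} (h : ∀ᶠ w in Δ.nearFilter ρ σ z, p w) :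
    ∀ᶠ w in Δ.nearFilter τ σ z, ∀ᶠ w' in Δ.nearFilter ρ τ w, p w' := by
  obtain ⟨A, hA, δ, hδ, hs⟩ := h
  refine ⟨A, hA, δ, hδ, fun w hw => ?_⟩
  obtain ⟨δ', hδ', h'⟩ := exists_nearSet_subset (ρ := ρ) hτ hδ hw
  exact ⟨A, fun m hm => dualMonoid_anti hτ (hA m hm), δ', hδ', h'.trans hs⟩

theorem nearFilter_translate {τ σ : Δ.Cone} {z l : Fin n → ℂ} (hl : l ∈ periods τ.1)
    {p : (Fin n → ℂ) → Prop} (h : ∀ᶠ w in Δ.nearFilter τ σ z, p w) :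
    ∀ᶠ w in Δ.nearFilter τ σ (z + l), p (w - l) := by
  obtain ⟨A, hA, δ, hδ, hs⟩ := h
  exact ⟨A, hA, δ, hδ, fun w hw => hs (nearSet_add_mem hl hw)⟩

/-- The basic neighbourhoods of `exp(z) • x_σ`. -/
theorem exists_opens_nearSet (σ : Δ.Cone) (z : Fin n → ℂ) (A : Finset (Fin n → ℤ))
    (hA : ∀ m ∈ A, m ∈ dualMonoid σ.1) {δ : ℝ} (hδ : 0 < δ) :
    ∃ B : Opens Δ.Variety, ∀ (τ : Δ.Cone) (w : Fin n → ℂ), Δ.expMap τ w ∈ B ↔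
      τ ≤ σ ∧ ∃ ν, w - intPeriod ν ∈ Δ.nearSet τ σ z A δ := by
  obtain ⟨S, hS⟩ := Δ.exists_generators σ
  -- The retraction to O_σ expresses the ball condition up to periods, and the remaining conditions
  -- bound the monomials in A that vanish at x_σ.
  let O : Set (Chart σ.1) := Δ.orbitRetraction σ ⁻¹' (Δ.orbitExp σ '' Metric.ball z δ) ∩
    ⋂ m : {m // m ∈ A}, {x | ¬ IsPerp σ.1 m.1 → ‖x.1 ⟨m.1, hA m.1 m.2⟩‖ < δ}
  have hO : IsOpen O := by
    refine IsOpen.inter ?_ (isOpen_iInter_of_finite fun m => ?_)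
    · exact (Δ.isOpenMap_orbitExp σ _ Metric.isOpen_ball).preimage (Δ.orbitRetraction σ).continuous
    · by_cases hm : IsPerp σ.1 m.1
      · simp [hm]
      · simp only [hm, not_false_eq_true, forall_const]
        exact isOpen_lt (Chart.continuous_eval _).norm continuous_const
  have hmem : ∀ (τ : Δ.Cone) (h : τ ≤ σ) (w : Fin n → ℂ),
      Chart.incl h (Chart.expPoint τ.1 w) ∈ O ↔ ∃ ν, w - intPeriod ν ∈ Δ.nearSet τ σ z A δ := by
    intro τ h w
    have hval : ∀ (m : Fin n → ℤ) (hm : m ∈ A), IsPerp τ.1 m →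
        ‖(Chart.incl h (Chart.expPoint τ.1 w)).1 ⟨m, hA m hm⟩‖ =
          Real.exp (complexPairing m w).re := fun m hm hmτ => by
      refine (congrArg norm (Chart.expPoint_apply_of_isPerp w
        (m := ⟨m, dualMonoid_anti h (hA m hm)⟩) hmτ)).trans ?_
      exact Complex.norm_exp _
    have hlog : ∀ x : ℝ, Real.exp x < δ ↔ x < Real.log δ := fun x => (Real.lt_log_iff_exp_lt hδ).symm
    constructor
    · rintro ⟨⟨w', hw', hww'⟩, hw⟩
      rw [orbitRetraction_incl_expPoint, eq_comm, orbitExp_eq_iff] at hww'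
      -- A period of O_σ need not be one of O_τ. An integral one is, and the error lies in `spanC
      -- σ`, which the basic set tolerates.
      obtain ⟨ν, hν⟩ := exists_intPeriod hS hww'
      refine ⟨ν, ⟨_, hν, ?_⟩, fun m hm h1 h2 => ?_⟩
      · convert hw' using 1
        abel
      · rw [complexPairing_sub_right, Complex.sub_re,
          re_complexPairing_of_mem_periods (intPeriod_mem_periods ν) h1, sub_zero, ← hlog,
          ← hval m hm h1]
        exact (Set.mem_iInter.mp hw ⟨m, hm⟩) h2
    · rintro ⟨ν, ⟨k, hk, hkw⟩, hw⟩
      refine ⟨⟨_, hkw, ?_⟩, Set.mem_iInter.mpr fun m h2 => ?_⟩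
      · rw [orbitRetraction_incl_expPoint, orbitExp_eq_iff]
        have := neg_mem (add_mem (intPeriod_mem_periods (σ := σ.1) ν) (mem_periods_of_mem_spanC hk))
        convert this using 1
        abel
      · by_cases h1 : IsPerp τ.1 m.1
        · rw [hval m.1 m.2 h1, hlog]
          have := hw m.1 m.2 h1 h2
          rwa [complexPairing_sub_right, Complex.sub_re,
            re_complexPairing_of_mem_periods (intPeriod_mem_periods ν) h1, sub_zero] at this
        · have h0 : (Chart.incl h (Chart.expPoint τ.1 w)).1 ⟨m.1, hA m.1 m.2⟩ = 0 :=
            Chart.expPoint_apply_of_not_isPerp w (m := ⟨m.1, dualMonoid_anti h (hA m.1 m.2)⟩) h1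
          rw [h0, norm_zero]
          exact hδ
  refine ⟨⟨Δ.chartMap σ '' O, Δ.isOpenMap_chartMap σ O hO⟩, fun τ w => ⟨?_, ?_⟩⟩
  · rintro ⟨x, hx, hxw⟩
    obtain ⟨τ', h', w', rfl⟩ := Δ.exists_incl_expPoint σ x
    rw [chartMap_incl_expPoint] at hxw
    obtain rfl := Δ.cone_eq_of_expMap_eq hxw
    rw [expMap_eq_iff, ← Chart.expPoint_eq_iff] at hxw
    rw [hxw] at hx
    exact ⟨h', (hmem _ h' w).mp hx⟩
  · rintro ⟨h, hν⟩
    exact ⟨_, (hmem τ h w).mpr hν, Δ.chartMap_incl_expPoint h w⟩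

/-- Check each monomial: those in σ^⊥ converge because `spanC σ` is invisible to them, those in τ^⊥
but not in σ^⊥ are forced to 0, and the others vanish on O_τ. -/
theorem tendsto_expMap {τ σ : Δ.Cone} (h : τ ≤ σ) (z : Fin n → ℂ) :
    Filter.Tendsto (Δ.expMap τ) (Δ.nearFilter τ σ z) (nhds (Δ.expMap σ z)) := by
  classical
  have key : Filter.Tendsto (fun w => Chart.incl h (Chart.expPoint τ.1 w)) (Δ.nearFilter τ σ z)
      (nhds (Chart.expPoint σ.1 z)) := by
    refine tendsto_subtype_rng.mpr (tendsto_pi_nhds.mpr fun m => ?_)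
    by_cases hm : IsPerp σ.1 m
    · have hmτ : IsPerp τ.1 m := hm.anti h
      have h1 : Filter.Tendsto (complexPairing m.1) (Δ.nearFilter τ σ z)
          (nhds (complexPairing m.1 z)) := fun s hs => by
        obtain ⟨δ, hδ, hball⟩ := Metric.mem_nhds_iff.mp
          ((continuous_complexPairing m.1).continuousAt (x := z) hs)
        refine ⟨∅, by simp, δ, hδ, ?_⟩
        rintro w ⟨⟨k, hk, hkw⟩, -⟩
        have := hball hkw
        rwa [Set.mem_preimage, complexPairing_sub_right, hk m hm, sub_zero] at this
      have h2 := (Complex.continuous_exp.tendsto _).comp h1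
      rw [← Chart.expPoint_apply_of_isPerp z hm] at h2
      refine h2.congr fun w => ?_
      exact (Chart.expPoint_apply_of_isPerp w (m := ⟨m, dualMonoid_anti h m.2⟩) hmτ).symm
    · rw [Chart.expPoint_apply_of_not_isPerp z hm]
      by_cases hmτ : IsPerp τ.1 m
      · refine Metric.tendsto_nhds.mpr fun δ hδ => ⟨{m.1}, by simp [m.2], δ, hδ, ?_⟩
        rintro w ⟨-, hw⟩
        have h0 : (Chart.incl h (Chart.expPoint τ.1 w)).1 m = Complex.exp (complexPairing m.1 w) :=
          Chart.expPoint_apply_of_isPerp w (m := ⟨m, dualMonoid_anti h m.2⟩) hmτ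
        change dist ((Chart.incl h (Chart.expPoint τ.1 w)).1 m) 0 < δ
        rw [h0, dist_zero_right, Complex.norm_exp, ← Real.lt_log_iff_exp_lt hδ]
        exact hw m.1 (by simp) hmτ hm
      · refine tendsto_const_nhds.congr fun w => ?_
        exact (Chart.expPoint_apply_of_not_isPerp w (m := ⟨m, dualMonoid_anti h m.2⟩) hmτ).symm
  refine (((Δ.chartMap σ).continuous.tendsto _).comp key).congr fun w => ?_
  exact Δ.chartMap_incl_expPoint h w

/-- There are finitely many cones, so the union of their sets A and the minimum of their δ give one
basic neighbourhood. All topological questions on X thus reduce to one orbit at a time. -/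
theorem mem_nhds_expMap_iff {σ : Δ.Cone} {z : Fin n → ℂ} {W : Set Δ.Variety} :
    W ∈ nhds (Δ.expMap σ z) ↔ ∀ τ ≤ σ, ∀ᶠ w in Δ.nearFilter τ σ z, Δ.expMap τ w ∈ W := by
  classical
  refine ⟨fun h τ hτ => tendsto_expMap hτ z h, fun h => ?_⟩
  have h' : ∀ τ : Δ.Cone, ∃ A : Finset (Fin n → ℤ), (∀ m ∈ A, m ∈ dualMonoid σ.1) ∧
      ∃ δ > 0, τ ≤ σ → Δ.nearSet τ σ z A δ ⊆ {w | Δ.expMap τ w ∈ W} := fun τ => by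
    by_cases hτ : τ ≤ σ
    · obtain ⟨A, hA, δ, hδ, hs⟩ := h τ hτ
      exact ⟨A, hA, δ, hδ, fun _ => hs⟩
    · exact ⟨∅, by simp, 1, one_pos, fun h => (hτ h).elim⟩
  choose A hA δ hδ hs using h'
  have := Fintype.ofFinite Δ.Cone
  have hne : (Finset.univ : Finset Δ.Cone).Nonempty := ⟨σ, Finset.mem_univ _⟩
  have hpos : 0 < Finset.univ.inf' hne δ := (Finset.lt_inf'_iff hne).mpr fun τ _ => hδ τ
  have hAA : ∀ m ∈ Finset.univ.biUnion A, m ∈ dualMonoid σ.1 := fun m hm => by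
    obtain ⟨τ, -, hτ⟩ := Finset.mem_biUnion.mp hm
    exact hA τ m hτ
  obtain ⟨B, hB⟩ := exists_opens_nearSet σ z _ hAA hpos
  refine Filter.mem_of_superset (B.isOpen.mem_nhds ((hB σ z).mpr ⟨le_rfl, 0, ?_⟩)) ?_
  · have h0 : intPeriod (0 : Fin n → ℤ) = 0 := by ext i; simp [intPeriod]
    rw [h0, sub_zero]
    exact ⟨⟨0, zero_mem _, by simpa using hpos⟩, fun m _ h1 h2 => (h2 h1).elim⟩
  · intro x hx
    obtain ⟨τ, w, rfl⟩ := Δ.exists_expMap_eq x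
    obtain ⟨hτ, ν, hν⟩ := (hB τ w).mp hx
    have := hs τ hτ (nearSet_mono (Finset.subset_biUnion_of_mem A (Finset.mem_univ τ)) hpos
      (Finset.inf'_le _ (Finset.mem_univ τ)) hν)
    have e : Δ.expMap τ (w - intPeriod ν) = Δ.expMap τ w := Δ.expMap_eq_of_mem (by
      rw [sub_sub_cancel_left]
      exact neg_mem (intPeriod_mem_periods ν))
    rw [← e]
    exact this

end Fan

/-! ### The fundamental groups of the orbits -/

namespace Fan

variable {n : ℕ} (Δ : Fan n)

theorem orbitExp_of_mem {σ : Δ.Cone} {l : Fin n → ℂ} (hl : l ∈ periods σ.1) :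
    Δ.orbitExp σ l = Δ.basePoint σ := by
  rw [← orbitExp_zero, orbitExp_eq_iff, sub_zero]
  exact hl

/-- The loop `t ↦ exp(t l) • x_σ` of a period `l`. -/
noncomputable def periodLoop (σ : Δ.Cone) (l : periods σ.1) :
    Path (Δ.basePoint σ) (Δ.basePoint σ) where
  toFun t := Δ.orbitExp σ ((t : ℝ) • l.1)
  continuous_toFun := (Δ.orbitExp σ).continuous.comp (by fun_prop)
  source' := by
    refine (congrArg (Δ.orbitExp σ) ?_).trans (Δ.orbitExp_zero σ)
    simp
  target' := by
    refine (congrArg (Δ.orbitExp σ) ?_).trans (Δ.orbitExp_of_mem l.2)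
    simp

/-- The class of a period in the fundamental group. -/
noncomputable def periodClass (σ : Δ.Cone) (l : periods σ.1) :
    FundamentalGroup (Δ.Orbit σ) (Δ.basePoint σ) :=
  FundamentalGroup.fromPath (Path.Homotopic.Quotient.mk (Δ.periodLoop σ l))

variable {Δ}

/-- In the simply connected space ℂⁿ every path from 0 to l is homotopic to the segment that defines
`periodLoop`. -/
theorem mk_eq_periodClass {σ : Δ.Cone} (γ : Path (Δ.basePoint σ) (Δ.basePoint σ))
    {l : periods σ.1} (w : Path 0 l.1) (h : ∀ t, Δ.orbitExp σ (w t) = γ t) :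
    FundamentalGroup.fromPath (Path.Homotopic.Quotient.mk γ) = Δ.periodClass σ l := by
  let w' : Path 0 l.1 :=
    { toFun := fun t => (t : ℝ) • l.1
      continuous_toFun := by fun_prop
      source' := by simp
      target' := by simp }
  have h1 := ((SimplyConnectedSpace.paths_homotopic w w').map (Δ.orbitExp σ)).pathCast
    (Δ.orbitExp_zero σ).symm (Δ.orbitExp_of_mem l.2).symm
  refine Path.Homotopic.Quotient.eq.mpr ?_
  convert h1 using 1
  · exact Path.ext (funext fun t => (h t).symm)
  · exact Path.ext rfl

theorem periodClass_add (σ : Δ.Cone) (l l' : periods σ.1) :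
    Δ.periodClass σ (l + l') = Δ.periodClass σ l * Δ.periodClass σ l' := by
  let w₁ : Path 0 l'.1 :=
    { toFun := fun t => (t : ℝ) • l'.1
      continuous_toFun := by fun_prop
      source' := by simp
      target' := by simp }
  let w₂ : Path l'.1 (l + l').1 :=
    { toFun := fun t => (t : ℝ) • l.1 + l'.1
      continuous_toFun := by fun_prop
      source' := by simp
      target' := by simp }
  -- In a product in the fundamental group the right factor is traversed first, so the lift goes to
  -- l' before it goes on to l + l'.
  refine (mk_eq_periodClass ((Δ.periodLoop σ l').trans (Δ.periodLoop σ l)) (w₁.trans w₂)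
    fun t => ?_).symm
  rw [Path.trans_apply, Path.trans_apply]
  split_ifs with h
  · rfl
  · refine Δ.orbitExp_eq_iff.mpr ?_
    change (_ • l.1 + l'.1) - _ • l.1 ∈ periods σ.1
    rw [add_sub_cancel_left]
    exact l'.2

/-- The whole segment lies in the span, so the loop is constant. -/
theorem periodClass_of_mem_spanC (σ : Δ.Cone) {l : periods σ.1} (hl : l.1 ∈ spanC σ.1) :
    Δ.periodClass σ l = 1 := by
  let w : Path 0 l.1 :=
    { toFun := fun t => (t : ℝ) • l.1
      continuous_toFun := by fun_prop
      source' := by simp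
      target' := by simp }
  refine (mk_eq_periodClass (Path.refl _) w fun t => ?_).symm
  exact Δ.orbitExp_of_mem (mem_periods_of_mem_spanC ((spanC σ.1).smul_mem ((t : ℝ) : ℂ) hl))

theorem periodClass_zero (σ : Δ.Cone) : Δ.periodClass σ 0 = 1 :=
  periodClass_of_mem_spanC σ (zero_mem _)

theorem orbit_apply_ne_zero {σ : Δ.Cone} (x : Δ.Orbit σ) {m : Fin n → ℤ} (hm : IsPerp σ.1 m) :
    x.1.1 ⟨m, hm.mem_dualMonoid⟩ ≠ 0 := Chart.apply_ne_zero _ (m := ⟨m, hm.mem_dualMonoid⟩) hm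

/-- The character of the orbit `O_σ` given by an element of `σ^⊥`. -/
def orbitChar {σ : Δ.Cone} {m : Fin n → ℤ} (hm : IsPerp σ.1 m) : C(Δ.Orbit σ, {z : ℂ // z ≠ 0}) where
  toFun x := ⟨x.1.1 ⟨m, hm.mem_dualMonoid⟩, orbit_apply_ne_zero x hm⟩
  continuous_toFun := ((Chart.continuous_eval _).comp continuous_subtype_val).subtype_mk _

theorem orbitChar_orbitExp {σ : Δ.Cone} {m : Fin n → ℤ} (hm : IsPerp σ.1 m) (w : Fin n → ℂ) :
    orbitChar hm (Δ.orbitExp σ w) = ⟨_, Complex.exp_ne_zero (complexPairing m w)⟩ :=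
  Subtype.ext (Chart.expPoint_apply_of_isPerp w (m := ⟨m, hm.mem_dualMonoid⟩) hm)

/-- A character in σ^⊥ takes the loops to loops in ℂ^*, where homotopic loops have lifts through exp
with the same endpoint; for the loop of l that endpoint is ⟨m, l⟩. -/
theorem sub_mem_spanC_of_periodClass_eq {σ : Δ.Cone} {l l' : periods σ.1}
    (h : Δ.periodClass σ l = Δ.periodClass σ l') : l.1 - l'.1 ∈ spanC σ.1 := by
  intro m hm
  rw [complexPairing_sub_right, sub_eq_zero]
  have h1 := (Path.Homotopic.Quotient.eq.mp h).map (orbitChar hm)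
  have hlift : ∀ l : periods σ.1, ∃ Γ : C(unitInterval, ℂ), Γ 0 = 0 ∧ Γ 1 = complexPairing m l.1 ∧
      ∀ t, (⟨Complex.exp (Γ t), Complex.exp_ne_zero _⟩ : {z : ℂ // z ≠ 0}) =
        orbitChar hm (Δ.periodLoop σ l t) := fun l => by
    refine ⟨⟨fun t => complexPairing m ((t : ℝ) • l.1),
      (continuous_complexPairing m).comp (by fun_prop)⟩, ?_, ?_, fun t => ?_⟩
    · simp [complexPairing_zero_right]
    · simp
    · exact (orbitChar_orbitExp hm _).symm
  obtain ⟨Γ, h0, h2, h3⟩ := hlift l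
  obtain ⟨Γ', h0', h2', h3'⟩ := hlift l'
  have hb : ∀ l, (((Δ.periodLoop σ l).map (orbitChar hm).continuous : Path _ _) :
      C(unitInterval, {z : ℂ // z ≠ 0})) 0 = ⟨_, Complex.exp_ne_zero 0⟩ := fun l => by
    obtain ⟨Γ, h0, -, h3⟩ := hlift l
    refine (h3 0).symm.trans (Subtype.ext ?_)
    rw [h0]
  have key := Complex.isCoveringMap_exp.liftPath_apply_one_eq_of_homotopicRel h1 0 (hb l) (hb l')
  have e : Γ = Complex.isCoveringMap_exp.liftPath _ 0 (hb l) :=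
    (Complex.isCoveringMap_exp.eq_liftPath_iff' _).mpr ⟨funext h3, h0⟩
  have e' : Γ' = Complex.isCoveringMap_exp.liftPath _ 0 (hb l') :=
    (Complex.isCoveringMap_exp.eq_liftPath_iff' _).mpr ⟨funext h3', h0'⟩
  rw [← h2, ← h2', e, e']
  exact key

/-- Loops in the orbit `O_σ` lift to the logarithmic coordinates. -/
theorem exists_lift_loop {σ : Δ.Cone} (γ : Path (Δ.basePoint σ) (Δ.basePoint σ)) :
    ∃ (l : periods σ.1) (w : Path 0 l.1), ∀ t, Δ.orbitExp σ (w t) = γ t := by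
  obtain ⟨S, hS⟩ := Δ.exists_generators σ
  obtain ⟨r, hr, hr'⟩ := exists_perp_retraction hS
  have hb : ∀ i, ((orbitChar (hr (Pi.single i 1))).comp (γ : C(unitInterval, Δ.Orbit σ))) 0 =
      ⟨_, Complex.exp_ne_zero 0⟩ := fun i => by
    refine (congrArg (orbitChar (hr (Pi.single i 1))) (γ.source.trans (Δ.orbitExp_zero σ).symm)).trans ?_
    refine (orbitChar_orbitExp _ _).trans (Subtype.ext ?_)
    rw [complexPairing_zero_right]
  -- Lift the characters r(e_i) along the loop one by one. Together they form a lift of the loop,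
  -- since `r` is the identity on σ^⊥.
  let u : Fin n → C(unitInterval, ℂ) := fun i => Complex.isCoveringMap_exp.liftPath _ 0 (hb i)
  have hu : ∀ t, Δ.orbitExp σ (fun i => u i t) = γ t := fun t => by
    obtain ⟨v, hv⟩ := Δ.exists_orbitExp_eq (γ t)
    rw [← hv, orbitExp_eq_iff]
    have h1 : ∀ i, Complex.exp (u i t) = Complex.exp (complexPairing (r (Pi.single i 1)) v) :=
      fun i => by
        have h2 := congrFun (Complex.isCoveringMap_exp.liftPath_lifts _ 0 (hb i)) t
        have h3 := h2.trans ((congrArg (orbitChar (hr (Pi.single i 1))) hv.symm).trans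
          (orbitChar_orbitExp _ _))
        exact congrArg Subtype.val h3
    choose k hk using fun i => Complex.exp_eq_exp_iff_exists_int.mp (h1 i)
    intro m hm
    have h2 : (fun i => u i t) =
        (fun i => complexPairing (r (Pi.single i 1)) v) + intPeriod k := funext hk
    rw [h2, complexPairing_sub_right, complexPairing_add_right, ← complexPairing_retraction,
      hr' m hm, complexPairing_intPeriod]
    exact ⟨_, add_sub_cancel_left _ _⟩
  have h1 : (fun i => u i 1) ∈ periods σ.1 := by
    have := (hu 1).trans (γ.target.trans (Δ.orbitExp_zero σ).symm)
    rwa [orbitExp_eq_iff, sub_zero] at this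
  refine ⟨⟨_, h1⟩, ⟨⟨fun t i => u i t, by fun_prop⟩, ?_, rfl⟩, hu⟩
  exact funext fun i => Complex.isCoveringMap_exp.liftPath_zero _ 0 (hb i)

theorem periodClass_surjective (σ : Δ.Cone) : Function.Surjective (Δ.periodClass σ) := by
  intro g
  obtain ⟨γ, rfl⟩ := Path.Homotopic.Quotient.mk_surjective g
  obtain ⟨l, w, hw⟩ := exists_lift_loop γ
  exact ⟨l, (mk_eq_periodClass γ w hw).symm⟩

theorem pi1Map_periodClass {τ σ : Δ.Cone} (h : τ ≤ σ) (l : periods τ.1) :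
    Δ.pi1Map h (Δ.periodClass τ l) = Δ.periodClass σ ⟨l.1, periods_mono h l.2⟩ := by
  rw [pi1Map, FundamentalGroup.mapOfEq_apply]
  exact congrArg Path.Homotopic.Quotient.mk (Path.ext (funext fun t => Δ.orbitProj_orbitExp h _))

end Fan

/-! ### Flat sections along a map -/

namespace TopCat.Presheaf

variable {X : TopCat.{0}} (P : TopCat.Presheaf (ModuleCat.{0} ℂ) X)

theorem germ_eventually_eq {P : TopCat.Presheaf (ModuleCat.{0} ℂ) X} {W W' : Opens X} {x : X}
    (hW : x ∈ W) (hW' : x ∈ W') (g : P.obj (op W)) (g' : P.obj (op W'))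
    (h : P.germ W x hW g = P.germ W' x hW' g') :
    ∀ᶠ y in nhds x, ∃ (hy : y ∈ W) (hy' : y ∈ W'), P.germ W y hy g = P.germ W' y hy' g' := by
  obtain ⟨U, hU, i, i', hi⟩ := P.germ_eq x hW hW' g g' h
  filter_upwards [U.isOpen.mem_nhds hU] with y hy
  refine ⟨i.le hy, i'.le hy, ?_⟩
  exact (P.germ_res_apply i y hy g).symm.trans
    ((congrArg (P.germ U y hy) hi).trans (P.germ_res_apply i' y hy g'))

theorem EtaleSpace.tendsto_mk {P : TopCat.Presheaf (ModuleCat.{0} ℂ) X} {α : Type*}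
    {l : Filter α} {b : α → X} {s : ∀ a, P.stalk (b a)} {x : X} {W : Opens X} (hx : x ∈ W)
    (g : P.obj (op W)) (hb : Filter.Tendsto b l (nhds x))
    (h : ∀ᶠ a in l, ∃ hW : b a ∈ W, s a = P.germ W (b a) hW g) :
    Filter.Tendsto (fun a => (⟨b a, s a⟩ : EtaleSpace P)) l (nhds ⟨x, P.germ W x hx g⟩) := by
  refine TopologicalSpace.tendsto_nhds_generateFrom_iff.mpr ?_
  rintro _ ⟨W', g', rfl⟩ ⟨hx', hg'⟩
  filter_upwards [h, hb.eventually (germ_eventually_eq hx hx' g g' hg')] with a ⟨ha, ha'⟩ ⟨_, h2, h3⟩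
  exact ⟨h2, ha'.trans h3⟩

variable {V : Type} [TopologicalSpace V] (f : V → X)

/-- The families of germs along a map that are locally germs of a section. -/
def flatSections : Submodule ℂ (∀ v, P.stalk (f v)) where
  carrier := {s | ∀ v, ∃ (W : Opens X) (_ : f v ∈ W) (g : P.obj (op W)),
    ∀ᶠ v' in nhds v, ∃ h : f v' ∈ W, s v' = P.germ W (f v') h g}
  add_mem' := fun {s s'} hs hs' v => by
    obtain ⟨W, hW, g, hg⟩ := hs v
    obtain ⟨W', hW', g', hg'⟩ := hs' v
    refine ⟨W ⊓ W', ⟨hW, hW'⟩, P.map (homOfLE inf_le_left).op g + P.map (homOfLE inf_le_right).op g', ?_⟩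
    filter_upwards [hg, hg'] with v' ⟨h, e⟩ ⟨h', e'⟩
    refine ⟨⟨h, h'⟩, ?_⟩
    rw [map_add, Pi.add_apply, e, e']
    exact (congrArg₂ (· + ·) (P.germ_res_apply (homOfLE inf_le_left) (f v') ⟨h, h'⟩ g)
      (P.germ_res_apply (homOfLE inf_le_right) (f v') ⟨h, h'⟩ g')).symm
  zero_mem' := fun v => ⟨⊤, Opens.mem_top _, 0, .of_forall fun v' => ⟨Opens.mem_top _, by
    rw [map_zero]; rfl⟩⟩
  smul_mem' := fun c s hs v => by
    obtain ⟨W, hW, g, hg⟩ := hs v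
    refine ⟨W, hW, c • g, ?_⟩
    filter_upwards [hg] with v' ⟨h, e⟩
    exact ⟨h, by rw [Pi.smul_apply, e, map_smul]⟩

variable {P f}

theorem mem_flatSections_iff (hf : Continuous f) {s : ∀ v, P.stalk (f v)} :
    s ∈ P.flatSections f ↔ Continuous fun v => (⟨f v, s v⟩ : EtaleSpace P) := by
  refine ⟨fun hs => continuous_iff_continuousAt.mpr fun v => ?_, fun hs v => ?_⟩
  · obtain ⟨W, hW, g, hg⟩ := hs v
    obtain ⟨_, e⟩ := hg.self_of_nhds
    have := EtaleSpace.tendsto_mk hW g hf.continuousAt hg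
    unfold ContinuousAt
    dsimp only
    rw [e]
    exact this
  · obtain ⟨W, hW, g, hg⟩ := EtaleSpace.exists_section_of_tendsto hs.continuousAt
    exact ⟨W, hW, g, hg⟩

theorem flatSections_eventually {s : ∀ v, P.stalk (f v)} (hs : s ∈ P.flatSections f) (hf : Continuous f)
    {v : V} {W : Opens X} (hW : f v ∈ W) (g : P.obj (op W)) (h : P.germ W (f v) hW g = s v) :
    ∀ᶠ v' in nhds v, ∃ h : f v' ∈ W, s v' = P.germ W (f v') h g := by
  obtain ⟨W', hW', g', hg'⟩ := hs v
  have h1 : P.germ W (f v) hW g = P.germ W' (f v) hW' g' := by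
    obtain ⟨_, e⟩ := hg'.self_of_nhds
    exact h.trans e
  filter_upwards [hg', hf.continuousAt.eventually (germ_eventually_eq hW hW' g g' h1)] with
    v' ⟨_, h2⟩ ⟨h3, _, h4⟩
  exact ⟨h3, h2.trans h4.symm⟩

/-- Local triviality of a presheaf along a map. -/
def IsLocallyTrivialAlong (P : TopCat.Presheaf (ModuleCat.{0} ℂ) X) (f : V → X) : Prop :=
  ∀ v, ∃ (U : Opens V) (A : Type) (c : ∀ v', A → P.stalk (f v')), v ∈ U ∧
    (∀ v' ∈ U, Function.Bijective (c v')) ∧ ∀ a, ∀ v' ∈ U, ∃ (W : Opens X) (_ : f v' ∈ W)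
      (g : P.obj (op W)), ∀ᶠ u in nhds v', ∃ h : f u ∈ W, c u a = P.germ W (f u) h g

/-- The pullback of the étale space along a map. -/
abbrev EtalePullback (P : TopCat.Presheaf (ModuleCat.{0} ℂ) X) (f : V → X) : Type :=
  {p : V × EtaleSpace P // p.2.base = f p.1}

/-- The bijections `c` identify the part over U with U × A, A discrete; this is a homeomorphism
because each `c · a` is locally given by germs of one section. -/
theorem IsLocallyTrivialAlong.isCoveringMap (hf : Continuous f) (h : IsLocallyTrivialAlong P f) :
    IsCoveringMap fun p : EtalePullback P f => p.1.1 := by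
  intro v
  obtain ⟨U, A, c, hv, hc, hA⟩ := h v
  let _ : TopologicalSpace A := ⊥
  have : DiscreteTopology A := ⟨rfl⟩
  refine IsEvenlyCovered.to_isEvenlyCovered_preimage (I := A) ⟨inferInstance, U, hv, U.isOpen,
    U.isOpen.preimage (continuous_fst.comp continuous_subtype_val), ?_⟩
  have hex : ∀ p : (fun p : EtalePullback P f => p.1.1) ⁻¹' (U : Set V),
      ∃ a, (⟨f p.1.1.1, c p.1.1.1 a⟩ : EtaleSpace P) = p.1.1.2 := by
    rintro ⟨⟨⟨v', ⟨x, e⟩⟩, hx⟩, hv'⟩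
    dsimp only at hx
    subst hx
    obtain ⟨a, ha⟩ := (hc v' hv').2 e
    exact ⟨a, by rw [← ha]⟩
  choose k hk using hex
  have hmk : ∀ (x : X) (a a' : P.stalk x), (⟨x, a⟩ : EtaleSpace P) = ⟨x, a'⟩ → a = a' :=
    fun x a a' h => by injection h
  refine ⟨⟨⟨fun p => (⟨p.1.1.1, p.2⟩, k p),
    fun q => ⟨⟨(q.1.1, ⟨f q.1.1, c q.1.1 q.2⟩), rfl⟩, q.1.2⟩, fun p => ?_, fun q => ?_⟩, ?_, ?_⟩,
    fun p => rfl⟩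
  · exact Subtype.ext (Subtype.ext (Prod.ext rfl (hk p)))
  · refine Prod.ext rfl ?_
    exact (hc q.1.1 q.1.2).1 (hmk _ _ _ (hk ⟨⟨(q.1.1, ⟨f q.1.1, c q.1.1 q.2⟩), rfl⟩, q.1.2⟩))
  · refine Continuous.prodMk ((continuous_fst.comp (continuous_subtype_val.comp
      continuous_subtype_val)).subtype_mk _) ?_
    refine continuous_iff_continuousAt.mpr fun p => ?_
    rw [ContinuousAt, nhds_discrete A, Filter.tendsto_pure]
    obtain ⟨W, hW, g, hg⟩ := hA (k p) p.1.1.1 p.2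
    have h1 : Filter.Tendsto (fun p : (fun p : EtalePullback P f => p.1.1) ⁻¹' (U : Set V) =>
      p.1.1.1) (nhds p) (nhds p.1.1.1) :=
      (continuous_fst.comp (continuous_subtype_val.comp continuous_subtype_val)).continuousAt
    have h2 : Filter.Tendsto (fun p : (fun p : EtalePullback P f => p.1.1) ⁻¹' (U : Set V) =>
      p.1.1.2) (nhds p) (nhds ⟨f p.1.1.1, c p.1.1.1 (k p)⟩) := by
      rw [hk p]
      exact (continuous_snd.comp (continuous_subtype_val.comp continuous_subtype_val)).continuousAt
    have h3 : P.germ W (f p.1.1.1) hW g = c p.1.1.1 (k p) := hg.self_of_nhds.choose_spec.symm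
    filter_upwards [h1.eventually hg, h2.eventually
      (EtaleSpace.eventually_nhds (⟨f p.1.1.1, c p.1.1.1 (k p)⟩ : EtaleSpace P) hW g h3)]
      with q ⟨h4, h5⟩ ⟨h6, h7⟩
    refine (hc q.1.1.1 q.2).1 ?_
    rw [h5]
    have h8 := hk q
    generalize q.1.1.2 = e at h6 h7 h8
    subst h8
    exact h7
  · refine continuous_prod_of_discrete_right.mpr fun a => ?_
    refine Continuous.subtype_mk (Continuous.subtype_mk (Continuous.prodMk continuous_subtype_val ?_) _) _
    refine continuous_iff_continuousAt.mpr fun u => ?_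
    obtain ⟨W, hW, g, hg⟩ := hA a u.1 u.2
    have h3 := hg.self_of_nhds.choose_spec
    unfold ContinuousAt
    dsimp only
    rw [h3]
    exact EtaleSpace.tendsto_mk hW g (hf.comp continuous_subtype_val).continuousAt
      (continuous_subtype_val.continuousAt.eventually hg)

/-- Flat sections are the lifts of the identity of V through a covering; as V is simply connected,
each prescribed value has exactly one. -/
theorem IsLocallyTrivialAlong.existsUnique [SimplyConnectedSpace V] [LocallyPathConnectedSpace V]
    (hf : Continuous f) (h : IsLocallyTrivialAlong P f) (v : V) :
    Function.Bijective fun s : P.flatSections f => s.1 v := by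
  have hcov := h.isCoveringMap hf
  have key : ∀ a : P.stalk (f v), ∃! s : C(V, EtalePullback P f), s v = ⟨(v, ⟨f v, a⟩), rfl⟩ ∧
      (fun p : EtalePullback P f => p.1.1) ∘ s = ContinuousMap.id V := fun a =>
    hcov.existsUnique_continuousMap_lifts (ContinuousMap.id V) v ⟨(v, ⟨f v, a⟩), rfl⟩ rfl
  have hmk : ∀ (x : X) (a a' : P.stalk x), (⟨x, a⟩ : EtaleSpace P) = ⟨x, a'⟩ → a = a' :=
    fun x a a' h => by injection h
  constructor
  · intro s s' hss
    let L : P.flatSections f → C(V, EtalePullback P f) := fun s =>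
      ⟨fun v => ⟨(v, ⟨f v, s.1 v⟩), rfl⟩, Continuous.subtype_mk
        (continuous_id.prodMk ((mem_flatSections_iff hf).mp s.2)) _⟩
    have h1 : L s = L s' := (key (s.1 v)).unique ⟨rfl, rfl⟩ ⟨by
      change (⟨(v, ⟨f v, s'.1 v⟩), rfl⟩ : EtalePullback P f) = _
      refine Subtype.ext (Prod.ext rfl ?_)
      exact congrArg (EtaleSpace.mk (f v)) hss.symm, rfl⟩
    refine Subtype.ext (funext fun v' => hmk _ _ _ ?_)
    exact congrArg (fun p : C(V, EtalePullback P f) => (p v').1.2) h1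
  · intro a
    obtain ⟨s, hs, hs'⟩ := (key a).exists
    have h1 : ∀ v', ∃ b : P.stalk (f v'), (s v').1.2 = ⟨f v', b⟩ := fun v' => by
      have h2 := congrFun hs' v'
      have h3 := (s v').2
      dsimp only [Function.comp] at h2
      rw [h2] at h3
      generalize (s v').1.2 = e at h3 ⊢
      obtain ⟨x, b⟩ := e
      dsimp only at h3
      subst h3
      exact ⟨b, rfl⟩
    choose b hb using h1
    refine ⟨⟨b, (mem_flatSections_iff hf).mpr ?_⟩, ?_⟩
    · have : (fun v => (⟨f v, b v⟩ : EtaleSpace P)) = fun v => (s v).1.2 :=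
        funext fun v => (hb v).symm
      rw [this]
      exact continuous_snd.comp (continuous_subtype_val.comp s.continuous)
    · refine hmk _ _ _ ((hb v).symm.trans ?_)
      rw [hs]

end TopCat.Presheaf

/-! ### Transport of stalks along equalities of points -/

namespace TopCat.Presheaf

variable {X : TopCat.{0}} (P : TopCat.Presheaf (ModuleCat.{0} ℂ) X)

/-- The identification of the stalks at equal points. -/
noncomputable def stalkCast {x y : X} (h : x = y) : P.stalk x →ₗ[ℂ] P.stalk y := by
  subst h
  exact LinearMap.id

variable {P}

theorem stalkCast_germ {x y : X} (h : x = y) {W : Opens X} (hx : x ∈ W) (g : P.obj (op W)) :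
    P.stalkCast h (P.germ W x hx g) = P.germ W y (h ▸ hx) g := by
  subst h
  rfl

theorem stalkCast_stalkCast {x y z : X} (h : x = y) (h' : y = z) (a : P.stalk x) :
    P.stalkCast h' (P.stalkCast h a) = P.stalkCast (h.trans h') a := by
  subst h h'
  rfl

variable (P) in
/-- The identification of the stalks at equal points as an equivalence. -/
noncomputable def stalkCastEquiv {x y : X} (h : x = y) : P.stalk x ≃ₗ[ℂ] P.stalk y :=
  { P.stalkCast h with
    invFun := P.stalkCast h.symm
    left_inv := fun a => stalkCast_stalkCast h h.symm a
    right_inv := fun a => stalkCast_stalkCast h.symm h a }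

theorem stalkCast_map {P Q : TopCat.Presheaf (ModuleCat.{0} ℂ) X} (α : P ⟶ Q) {x y : X}
    (h : x = y) (a : P.stalk x) :
    (stalkFunctor (ModuleCat.{0} ℂ) y).map α (P.stalkCast h a) =
      Q.stalkCast h ((stalkFunctor (ModuleCat.{0} ℂ) x).map α a) := by
  subst h
  rfl

theorem stalkCast_mk {x y : X} (h : x = y) (a : P.stalk x) :
    (⟨y, P.stalkCast h a⟩ : EtaleSpace P) = ⟨x, a⟩ := by
  subst h
  rfl

theorem stalkCast_apply {V : Type} {f : V → X} (s : ∀ v, P.stalk (f v)) {v v' : V} (h : v = v')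
    (h' : f v = f v') : P.stalkCast h' (s v) = s v' := by
  subst h
  rfl

end TopCat.Presheaf

/-! ### Flat sections in logarithmic coordinates -/

namespace Fan

open TopCat.Presheaf

variable {n : ℕ} {Δ : Fan n}

theorem isLocallyTrivialAlong_expMap (F : Δ.LC) (σ : Δ.Cone) :
    IsLocallyTrivialAlong F.obj.presheaf (Δ.expMap σ) := by
  intro w
  obtain ⟨U, A, c, hU, hc, hA⟩ := IsLocallyConstantSheaf.exists_trivialization
    (TopCat.ofHom (Δ.orbitMap σ)) F.obj (F.property σ) (Δ.orbitExp σ w)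
  refine ⟨⟨Δ.orbitExp σ ⁻¹' U, U.isOpen.preimage (Δ.orbitExp σ).continuous⟩, A,
    fun w' => c (Δ.orbitExp σ w'), hU, fun w' hw' => hc _ hw', fun a w' hw' => ?_⟩
  obtain ⟨W, s, hW, V', hV', h⟩ := hA a _ hw'
  refine ⟨W, hW, s, ?_⟩
  filter_upwards [(Δ.orbitExp σ).continuous.continuousAt (V'.isOpen.mem_nhds hV')] with w'' hw''
  exact h _ hw''

/-- The space of flat sections of a sheaf along the universal cover of an orbit. -/
noncomputable abbrev flat (F : Δ.LC) (σ : Δ.Cone) :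
    Submodule ℂ (∀ w, F.obj.presheaf.stalk (Δ.expMap σ w)) :=
  F.obj.presheaf.flatSections (Δ.expMap σ)

/-- A flat section is determined by its value at any point, which is arbitrary. -/
noncomputable def flatEval (F : Δ.LC) (σ : Δ.Cone) (w : Fin n → ℂ) :
    flat F σ ≃ₗ[ℂ] F.obj.presheaf.stalk (Δ.expMap σ w) :=
  LinearEquiv.ofBijective ((LinearMap.proj w).comp (flat F σ).subtype)
    ((isLocallyTrivialAlong_expMap F σ).existsUnique (Δ.expMap σ).continuous w)

theorem flatEval_symm_apply {F : Δ.LC} {σ : Δ.Cone} (w : Fin n → ℂ)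
    (a : F.obj.presheaf.stalk (Δ.expMap σ w)) : ((flatEval F σ w).symm a).1 w = a :=
  (flatEval F σ w).apply_symm_apply a

theorem flat_ext {F : Δ.LC} {σ : Δ.Cone} (w : Fin n → ℂ) {s s' : flat F σ} (h : s.1 w = s'.1 w) :
    s = s' := (flatEval F σ w).injective h

/-! ### Monodromy -/

theorem expMap_add_period {σ : Δ.Cone} (l : periods σ.1) (w : Fin n → ℂ) :
    Δ.expMap σ (w + l.1) = Δ.expMap σ w :=
  Δ.expMap_eq_of_mem (by rw [add_sub_cancel_left]; exact l.2)

/-- Translation of flat sections by a period. -/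
noncomputable def translate (F : Δ.LC) {σ : Δ.Cone} (l : periods σ.1) : flat F σ →ₗ[ℂ] flat F σ where
  toFun s := ⟨fun w => F.obj.presheaf.stalkCast (expMap_add_period l w) (s.1 (w + l.1)), fun w => by
    obtain ⟨W, hW, g, hg⟩ := s.2 (w + l.1)
    refine ⟨W, expMap_add_period l w ▸ hW, g, ?_⟩
    have hc : Filter.Tendsto (fun w => w + l.1) (nhds w) (nhds (w + l.1)) :=
      (continuous_id.add continuous_const).continuousAt
    filter_upwards [hc.eventually hg] with w' ⟨h, h'⟩
    refine ⟨expMap_add_period l w' ▸ h, ?_⟩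
    rw [h']
    exact stalkCast_germ _ _ _⟩
  map_add' s s' := Subtype.ext (funext fun w => map_add _ _ _)
  map_smul' c s := Subtype.ext (funext fun w => map_smul _ _ _)

theorem translate_apply {F : Δ.LC} {σ : Δ.Cone} (l : periods σ.1) (s : flat F σ) (w : Fin n → ℂ)
    (h : Δ.expMap σ (w + l.1) = Δ.expMap σ w) :
    (translate F l s).1 w = F.obj.presheaf.stalkCast h (s.1 (w + l.1)) := rfl

theorem translate_add {F : Δ.LC} {σ : Δ.Cone} (l l' : periods σ.1) (s : flat F σ) :
    translate F (l + l') s = translate F l (translate F l' s) := by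
  refine Subtype.ext (funext fun w => ?_)
  rw [translate_apply _ _ _ (expMap_add_period _ _), translate_apply l _ _ (expMap_add_period _ _),
    translate_apply l' _ _ (expMap_add_period _ _), stalkCast_stalkCast]
  have e : w + (l + l').1 = w + l.1 + l'.1 := (add_assoc _ _ _).symm
  rw [← stalkCast_apply s.1 e (congrArg _ e), stalkCast_stalkCast]

/-- Along the segment from 0 to l the point of the orbit is fixed, so the values of s form a locally
constant function of t with values in one stalk. -/
theorem translate_of_mem_spanC {F : Δ.LC} {σ : Δ.Cone} {l : periods σ.1} (hl : l.1 ∈ spanC σ.1)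
    (s : flat F σ) : translate F l s = s := by
  have hp : ∀ t : ℝ, t • l.1 ∈ periods σ.1 := fun t =>
    mem_periods_of_mem_spanC ((spanC σ.1).smul_mem (t : ℂ) hl)
  have hE : ∀ t : ℝ, Δ.expMap σ (t • l.1) = Δ.expMap σ 0 := fun t =>
    Δ.expMap_eq_of_mem (by rw [sub_zero]; exact hp t)
  let k : ℝ → F.obj.presheaf.stalk (Δ.expMap σ 0) := fun t =>
    F.obj.presheaf.stalkCast (hE t) (s.1 (t • l.1))
  have hk : IsLocallyConstant k := by
    refine (IsLocallyConstant.iff_eventually_eq k).mpr fun t => ?_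
    obtain ⟨W, hW, g, hg⟩ := s.2 (t • l.1)
    have hc : Filter.Tendsto (fun t : ℝ => t • l.1) (nhds t) (nhds (t • l.1)) :=
      (continuous_id.smul continuous_const).continuousAt
    obtain ⟨_, h0⟩ := hg.self_of_nhds
    filter_upwards [hc.eventually hg] with t' ⟨_, h⟩
    change F.obj.presheaf.stalkCast _ _ = F.obj.presheaf.stalkCast _ _
    rw [h, h0]
    exact (stalkCast_germ _ _ _).trans (stalkCast_germ _ _ _).symm
  refine flat_ext 0 ?_
  have h1 := hk.apply_eq_of_preconnectedSpace 1 0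
  have e1 : (1 : ℝ) • l.1 = 0 + l.1 := by rw [one_smul, zero_add]
  have e0 : (0 : ℝ) • l.1 = 0 := zero_smul _ _
  change F.obj.presheaf.stalkCast _ _ = F.obj.presheaf.stalkCast _ _ at h1
  rw [stalkCast_apply s.1 e0] at h1
  rw [← h1, translate_apply _ _ _ (expMap_add_period _ _), ← stalkCast_apply s.1 e1 (congrArg _ e1),
    stalkCast_stalkCast]

theorem translate_eq_of_periodClass_eq {F : Δ.LC} {σ : Δ.Cone} {l l' : periods σ.1}
    (h : Δ.periodClass σ l = Δ.periodClass σ l') (s : flat F σ) :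
    translate F l s = translate F l' s := by
  have h1 : l = (l - l') + l' := (sub_add_cancel l l').symm
  rw [h1, translate_add, translate_of_mem_spanC (sub_mem_spanC_of_periodClass_eq h)]

/-- The monodromy representation on the space of flat sections. -/
noncomputable def monodromyRep (F : Δ.LC) (σ : Δ.Cone) :
    FundamentalGroup (Δ.Orbit σ) (Δ.basePoint σ) →* Module.End ℂ (flat F σ) where
  toFun g := translate F (periodClass_surjective σ g).choose
  map_one' := LinearMap.ext fun s =>
    (translate_eq_of_periodClass_eq (l' := 0)
      ((periodClass_surjective σ 1).choose_spec.trans (periodClass_zero σ).symm) s).trans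
      (translate_of_mem_spanC (zero_mem _) s)
  map_mul' g h := LinearMap.ext fun s => by
    refine (translate_eq_of_periodClass_eq (l' := (periodClass_surjective σ g).choose +
      (periodClass_surjective σ h).choose) ?_ s).trans (translate_add _ _ s)
    rw [periodClass_add, (periodClass_surjective σ g).choose_spec,
      (periodClass_surjective σ h).choose_spec, (periodClass_surjective σ (g * h)).choose_spec]

theorem monodromyRep_periodClass {F : Δ.LC} {σ : Δ.Cone} (l : periods σ.1) (s : flat F σ) :
    monodromyRep F σ (Δ.periodClass σ l) s = translate F l s :=
  translate_eq_of_periodClass_eq (periodClass_surjective σ _).choose_spec s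

/-! ### Cospecialization -/

/-- The flat section `t` on `O_τ` is given near a point of `O_σ` by the sections with germ `a`. -/
def IsCospAt {F : Δ.LC} {τ σ : Δ.Cone} (z : Fin n → ℂ)
    (a : F.obj.presheaf.stalk (Δ.expMap σ z)) (t : flat F τ) : Prop :=
  ∃ (W : Opens Δ.X) (hW : Δ.expMap σ z ∈ W) (g : F.obj.presheaf.obj (op W)),
    F.obj.presheaf.germ W _ hW g = a ∧ ∀ᶠ w in Δ.nearFilter τ σ z,
      ∃ h : Δ.expMap τ w ∈ W, t.1 w = F.obj.presheaf.germ W _ h g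

/-- Any section with germ a may be used in `IsCospAt`: two of them agree near the point. -/
theorem IsCospAt.eventually {F : Δ.LC} {τ σ : Δ.Cone} (hτ : τ ≤ σ) {z : Fin n → ℂ}
    {a : F.obj.presheaf.stalk (Δ.expMap σ z)} {t : flat F τ} (h : IsCospAt z a t)
    {W : Opens Δ.X} (hW : Δ.expMap σ z ∈ W) (g : F.obj.presheaf.obj (op W))
    (hg : F.obj.presheaf.germ W _ hW g = a) : ∀ᶠ w in Δ.nearFilter τ σ z,
      ∃ h : Δ.expMap τ w ∈ W, t.1 w = F.obj.presheaf.germ W _ h g := by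
  obtain ⟨W', hW', g', rfl, h⟩ := h
  filter_upwards [h, (tendsto_expMap hτ z).eventually (germ_eventually_eq hW hW' g g' hg)] with w
    ⟨_, h1⟩ ⟨h2, _, h3⟩
  exact ⟨h2, h1.trans h3.symm⟩

/-- The two flat sections agree at some point since the filter is proper, and one value determines a
flat section. -/
theorem IsCospAt.unique {F : Δ.LC} {τ σ : Δ.Cone} (hτ : τ ≤ σ) {z : Fin n → ℂ}
    {a : F.obj.presheaf.stalk (Δ.expMap σ z)} {t t' : flat F τ} (h : IsCospAt z a t)
    (h' : IsCospAt z a t') : t = t' := by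
  obtain ⟨W, hW, g, hg, h⟩ := h
  obtain ⟨w, ⟨_, h1⟩, ⟨_, h2⟩⟩ := (h.and (h'.eventually hτ hW g hg)).exists
  exact flat_ext w (h1.trans h2.symm)

theorem IsCospAt.add {F : Δ.LC} {τ σ : Δ.Cone} {z : Fin n → ℂ}
    {a a' : F.obj.presheaf.stalk (Δ.expMap σ z)} {t t' : flat F τ} (h : IsCospAt z a t)
    (h' : IsCospAt z a' t') : IsCospAt z (a + a') (t + t') := by
  obtain ⟨W, hW, g, rfl, h⟩ := h
  obtain ⟨W', hW', g', rfl, h'⟩ := h'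
  have key : ∀ (x : Δ.X) (hx : x ∈ W) (hx' : x ∈ W'), F.obj.presheaf.germ (W ⊓ W') x ⟨hx, hx'⟩
      (F.obj.presheaf.map (homOfLE inf_le_left).op g +
        F.obj.presheaf.map (homOfLE inf_le_right).op g') =
      F.obj.presheaf.germ W x hx g + F.obj.presheaf.germ W' x hx' g' := fun x hx hx' => by
    rw [map_add]
    exact congrArg₂ (· + ·) (F.obj.presheaf.germ_res_apply (homOfLE inf_le_left) x ⟨hx, hx'⟩ g)
      (F.obj.presheaf.germ_res_apply (homOfLE inf_le_right) x ⟨hx, hx'⟩ g')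
  refine ⟨W ⊓ W', ⟨hW, hW'⟩, F.obj.presheaf.map (homOfLE inf_le_left).op g +
    F.obj.presheaf.map (homOfLE inf_le_right).op g', key _ _ _, ?_⟩
  filter_upwards [h, h'] with w ⟨h1, h2⟩ ⟨h3, h4⟩
  refine ⟨⟨h1, h3⟩, Eq.trans ?_ (key _ h1 h3).symm⟩
  rw [← h2, ← h4]
  rfl

theorem IsCospAt.smul {F : Δ.LC} {τ σ : Δ.Cone} {z : Fin n → ℂ}
    {a : F.obj.presheaf.stalk (Δ.expMap σ z)} {t : flat F τ} (c : ℂ) (h : IsCospAt z a t) :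
    IsCospAt z (c • a) (c • t) := by
  obtain ⟨W, hW, g, rfl, h⟩ := h
  refine ⟨W, hW, c • g, map_smul _ _ _, ?_⟩
  filter_upwards [h] with w ⟨h1, h2⟩
  refine ⟨h1, ?_⟩
  rw [map_smul, ← h2]
  rfl

theorem eventually_flatEval_symm {F : Δ.LC} {σ : Δ.Cone} {w : Fin n → ℂ} {W : Opens Δ.X}
    (hw : Δ.expMap σ w ∈ W) (g : F.obj.presheaf.obj (op W)) :
    ∀ᶠ w' in nhds w, ∃ h : Δ.expMap σ w' ∈ W,
      (flatEval F σ w').symm (F.obj.presheaf.germ W _ h g) =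
        (flatEval F σ w).symm (F.obj.presheaf.germ W _ hw g) := by
  filter_upwards [flatSections_eventually ((flatEval F σ w).symm (F.obj.presheaf.germ W _ hw g)).2
    (Δ.expMap σ).continuous hw g (flatEval_symm_apply w _).symm] with w' ⟨h, h'⟩
  exact ⟨h, (LinearEquiv.symm_apply_eq _).mpr h'.symm⟩

/-- The flat section through the germ of g at w is locally constant in w, hence constant on the
connected set `nearSet`. -/
theorem exists_eqOn_nearSet {F : Δ.LC} {τ σ : Δ.Cone} {z : Fin n → ℂ} {A : Finset (Fin n → ℤ)}
    {δ : ℝ} {W : Opens Δ.X} (hA : ∀ m ∈ A, m ∈ dualMonoid σ.1) (hδ : 0 < δ)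
    (hW : ∀ w ∈ Δ.nearSet τ σ z A δ, Δ.expMap τ w ∈ W) (g : F.obj.presheaf.obj (op W)) :
    ∃ t : flat F τ, ∀ (w) (hw : w ∈ Δ.nearSet τ σ z A δ),
      t.1 w = F.obj.presheaf.germ W _ (hW w hw) g := by
  obtain ⟨w₀, hw₀⟩ := nearSet_nonempty (τ := τ) z hA hδ
  have : PreconnectedSpace (Δ.nearSet τ σ z A δ) :=
    Subtype.preconnectedSpace (convex_nearSet (Δ := Δ)).isPreconnected
  let k : Δ.nearSet τ σ z A δ → flat F τ := fun w =>
    (flatEval F τ w.1).symm (F.obj.presheaf.germ W _ (hW w.1 w.2) g)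
  have hk : IsLocallyConstant k := by
    refine (IsLocallyConstant.iff_eventually_eq k).mpr fun w => ?_
    filter_upwards [continuous_subtype_val.continuousAt.eventually
      (eventually_flatEval_symm (hW w.1 w.2) g)] with w' ⟨_, h⟩
    exact h
  refine ⟨k ⟨w₀, hw₀⟩, fun w hw => ?_⟩
  rw [hk.apply_eq_of_preconnectedSpace ⟨w₀, hw₀⟩ ⟨w, hw⟩]
  exact flatEval_symm_apply _ _

theorem exists_isCospAt {F : Δ.LC} {τ σ : Δ.Cone} (hτ : τ ≤ σ) (z : Fin n → ℂ)
    (a : F.obj.presheaf.stalk (Δ.expMap σ z)) : ∃ t : flat F τ, IsCospAt z a t := by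
  obtain ⟨W, hW, g, hg⟩ := F.obj.presheaf.exists_germ_eq a
  obtain ⟨A, hA, δ, hδ, hN⟩ := mem_nearFilter.mp ((tendsto_expMap hτ z) (W.isOpen.mem_nhds hW))
  obtain ⟨t, ht⟩ := exists_eqOn_nearSet (F := F) hA hδ hN g
  exact ⟨t, W, hW, g, hg, A, hA, δ, hδ, fun w hw => ⟨hN hw, ht w hw⟩⟩

/-- The flat section obtained at z is locally constant in z, because one section of F represents `s`
and its cospecialization at all nearby points; ℂⁿ is connected. -/
theorem exists_isCosp {F : Δ.LC} {τ σ : Δ.Cone} (hτ : τ ≤ σ) (s : flat F σ) :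
    ∃ t : flat F τ, ∀ z, IsCospAt z (s.1 z) t := by
  choose t ht using fun z => exists_isCospAt hτ z (s.1 z)
  have hk : IsLocallyConstant t := by
    refine (IsLocallyConstant.iff_eventually_eq t).mpr fun z => ?_
    obtain ⟨W, hW, g, hg, h⟩ := ht z
    filter_upwards [nhds_le_nearFilter σ z (nearFilter_nested le_rfl h),
      flatSections_eventually s.2 (Δ.expMap σ).continuous hW g hg] with z' h1 ⟨h2, h3⟩
    exact (ht z').unique hτ ⟨W, h2, g, h3.symm, h1⟩
  exact ⟨t 0, fun z => hk.apply_eq_of_preconnectedSpace z 0 ▸ ht z⟩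

/-- The cospecialization map between spaces of flat sections. -/
noncomputable def cosp (F : Δ.LC) {τ σ : Δ.Cone} (hτ : τ ≤ σ) : flat F σ →ₗ[ℂ] flat F τ where
  toFun s := (exists_isCosp hτ s).choose
  map_add' s s' := ((exists_isCosp hτ (s + s')).choose_spec 0).unique hτ
    (((exists_isCosp hτ s).choose_spec 0).add ((exists_isCosp hτ s').choose_spec 0))
  map_smul' c s := ((exists_isCosp hτ (c • s)).choose_spec 0).unique hτ
    (((exists_isCosp hτ s).choose_spec 0).smul c)

theorem isCospAt_cosp {F : Δ.LC} {τ σ : Δ.Cone} (hτ : τ ≤ σ) (s : flat F σ) (z : Fin n → ℂ) :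
    IsCospAt z (s.1 z) (cosp F hτ s) := (exists_isCosp hτ s).choose_spec z

theorem cosp_eq {F : Δ.LC} {τ σ : Δ.Cone} (hτ : τ ≤ σ) {s : flat F σ} {t : flat F τ}
    {z : Fin n → ℂ} (h : IsCospAt z (s.1 z) t) : cosp F hτ s = t :=
  (isCospAt_cosp hτ s z).unique hτ h

theorem cosp_refl {F : Δ.LC} {σ : Δ.Cone} (s : flat F σ) : cosp F le_rfl s = s := by
  obtain ⟨W, hW, g, hg, h⟩ := isCospAt_cosp le_rfl s 0
  obtain ⟨_, h1⟩ := mem_of_mem_nhds (nhds_le_nearFilter σ 0 h)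
  exact flat_ext 0 (h1.trans hg)

/-- Let one section near x_σ represent the germ of `s`. At a suitable nearby point of O_τ it
represents `cosp F hτ s`, and near that point it still gives the direct cospecialization to O_ρ. -/
theorem cosp_cosp {F : Δ.LC} {ρ τ σ : Δ.Cone} (hρ : ρ ≤ τ) (hτ : τ ≤ σ) (s : flat F σ) :
    cosp F hρ (cosp F hτ s) = cosp F (hρ.trans hτ) s := by
  obtain ⟨W, hW, g, hg, h⟩ := isCospAt_cosp hτ s 0
  have h1 := nearFilter_nested hτ ((isCospAt_cosp (hρ.trans hτ) s 0).eventually (hρ.trans hτ) hW g hg)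
  obtain ⟨w, ⟨h2, h3⟩, h4⟩ := (h.and h1).exists
  exact cosp_eq hρ ⟨W, h2, g, h3.symm, h4⟩

/-- Compare the cospecialization read off at the logarithm l with the one read off at 0: translation
by l matches the near filters and fixes the points of both orbits. -/
theorem cosp_translate {F : Δ.LC} {τ σ : Δ.Cone} (hτ : τ ≤ σ) (l : periods τ.1) (s : flat F σ) :
    cosp F hτ (translate F ⟨l.1, periods_mono hτ l.2⟩ s) = translate F l (cosp F hτ s) := by
  obtain ⟨W, hW, g, hg, h⟩ := isCospAt_cosp hτ s (0 + l.1)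
  have e := expMap_add_period (σ := σ) ⟨l.1, periods_mono hτ l.2⟩ 0
  have h1 := nearFilter_translate (neg_mem l.2) h
  rw [add_neg_cancel_right] at h1
  refine cosp_eq hτ (z := 0) ⟨W, e ▸ hW, g, ?_, ?_⟩
  · rw [translate_apply _ _ _ e]
    exact (stalkCast_germ e hW g).symm.trans (congrArg _ hg)
  · filter_upwards [h1] with w ⟨h2, h3⟩
    rw [sub_neg_eq_add] at h2
    have e' := expMap_add_period l w
    refine ⟨e' ▸ h2, ?_⟩
    rw [translate_apply _ _ _ e', ← stalkCast_germ e' h2 g]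
    refine congrArg _ ?_
    have e2 : w - -l.1 = w + l.1 := sub_neg_eq_add _ _
    rw [← stalkCast_apply (cosp F hτ s).1 e2 (congrArg _ e2), h3]
    exact stalkCast_germ _ _ _

/-! ### Morphisms -/

/-- The map on flat sections induced by a morphism. -/
noncomputable def flatMap {F G : Δ.LC} (α : F ⟶ G) (σ : Δ.Cone) : flat F σ →ₗ[ℂ] flat G σ where
  toFun s := ⟨fun w => (stalkFunctor (ModuleCat.{0} ℂ) (Δ.expMap σ w)).map α.hom.hom (s.1 w),
    fun w => by
      obtain ⟨W, hW, g, h⟩ := s.2 w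
      refine ⟨W, hW, α.hom.hom.app (op W) g, ?_⟩
      filter_upwards [h] with w' ⟨h1, h2⟩
      refine ⟨h1, ?_⟩
      rw [h2]
      exact stalkFunctor_map_germ_apply W _ h1 α.hom.hom g⟩
  map_add' s s' := Subtype.ext (funext fun w => map_add _ _ _)
  map_smul' c s := Subtype.ext (funext fun w => map_smul _ _ _)

theorem flatMap_apply {F G : Δ.LC} (α : F ⟶ G) {σ : Δ.Cone} (s : flat F σ) (w : Fin n → ℂ) :
    (flatMap α σ s).1 w = (stalkFunctor (ModuleCat.{0} ℂ) (Δ.expMap σ w)).map α.hom.hom (s.1 w) :=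
  rfl

theorem flatMap_translate {F G : Δ.LC} (α : F ⟶ G) {σ : Δ.Cone} (l : periods σ.1) (s : flat F σ) :
    flatMap α σ (translate F l s) = translate G l (flatMap α σ s) :=
  Subtype.ext (funext fun _ => stalkCast_map _ _ _)

theorem flatMap_cosp {F G : Δ.LC} (α : F ⟶ G) {τ σ : Δ.Cone} (hτ : τ ≤ σ) (s : flat F σ) :
    flatMap α τ (cosp F hτ s) = cosp G hτ (flatMap α σ s) := by
  obtain ⟨W, hW, g, hg, h⟩ := isCospAt_cosp hτ s 0
  refine (cosp_eq hτ (z := 0) ⟨W, hW, α.hom.hom.app (op W) g, ?_, ?_⟩).symm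
  · rw [flatMap_apply, ← hg]
    exact (stalkFunctor_map_germ_apply W _ hW α.hom.hom g).symm
  · filter_upwards [h] with w ⟨h1, h2⟩
    refine ⟨h1, ?_⟩
    rw [flatMap_apply, h2]
    exact stalkFunctor_map_germ_apply W _ h1 α.hom.hom g

end Fan

namespace Fan

open TopCat.Presheaf

variable {n : ℕ} {Δ : Fan n}

/-! ### The functor of stalks -/

/-- The action of the group algebra of the fundamental group on flat sections. -/
noncomputable def monodromyHom (F : Δ.LC) (σ : Δ.Cone) :
    MonoidAlgebra ℂ (FundamentalGroup (Δ.Orbit σ) (Δ.basePoint σ)) →+* Module.End ℂ (flat F σ) :=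
  (MonoidAlgebra.lift ℂ (Module.End ℂ (flat F σ)) _ (monodromyRep F σ)).toRingHom

theorem monodromyHom_single {F : Δ.LC} {σ : Δ.Cone}
    (g : FundamentalGroup (Δ.Orbit σ) (Δ.basePoint σ)) (c : ℂ) (s : flat F σ) :
    monodromyHom F σ (MonoidAlgebra.single g c) s = c • monodromyRep F σ g s :=
  congrArg (fun f : Module.End ℂ (flat F σ) => f s) (MonoidAlgebra.lift_single _ g c)

theorem cosp_monodromyHom {F : Δ.LC} {τ σ : Δ.Cone} (hτ : τ ≤ σ)
    (r : MonoidAlgebra ℂ (FundamentalGroup (Δ.Orbit τ) (Δ.basePoint τ))) (s : flat F σ) :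
    cosp F hτ (monodromyHom F σ (MonoidAlgebra.mapDomainRingHom ℂ (Δ.pi1Map hτ) r) s) =
      monodromyHom F τ r (cosp F hτ s) := by
  induction r using MonoidAlgebra.induction_linear with
  | zero => simp only [map_zero, LinearMap.zero_apply]
  | add r r' h h' => simp only [map_add, LinearMap.add_apply, h, h']
  | single g c =>
    obtain ⟨l, rfl⟩ := periodClass_surjective τ g
    have e : MonoidAlgebra.mapDomainRingHom ℂ (Δ.pi1Map hτ)
        (MonoidAlgebra.single (Δ.periodClass τ l) c) =
        MonoidAlgebra.single (Δ.periodClass σ ⟨l.1, periods_mono hτ l.2⟩) c :=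
      (MonoidAlgebra.mapDomain_single ..).trans (congrArg (MonoidAlgebra.single · c) (pi1Map_periodClass hτ l))
    rw [e, monodromyHom_single, monodromyHom_single, monodromyRep_periodClass,
      monodromyRep_periodClass, map_smul, cosp_translate]

theorem flatMap_monodromyHom {F G : Δ.LC} (α : F ⟶ G) {σ : Δ.Cone}
    (r : MonoidAlgebra ℂ (FundamentalGroup (Δ.Orbit σ) (Δ.basePoint σ))) (s : flat F σ) :
    flatMap α σ (monodromyHom F σ r s) = monodromyHom G σ r (flatMap α σ s) := by
  induction r using MonoidAlgebra.induction_linear with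
  | zero => simp only [map_zero, LinearMap.zero_apply]
  | add r r' h h' => simp only [map_add, LinearMap.add_apply, h, h']
  | single g c =>
    obtain ⟨l, rfl⟩ := periodClass_surjective σ g
    rw [monodromyHom_single, monodromyHom_single, monodromyRep_periodClass,
      monodromyRep_periodClass, map_smul, flatMap_translate]

/-- The space of flat sections as a module over the group algebra of the fundamental group. -/
noncomputable def flatModule (F : Δ.LC) (α : Δ.Coneᵒᵈ) : ModuleCat.{0} (Δ.B.obj (op α)) :=
  @ModuleCat.of (Δ.B.obj (op α)) _ (flat F (OrderDual.ofDual α)) _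
    (Module.compHom _ (monodromyHom F (OrderDual.ofDual α)))

/-- The co-module of flat sections. -/
noncomputable def etaObj (F : Δ.LC) : CoModule Δ.B where
  obj α := flatModule F α
  map h := (cosp F (OrderDual.ofDual_le_ofDual.mpr h)).toAddMonoidHom
  map_smul h r m := cosp_monodromyHom (OrderDual.ofDual_le_ofDual.mpr h) r m
  map_id _ m := cosp_refl m
  map_comp h h' m :=
    cosp_cosp (OrderDual.ofDual_le_ofDual.mpr h') (OrderDual.ofDual_le_ofDual.mpr h) m

/-- The linear map of flat sections induced by a morphism. -/
noncomputable def flatModuleMap {F G : Δ.LC} (α : F ⟶ G) (σ : Δ.Coneᵒᵈ) :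
    flatModule F σ ⟶ flatModule G σ :=
  ModuleCat.ofHom (X := flatModule F σ) (Y := flatModule G σ)
    { toFun := fun s => flatMap α (OrderDual.ofDual σ) s
      map_add' := fun s s' => map_add (flatMap α (OrderDual.ofDual σ)) s s'
      map_smul' := fun r s => flatMap_monodromyHom α r s }

variable (Δ) in
/-- The functor of flat sections. -/
noncomputable def eta : Δ.LC ⥤ CoModule Δ.B where
  obj F := etaObj F
  map α :=
    { app := fun σ => flatModuleMap α σ
      naturality := fun h m => flatMap_cosp α (OrderDual.ofDual_le_ofDual.mpr h) m }
  map_id F := by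
    refine CoModule.Hom.ext (funext fun σ => ModuleCat.hom_ext (LinearMap.ext fun s => ?_))
    refine Subtype.ext (funext fun w => ?_)
    change (stalkFunctor (ModuleCat.{0} ℂ) _).map (𝟙 F.obj.presheaf) (s.1 w) = s.1 w
    rw [CategoryTheory.Functor.map_id]
    rfl
  map_comp {F G H} α β := by
    refine CoModule.Hom.ext (funext fun σ => ModuleCat.hom_ext (LinearMap.ext fun s => ?_))
    refine Subtype.ext (funext fun w => ?_)
    change (stalkFunctor (ModuleCat.{0} ℂ) _).map (α.hom.hom ≫ β.hom.hom) (s.1 w) = _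
    rw [CategoryTheory.Functor.map_comp]
    rfl

theorem expMap_zero (σ : Δ.Cone) : Δ.expMap σ 0 = Δ.point σ :=
  congrArg (Δ.orbitMap σ) (Δ.orbitExp_zero σ)

end Fan

/-! ### Morphisms of sheaves from maps on stalks -/

namespace TopCat.Presheaf

variable {X : TopCat.{0}}

theorem hom_ext_of_stalk {F G : TopCat.Sheaf (ModuleCat.{0} ℂ) X} {α β : F ⟶ G}
    (h : ∀ (x : X) (a : F.presheaf.stalk x), (stalkFunctor (ModuleCat.{0} ℂ) x).map α.hom a =
      (stalkFunctor (ModuleCat.{0} ℂ) x).map β.hom a) : α = β := by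
  refine CategoryTheory.Sheaf.hom_ext (NatTrans.ext (funext fun W => ModuleCat.hom_ext (LinearMap.ext fun g => ?_)))
  refine section_ext G W.unop _ _ fun x hx => ?_
  exact (stalkFunctor_map_germ_apply W.unop x hx α.hom g).symm.trans ((h x _).trans
    (stalkFunctor_map_germ_apply W.unop x hx β.hom g))

/-- A family of germs that is locally given by sections comes from a section. -/
theorem exists_section_of_locally (G : TopCat.Sheaf (ModuleCat.{0} ℂ) X) (W : Opens X)
    (s : ∀ x, G.presheaf.stalk x) (hs : ∀ x ∈ W, ∃ (W' : Opens X) (_ : x ∈ W')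
      (g : G.presheaf.obj (op W')), ∀ᶠ y in nhds x, ∃ hy : y ∈ W', s y = G.presheaf.germ W' y hy g) :
    ∃ k : G.presheaf.obj (op W), ∀ (x) (hx : x ∈ W), G.presheaf.germ W x hx k = s x := by
  have h1 : ∀ x : W, ∃ (U : Opens X) (_ : x.1 ∈ U) (_ : U ≤ W) (g : G.presheaf.obj (op U)),
      ∀ (y) (hy : y ∈ U), G.presheaf.germ U y hy g = s y := fun x => by
    obtain ⟨W', hx', g, h⟩ := hs x.1 x.2
    obtain ⟨N, hN, hNo, hxN⟩ := eventually_nhds_iff.mp h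
    have hle : (⟨N, hNo⟩ : Opens X) ⊓ W ≤ W' := fun y hy => (hN y hy.1).1
    refine ⟨⟨N, hNo⟩ ⊓ W, ⟨hxN, x.2⟩, inf_le_right, G.presheaf.map (homOfLE hle).op g,
      fun y hy => ?_⟩
    exact (G.presheaf.germ_res_apply _ y hy g).trans (hN y hy.1).2.symm
  choose U hxU hUW g hg using h1
  obtain ⟨k, hk, -⟩ := G.existsUnique_gluing' U W (fun x => homOfLE (hUW x))
    (fun x hx => Opens.mem_iSup.mpr ⟨⟨x, hx⟩, hxU ⟨x, hx⟩⟩) g fun x y => by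
      refine section_ext G _ _ _ fun z hz => ?_
      exact (G.presheaf.germ_res_apply _ z hz _).trans (((hg x z hz.1).trans
        (hg y z hz.2).symm).trans (G.presheaf.germ_res_apply _ z hz _).symm)
  refine ⟨k, fun x hx => ?_⟩
  refine (G.presheaf.germ_res_apply (homOfLE (hUW ⟨x, hx⟩)) x (hxU ⟨x, hx⟩) k).symm.trans ?_
  exact (congrArg _ (hk ⟨x, hx⟩)).trans (hg ⟨x, hx⟩ x (hxU ⟨x, hx⟩))

/-- Maps on stalks that take sections to local sections come from a morphism. -/
theorem exists_hom_of_stalk (F G : TopCat.Sheaf (ModuleCat.{0} ℂ) X)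
    (h : ∀ x, F.presheaf.stalk x →ₗ[ℂ] G.presheaf.stalk x)
    (hs : ∀ (W : Opens X) (f : F.presheaf.obj (op W)), ∀ x ∈ W, ∃ (W' : Opens X)
      (_ : x ∈ W') (g : G.presheaf.obj (op W')), ∀ᶠ y in nhds x, ∃ (hy : y ∈ W) (hy' : y ∈ W'),
        h y (F.presheaf.germ W y hy f) = G.presheaf.germ W' y hy' g) :
    ∃ α : F ⟶ G, ∀ (x) (a : F.presheaf.stalk x),
      (stalkFunctor (ModuleCat.{0} ℂ) x).map α.hom a = h x a := by
  classical
  have h1 : ∀ (W : Opens X) (f : F.presheaf.obj (op W)), ∃ k : G.presheaf.obj (op W),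
      ∀ (x) (hx : x ∈ W), G.presheaf.germ W x hx k = h x (F.presheaf.germ W x hx f) := fun W f => by
    obtain ⟨k, hk⟩ := exists_section_of_locally G W
      (fun x => if hx : x ∈ W then h x (F.presheaf.germ W x hx f) else 0) fun x hx => by
        obtain ⟨W', hx', g, hg⟩ := hs W f x hx
        refine ⟨W', hx', g, ?_⟩
        filter_upwards [hg] with y ⟨h1, h2, h3⟩
        exact ⟨h2, by rw [dif_pos h1, h3]⟩
    exact ⟨k, fun x hx => by rw [hk x hx, dif_pos hx]⟩
  choose k hk using h1
  have hext : ∀ {W : Opens X} {s t : G.presheaf.obj (op W)}, (∀ (x) (hx : x ∈ W),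
      G.presheaf.germ W x hx s = G.presheaf.germ W x hx t) → s = t :=
    fun {W s t} h => section_ext G W s t h
  let α : F.presheaf ⟶ G.presheaf :=
    { app := fun W => ModuleCat.ofHom
        { toFun := fun f => k W.unop f
          map_add' := fun f f' => hext fun x hx => by
            rw [hk, map_add, map_add, map_add, hk, hk]
          map_smul' := fun c f => hext fun x hx => by
            rw [hk, map_smul, map_smul, RingHom.id_apply, map_smul, hk] }
      naturality := fun W W' i => ModuleCat.hom_ext (LinearMap.ext fun f => hext fun x hx => by
        change G.presheaf.germ W'.unop x hx (k W'.unop (F.presheaf.map i f)) =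
          G.presheaf.germ W'.unop x hx (G.presheaf.map i (k W.unop f))
        rw [hk]
        refine (congrArg (h x) (F.presheaf.germ_res_apply i.unop x hx f)).trans ?_
        exact (hk _ _ _ _).symm.trans (G.presheaf.germ_res_apply i.unop x hx _).symm) }
  refine ⟨⟨α⟩, fun x a => ?_⟩
  obtain ⟨W, hW, f, rfl⟩ := F.presheaf.exists_germ_eq a
  exact (stalkFunctor_map_germ_apply W x hW α f).trans (hk W f x hW)

end TopCat.Presheaf

/-! ### Faithfulness -/

namespace Fan

open TopCat.Presheaf

variable {n : ℕ} {Δ : Fan n}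

instance : (eta Δ).Faithful where
  map_injective {F G α β} h := by
    refine ObjectProperty.hom_ext _ (hom_ext_of_stalk fun x a => ?_)
    obtain ⟨σ, w, rfl⟩ := Δ.exists_expMap_eq x
    have h1 : flatMap α σ ((flatEval F σ w).symm a) = flatMap β σ ((flatEval F σ w).symm a) :=
      congrArg (fun f : (eta Δ).obj F ⟶ (eta Δ).obj G => (CoModule.Hom.app f
        (OrderDual.toDual σ)).hom ((flatEval F σ w).symm a)) h
    have h2 := congrFun (congrArg Subtype.val h1) w
    rw [flatMap_apply, flatMap_apply, flatEval_symm_apply] at h2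
    exact h2

end Fan

namespace Fan

open TopCat.Presheaf

variable {n : ℕ} {Δ : Fan n}

/-! ### Fullness -/

/-- Evaluation turns `k` into maps on stalks. Equivariance makes them independent of the logarithm,
and compatibility with cospecialization makes them take sections to sections across orbits. -/
theorem exists_hom_of_flat {F G : Δ.LC} (k : ∀ σ, flat F σ →ₗ[ℂ] flat G σ)
    (hk : ∀ (σ) (l : periods σ.1) (s : flat F σ), k σ (translate F l s) = translate G l (k σ s))
    (hc : ∀ {τ σ : Δ.Cone} (h : τ ≤ σ) (s : flat F σ), k τ (cosp F h s) = cosp G h (k σ s)) :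
    ∃ α : F ⟶ G, ∀ σ s, flatMap α σ s = k σ s := by
  have h1 : ∀ x : Δ.X, ∃ H : F.obj.presheaf.stalk x →ₗ[ℂ] G.obj.presheaf.stalk x,
      ∀ (σ w) (e : Δ.expMap σ w = x) (s : flat F σ), H (F.obj.presheaf.stalkCast e (s.1 w)) =
        G.obj.presheaf.stalkCast e ((k σ s).1 w) := fun x => by
    obtain ⟨σ, w, rfl⟩ := Δ.exists_expMap_eq x
    refine ⟨(flatEval G σ w).toLinearMap ∘ₗ k σ ∘ₗ (flatEval F σ w).symm.toLinearMap,
      fun σ' w' e s => ?_⟩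
    obtain rfl := Δ.cone_eq_of_expMap_eq e
    -- Two logarithms of the same point differ by a period, and `k` commutes with translation by it.
    let l : periods σ'.1 := ⟨w' - w, Δ.expMap_eq_iff.mp e⟩
    have e' : w' = w + l.1 := (add_sub_cancel w w').symm
    have hF : ∀ (F : Δ.LC) (s : flat F σ'), F.obj.presheaf.stalkCast e (s.1 w') =
        (translate F l s).1 w := fun F s => by
      rw [translate_apply _ _ _ (expMap_add_period l w), ← stalkCast_apply s.1 e' (congrArg _ e'),
        stalkCast_stalkCast]
    rw [hF, hF, ← hk]
    change (k σ' ((flatEval F σ' w).symm (flatEval F σ' w (translate F l s)))).1 w = _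
    rw [LinearEquiv.symm_apply_apply]
  choose H hH using h1
  have hH' : ∀ (σ w) (s : flat F σ), H (Δ.expMap σ w) (s.1 w) = (k σ s).1 w :=
    fun σ w s => hH _ σ w rfl s
  obtain ⟨α, hα⟩ := exists_hom_of_stalk F.obj G.obj H fun W f x hx => by
    obtain ⟨σ, z, rfl⟩ := Δ.exists_expMap_eq x
    have hs : F.obj.presheaf.germ W _ hx f =
      ((flatEval F σ z).symm (F.obj.presheaf.germ W _ hx f)).1 z := (flatEval_symm_apply z _).symm
    generalize (flatEval F σ z).symm (F.obj.presheaf.germ W _ hx f) = s at hs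
    obtain ⟨W', hW', g, hg⟩ := G.obj.presheaf.exists_germ_eq ((k σ s).1 z)
    -- On each orbit O_τ near the point, f gives the cospecialization of s and g that of `k σ s`;
    -- `hc` says that `k τ` relates them.
    refine ⟨W', hW', g, mem_nhds_expMap_iff.mpr fun τ hτ => ?_⟩
    filter_upwards [(isCospAt_cosp hτ s z).eventually hτ hx f hs,
      (isCospAt_cosp hτ (k σ s) z).eventually hτ hW' g hg] with w ⟨h1, h2⟩ ⟨h3, h4⟩
    refine ⟨h1, h3, ?_⟩
    rw [← h4, ← hc hτ s, ← hH']
    exact congrArg _ h2.symm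
  refine ⟨⟨α⟩, fun σ s => Subtype.ext (funext fun w => ?_)⟩
  exact (hα _ _).trans (hH' σ w s)

theorem flatModule_smul {F : Δ.LC} {σ : Δ.Cone}
    (g : FundamentalGroup (Δ.Orbit σ) (Δ.basePoint σ)) (c : ℂ)
    (s : flatModule F (OrderDual.toDual σ)) :
    Δ.monomialB σ g c • s = (c • monodromyRep F σ g s : flat F σ) :=
  monodromyHom_single g c s

theorem flatModule_smul_one {F : Δ.LC} {σ : Δ.Cone} (c : ℂ)
    (s : flatModule F (OrderDual.toDual σ)) :
    Δ.monomialB σ 1 c • s = (c • (show flat F σ from s) : flat F σ) :=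
  (flatModule_smul 1 c s).trans (by rw [map_one]; rfl)

theorem flatModule_smul_periodClass {F : Δ.LC} {σ : Δ.Cone} (l : periods σ.1)
    (s : flatModule F (OrderDual.toDual σ)) :
    Δ.monomialB σ (Δ.periodClass σ l) 1 • s = translate F l s :=
  (flatModule_smul _ 1 s).trans ((one_smul ℂ _).trans (monodromyRep_periodClass l s))

/-- The components of a morphism of co-modules of flat sections. -/
noncomputable def component {F G : Δ.LC} (h : (eta Δ).obj F ⟶ (eta Δ).obj G) (σ : Δ.Cone) :
    flatModule F (OrderDual.toDual σ) →ₗ[Δ.B.obj (op (OrderDual.toDual σ))]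
      flatModule G (OrderDual.toDual σ) := (CoModule.Hom.app h (OrderDual.toDual σ)).hom

/-- The components of a morphism of co-modules of flat sections as complex linear maps. -/
noncomputable def componentC {F G : Δ.LC} (h : (eta Δ).obj F ⟶ (eta Δ).obj G) (σ : Δ.Cone) :
    flat F σ →ₗ[ℂ] flat G σ where
  toFun s := component h σ s
  map_add' s s' := (component h σ).map_add s s'
  map_smul' c s := (congrArg (component h σ) (flatModule_smul_one c s)).symm.trans
    (((component h σ).map_smul (Δ.monomialB σ 1 c) s).trans (flatModule_smul_one c _))

instance : (eta Δ).Full where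
  map_surjective {F G} h := by
    obtain ⟨α, hα⟩ := exists_hom_of_flat (componentC h)
      (fun σ l s => (congrArg (component h σ) (flatModule_smul_periodClass l s)).symm.trans
        (((component h σ).map_smul _ s).trans (flatModule_smul_periodClass l _)))
      (fun {τ σ} hτ s => CoModule.Hom.naturality h (OrderDual.toDual_le_toDual.mpr hτ) s)
    refine ⟨α, CoModule.Hom.ext (funext fun σ => ModuleCat.hom_ext (LinearMap.ext fun s => ?_))⟩
    exact hα (OrderDual.ofDual σ) s

/-! ### Compatibility with the stalks at the distinguished points -/

/-- The identification of the stalk at the distinguished point with the flat sections. -/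
noncomputable def stalkAtEquiv (F : Δ.LC) (σ : Δ.Cone) : Δ.stalkAt F σ ≃ₗ[ℂ] flat F σ :=
  (F.obj.presheaf.stalkCastEquiv (expMap_zero σ)).symm.trans (flatEval F σ 0).symm

theorem stalkAtEquiv_apply_zero {F : Δ.LC} {σ : Δ.Cone} (a : Δ.stalkAt F σ) :
    (stalkAtEquiv F σ a).1 0 = F.obj.presheaf.stalkCast (expMap_zero σ).symm a :=
  flatEval_symm_apply (F := F) (σ := σ) 0 (F.obj.presheaf.stalkCast (expMap_zero σ).symm a)

theorem stalkAtEquiv_eq_iff {F : Δ.LC} {σ : Δ.Cone} {a : Δ.stalkAt F σ} {s : flat F σ} :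
    stalkAtEquiv F σ a = s ↔ a = F.obj.presheaf.stalkCast (expMap_zero σ) (s.1 0) := by
  constructor
  · rintro rfl
    rw [stalkAtEquiv_apply_zero, stalkCast_stalkCast]
    rfl
  · rintro rfl
    refine flat_ext 0 ?_
    rw [stalkAtEquiv_apply_zero, stalkCast_stalkCast]
    rfl

theorem continuous_flat {F : Δ.LC} {σ : Δ.Cone} (s : flat F σ) :
    Continuous fun w => (⟨Δ.expMap σ w, s.1 w⟩ : EtaleSpace F.obj.presheaf) :=
  (mem_flatSections_iff (Δ.expMap σ).continuous).mp s.2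

theorem flat_mk_translate {F : Δ.LC} {σ : Δ.Cone} (l : periods σ.1) (s : flat F σ)
    (w : Fin n → ℂ) : (⟨Δ.expMap σ w, (translate F l s).1 w⟩ : EtaleSpace F.obj.presheaf) =
      ⟨Δ.expMap σ (w + l.1), s.1 (w + l.1)⟩ := stalkCast_mk _ _

/-- A flat section evaluated along a lift of γ is a continuous lift of γ to the étale space; its end
value at l is the value at 0 of the translated section. -/
theorem transport_translate {F : Δ.LC} {σ : Δ.Cone} (γ : Path (Δ.basePoint σ) (Δ.basePoint σ))
    {l : periods σ.1} (w : Path 0 l.1) (hw : ∀ t, Δ.orbitExp σ (w t) = γ t) (a : Δ.stalkAt F σ) :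
    Δ.Transport F γ a ((stalkAtEquiv F σ).symm (translate F l (stalkAtEquiv F σ a))) := by
  refine ⟨⟨fun t => ⟨Δ.expMap σ (w t), (stalkAtEquiv F σ a).1 (w t)⟩,
    (continuous_flat _).comp w.continuous⟩, fun t => ?_, ?_, ?_⟩
  · exact congrArg (Δ.orbitMap σ) (hw t)
  · change (⟨Δ.expMap σ (w 0), (stalkAtEquiv F σ a).1 (w 0)⟩ : EtaleSpace F.obj.presheaf) = _
    rw [w.source, stalkAtEquiv_apply_zero]
    exact stalkCast_mk _ _
  · change (⟨Δ.expMap σ (w 1), (stalkAtEquiv F σ a).1 (w 1)⟩ : EtaleSpace F.obj.presheaf) = _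
    have h1 : stalkAtEquiv F σ ((stalkAtEquiv F σ).symm (translate F l (stalkAtEquiv F σ a))) =
      translate F l (stalkAtEquiv F σ a) := LinearEquiv.apply_symm_apply _ _
    rw [stalkAtEquiv_eq_iff.mp h1, stalkCast_mk, flat_mk_translate, w.target, zero_add]

theorem isOpen_nearSet_empty {τ σ : Δ.Cone} {z : Fin n → ℂ} {δ : ℝ} :
    IsOpen (Δ.nearSet τ σ z ∅ δ) := by
  have : Δ.nearSet τ σ z ∅ δ = ⋃ k ∈ spanC σ.1, (fun w => w - k) ⁻¹' Metric.ball z δ := by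
    ext w
    simp [nearSet]
  rw [this]
  exact isOpen_biUnion fun k _ => Metric.isOpen_ball.preimage (continuous_id.sub continuous_const)

/-- Being over a ball in O_σ restricts w only modulo `spanC σ` and periods, so no monomial condition
is imposed and the set A is empty. -/
theorem exists_nearSet_of_orbitProj {τ σ : Δ.Cone} (h : τ ≤ σ) {δ : ℝ} {y : Δ.Orbit τ}
    (hy : Δ.orbitProj h y ∈ Δ.orbitExp σ '' Metric.ball 0 δ) :
    ∃ w ∈ Δ.nearSet τ σ 0 ∅ δ, Δ.orbitExp τ w = y := by
  obtain ⟨S, hS⟩ := Δ.exists_generators σ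
  obtain ⟨w, rfl⟩ := Δ.exists_orbitExp_eq y
  obtain ⟨w', hw', e⟩ := hy
  rw [orbitProj_orbitExp, eq_comm, orbitExp_eq_iff] at e
  obtain ⟨ν, hν⟩ := exists_intPeriod hS e
  refine ⟨w - intPeriod ν, ⟨⟨_, hν, ?_⟩, by simp⟩, ?_⟩
  · convert hw' using 1
    abel
  · rw [orbitExp_eq_iff, sub_sub_cancel_left]
    exact neg_mem (intPeriod_mem_periods ν)

theorem orbitProj_mem_of_nearSet {τ σ : Δ.Cone} (h : τ ≤ σ) {A : Finset (Fin n → ℤ)} {δ : ℝ}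
    {w : Fin n → ℂ} (hw : w ∈ Δ.nearSet τ σ 0 A δ) :
    Δ.orbitProj h (Δ.orbitExp τ w) ∈ Δ.orbitExp σ '' Metric.ball 0 δ := by
  obtain ⟨⟨k, hk, hkw⟩, -⟩ := hw
  refine ⟨_, hkw, ?_⟩
  rw [orbitProj_orbitExp, orbitExp_eq_iff, sub_sub_cancel_left]
  exact neg_mem (mem_periods_of_mem_spanC hk)

/-- A cospecialized flat section descends to the fibres of the projection of orbits. -/
theorem cosp_mk_eq {F : Δ.LC} {τ σ : Δ.Cone} (h : τ ≤ σ) (s : flat F σ) {δ ε : ℝ}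
    (hε : ∀ l ∈ periods σ.1, ‖l‖ < ε → l ∈ spanC σ.1) (hδ : 2 * δ ≤ ε) {w w' : Fin n → ℂ}
    (hw : w ∈ Δ.nearSet τ σ 0 ∅ δ) (hw' : w' ∈ Δ.nearSet τ σ 0 ∅ δ)
    (e : Δ.orbitExp τ w = Δ.orbitExp τ w') :
    (⟨Δ.expMap τ w, (cosp F h s).1 w⟩ : EtaleSpace F.obj.presheaf) =
      ⟨Δ.expMap τ w', (cosp F h s).1 w'⟩ := by
  obtain ⟨⟨k, hk, hkw⟩, -⟩ := hw
  obtain ⟨⟨k', hk', hkw'⟩, -⟩ := hw'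
  let l : periods τ.1 := ⟨w - w', Δ.orbitExp_eq_iff.mp e⟩
  have hl : l.1 ∈ spanC σ.1 := by
    have h1 : (w - k) - (w' - k') ∈ spanC σ.1 := by
      refine hε _ ?_ ?_
      · have := sub_mem (periods_mono h l.2)
          (mem_periods_of_mem_spanC ((spanC σ.1).sub_mem hk hk'))
        convert this using 1
        simp only [l]
        abel
      · rw [mem_ball_zero_iff] at hkw hkw'
        have := norm_sub_le (w - k) (w' - k')
        linarith
    have h2 := add_mem h1 ((spanC σ.1).sub_mem hk hk')
    convert h2 using 1
    simp only [l]
    abel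
  -- The period l of O_τ lies in `spanC σ`, so it fixes s and, by equivariance, the cospecialization
  -- of s.
  have h3 : translate F l (cosp F h s) = cosp F h s := by
    rw [← cosp_translate h, translate_of_mem_spanC (l := ⟨l.1, periods_mono h l.2⟩) hl]
  have h4 := flat_mk_translate l (cosp F h s) w'
  rw [h3] at h4
  have e' : w' + l.1 = w := add_sub_cancel w' w
  rw [h4, e']

/-- Over the part of O_τ that projects to a small ball in O_σ, the flat section `cosp F h s` has the
same value at all logarithms in the near set, so it descends to a section of F on this part of the
orbit. -/
theorem cospecialize_cosp {F : Δ.LC} {τ σ : Δ.Cone} (h : τ ≤ σ) (a : Δ.stalkAt F σ) :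
    Δ.Cospecialize F h a ((stalkAtEquiv F τ).symm (cosp F h (stalkAtEquiv F σ a))) := by
  obtain ⟨S, hS⟩ := Δ.exists_generators σ
  obtain ⟨ε, hε, hεl⟩ := exists_pos_mem_spanC hS
  have ha : a = F.obj.presheaf.stalkCast (expMap_zero σ) ((stalkAtEquiv F σ a).1 0) :=
    stalkAtEquiv_eq_iff.mp rfl
  have hb : stalkAtEquiv F τ ((stalkAtEquiv F τ).symm (cosp F h (stalkAtEquiv F σ a))) =
    cosp F h (stalkAtEquiv F σ a) := LinearEquiv.apply_symm_apply _ _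
  rw [stalkAtEquiv_eq_iff] at hb
  generalize (stalkAtEquiv F τ).symm (cosp F h (stalkAtEquiv F σ a)) = b at hb
  generalize stalkAtEquiv F σ a = s at ha hb
  subst ha hb
  obtain ⟨W, hW, g, hg, A, hA, δ₀, hδ₀, hN⟩ := isCospAt_cosp h s 0
  -- With 2δ ≤ ε, two logarithms of one point in the near set differ by a vector in `spanC σ`.
  let δ := min δ₀ (ε / 2)
  have hδ : 0 < δ := lt_min hδ₀ (half_pos hε)
  have hδε : 2 * δ ≤ ε := by
    have := min_le_right δ₀ (ε / 2)
    change 2 * min δ₀ (ε / 2) ≤ ε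
    linarith
  have hN' : ∀ w ∈ Δ.nearSet τ σ 0 A δ, ∃ hw : Δ.expMap τ w ∈ W,
      (cosp F h s).1 w = F.obj.presheaf.germ W _ hw g := fun w hw =>
    hN (nearSet_mono (Finset.Subset.refl A) hδ (min_le_left _ _) hw)
  obtain ⟨B, hB⟩ := exists_opens_nearSet σ 0 A hA hδ
  have hB0 : Δ.point σ ∈ B := by
    rw [← expMap_zero]
    refine (hB σ 0).mpr ⟨le_rfl, 0, ?_⟩
    have h0 : intPeriod (0 : Fin n → ℤ) = 0 := by ext i; simp [intPeriod]
    rw [h0, sub_zero]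
    exact ⟨⟨0, zero_mem _, by simpa using hδ⟩, fun m _ h1 h2 => (h2 h1).elim⟩
  let V : Opens (Δ.Orbit σ) :=
    ⟨Δ.orbitExp σ '' Metric.ball 0 δ, Δ.isOpenMap_orbitExp σ _ Metric.isOpen_ball⟩
  -- An arbitrary logarithm in the near set; `hval` shows that the value does not depend on it.
  choose w hw hwy using fun y : Δ.orbitProj h ⁻¹' (V : Set (Δ.Orbit σ)) =>
    exists_nearSet_of_orbitProj h (y := y.1) y.2
  have hval : ∀ (y : Δ.orbitProj h ⁻¹' (V : Set (Δ.Orbit σ))), ∀ w' ∈ Δ.nearSet τ σ 0 ∅ δ,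
      Δ.orbitExp τ w' = y.1 → (⟨Δ.expMap τ (w y), (cosp F h s).1 (w y)⟩ :
        EtaleSpace F.obj.presheaf) = ⟨Δ.expMap τ w', (cosp F h s).1 w'⟩ := fun y w' hw' e =>
    cosp_mk_eq h s hεl hδε (hw y) hw' ((hwy y).trans e.symm)
  have hcont : Continuous fun y : Δ.orbitProj h ⁻¹' (V : Set (Δ.Orbit σ)) =>
      (⟨Δ.expMap τ (w y), (cosp F h s).1 (w y)⟩ : EtaleSpace F.obj.presheaf) := by
    refine continuous_iff_continuousAt.mpr fun y O hO => ?_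
    have h1 := Filter.inter_mem (isOpen_nearSet_empty.mem_nhds (hw y))
      ((continuous_flat (cosp F h s)).continuousAt hO)
    have h2 := (Δ.isOpenMap_orbitExp τ).image_mem_nhds h1
    rw [hwy y] at h2
    refine Filter.mem_map.mpr (Filter.mem_of_superset
      (continuous_subtype_val.continuousAt.preimage_mem_nhds h2) ?_)
    rintro y' ⟨w', ⟨hw', hO'⟩, e⟩
    change (⟨Δ.expMap τ (w y'), (cosp F h s).1 (w y')⟩ : EtaleSpace F.obj.presheaf) ∈ O
    rw [hval y' w' hw' e]
    exact hO'
  have h0 : (0 : Fin n → ℂ) ∈ Δ.nearSet τ σ 0 ∅ δ :=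
    ⟨⟨0, zero_mem _, by simpa using hδ⟩, by simp⟩
  have hWp : Δ.point σ ∈ W := expMap_zero (Δ := Δ) σ ▸ hW
  -- Points of O_τ in `B` project into V and have a logarithm where g represents the cospecialized
  -- section; W alone need not ensure this.
  refine ⟨B ⊓ W, ⟨hB0, hWp⟩, F.obj.presheaf.map (homOfLE inf_le_right).op g, V, ⟨_, hcont⟩, ?_, ?_,
    fun y => ?_, fun y hy => ?_, ?_⟩
  · change Δ.orbitProj h (Δ.basePoint τ) ∈ Δ.orbitExp σ '' Metric.ball 0 δ
    rw [← orbitExp_zero]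
    exact orbitProj_mem_of_nearSet h h0
  · refine (F.obj.presheaf.germ_res_apply (homOfLE inf_le_right) _ ⟨hB0, hWp⟩ g).trans ?_
    rw [← hg]
    exact (stalkCast_germ _ _ _).symm
  · exact congrArg (Δ.orbitMap τ) (hwy y)
  · obtain ⟨w', rfl⟩ := Δ.exists_orbitExp_eq y
    obtain ⟨-, ν, hν⟩ := (hB τ w').mp hy.1
    have e : Δ.orbitExp τ (w' - intPeriod ν) = Δ.orbitExp τ w' := by
      rw [orbitExp_eq_iff, sub_sub_cancel_left]
      exact neg_mem (intPeriod_mem_periods ν)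
    have hν' := nearSet_mono (Finset.empty_subset A) hδ le_rfl hν
    refine ⟨?_, ?_⟩
    · change Δ.orbitProj h (Δ.orbitExp τ w') ∈ Δ.orbitExp σ '' Metric.ball 0 δ
      rw [← e]
      exact orbitProj_mem_of_nearSet h hν
    · refine (hval _ _ hν' e).trans ?_
      obtain ⟨h1, h2⟩ := hN' _ hν
      rw [h2]
      have e' : Δ.expMap τ (w' - intPeriod ν) = Δ.orbitMap τ (Δ.orbitExp τ w') :=
        congrArg (Δ.orbitMap τ) e
      rw [← stalkCast_mk e', stalkCast_germ]
      refine congrArg (EtaleSpace.mk _) ?_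
      exact (F.obj.presheaf.germ_res_apply (homOfLE inf_le_right) _ hy g).symm
  · refine (hval _ 0 h0 (Δ.orbitExp_zero τ)).trans ?_
    exact (stalkCast_mk _ _).symm

variable (Δ) in
/-- The functor of flat sections is the functor of stalks at the distinguished points. -/
noncomputable def stalkFunctorData : Δ.StalkFunctorData (eta Δ) where
  e F σ := (stalkAtEquiv F σ).toAddEquiv
  e_smul F σ c a := (map_smul (stalkAtEquiv F σ) c a).trans (flatModule_smul_one c _).symm
  e_natural {F G} g σ a := by
    change stalkAtEquiv G σ _ = flatMap g σ (stalkAtEquiv F σ a)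
    refine stalkAtEquiv_eq_iff.mpr ?_
    rw [flatMap_apply, stalkAtEquiv_apply_zero, ← stalkCast_map]
    refine congrArg _ ?_
    rw [stalkCast_stalkCast]
    rfl
  monodromy F σ γ a := by
    obtain ⟨l, w, hw⟩ := exists_lift_loop γ
    refine ⟨_, transport_translate γ w hw a, ?_⟩
    rw [mk_eq_periodClass γ w hw]
    exact (flatModule_smul_periodClass l _).trans
      (LinearEquiv.apply_symm_apply (stalkAtEquiv F σ) _).symm
  cospecialize F {τ σ} h a := by
    refine ⟨_, cospecialize_cosp h a, ?_⟩
    exact (LinearEquiv.apply_symm_apply (stalkAtEquiv F τ) _).symm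

end Fan

namespace Fan

variable {n : ℕ} {Δ : Fan n}

/-! ### The sheaf of a co-module -/

section CoModule

variable (M : CoModule Δ.B)

/-- The complex vector space underlying the module at `σ`. -/
def fibre (σ : Δ.Cone) : Type := M.obj (OrderDual.toDual σ)

noncomputable instance (σ : Δ.Cone) : AddCommGroup (fibre M σ) :=
  inferInstanceAs (AddCommGroup (M.obj (OrderDual.toDual σ)))

/-- The scalars in the group algebra. -/
noncomputable def scalarHom (σ : Δ.Cone) : ℂ →+* Δ.B.obj (op (OrderDual.toDual σ)) :=
  (MonoidAlgebra.singleOneRingHom :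
    ℂ →+* MonoidAlgebra ℂ (FundamentalGroup (Δ.Orbit σ) (Δ.basePoint σ)))

noncomputable instance (σ : Δ.Cone) : Module (Δ.B.obj (op (OrderDual.toDual σ))) (fibre M σ) :=
  inferInstanceAs (Module (Δ.B.obj (op (OrderDual.toDual σ))) (M.obj (OrderDual.toDual σ)))

noncomputable instance (σ : Δ.Cone) : Module ℂ (fibre M σ) :=
  Module.compHom (fibre M σ) (scalarHom σ)

theorem monomialB_mul (σ : Δ.Cone) (g h : FundamentalGroup (Δ.Orbit σ) (Δ.basePoint σ)) (c d : ℂ) :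
    Δ.monomialB σ g c * Δ.monomialB σ h d = Δ.monomialB σ (g * h) (c * d) :=
  MonoidAlgebra.single_mul_single ..

theorem monomialB_one (σ : Δ.Cone) : Δ.monomialB σ 1 1 = 1 := rfl

variable {M}

theorem fibre_smul {σ : Δ.Cone} (c : ℂ) (m : fibre M σ) : c • m = Δ.monomialB σ 1 c • m := rfl

variable (M) in
/-- The action of a period. -/
noncomputable def periodAct {σ : Δ.Cone} (l : periods σ.1) : fibre M σ →ₗ[ℂ] fibre M σ where
  toFun m := Δ.monomialB σ (Δ.periodClass σ l) 1 • m
  map_add' m m' := smul_add _ m m'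
  map_smul' c m := by
    rw [RingHom.id_apply, fibre_smul, fibre_smul, smul_smul, smul_smul, monomialB_mul,
      monomialB_mul, mul_one, one_mul, mul_one, one_mul]

theorem periodAct_apply {σ : Δ.Cone} (l : periods σ.1) (m : fibre M σ) :
    periodAct M l m = Δ.monomialB σ (Δ.periodClass σ l) 1 • m := rfl

theorem periodAct_add {σ : Δ.Cone} (l l' : periods σ.1) (m : fibre M σ) :
    periodAct M (l + l') m = periodAct M l (periodAct M l' m) := by
  rw [periodAct_apply, periodAct_apply, periodAct_apply, smul_smul, monomialB_mul, mul_one,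
    periodClass_add]

theorem periodAct_of_mem_spanC {σ : Δ.Cone} {l : periods σ.1} (hl : l.1 ∈ spanC σ.1)
    (m : fibre M σ) : periodAct M l m = m := by
  rw [periodAct_apply, periodClass_of_mem_spanC σ hl, monomialB_one, one_smul]

theorem periodAct_zero {σ : Δ.Cone} (m : fibre M σ) : periodAct M (0 : periods σ.1) m = m :=
  periodAct_of_mem_spanC (zero_mem _) m

theorem map_monomialB {τ σ : Δ.Cone} (h : τ ≤ σ)
    (g : FundamentalGroup (Δ.Orbit τ) (Δ.basePoint τ)) (c : ℂ) :
    (Δ.B.map (homOfLE (OrderDual.toDual_le_toDual.mpr h)).op).hom (Δ.monomialB τ g c) =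
      Δ.monomialB σ (Δ.pi1Map h g) c := MonoidAlgebra.mapDomain_single ..

theorem map_monomialB_smul {τ σ : Δ.Cone} (h : τ ≤ σ)
    (g : FundamentalGroup (Δ.Orbit τ) (Δ.basePoint τ)) (c : ℂ) (m : fibre M σ) :
    M.map (OrderDual.toDual_le_toDual.mpr h) (Δ.monomialB σ (Δ.pi1Map h g) c • m) =
      (Δ.monomialB τ g c • (M.map (OrderDual.toDual_le_toDual.mpr h) m : fibre M τ) : fibre M τ) :=
  (congrArg (fun r : Δ.B.obj (op (OrderDual.toDual σ)) =>
    M.map (OrderDual.toDual_le_toDual.mpr h) (r • m : fibre M σ)) (map_monomialB h g c)).symm.trans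
    (M.map_smul (OrderDual.toDual_le_toDual.mpr h) (Δ.monomialB τ g c) m)

variable (M) in
/-- The structure map of the co-module. -/
noncomputable def fibreMap {τ σ : Δ.Cone} (h : τ ≤ σ) : fibre M σ →ₗ[ℂ] fibre M τ where
  toFun m := M.map (OrderDual.toDual_le_toDual.mpr h) m
  map_add' m m' := (M.map (OrderDual.toDual_le_toDual.mpr h)).map_add m m'
  map_smul' c m := by
    have h1 := map_monomialB_smul h 1 c m
    rwa [map_one] at h1

theorem fibreMap_refl {σ : Δ.Cone} (m : fibre M σ) : fibreMap M le_rfl m = m := M.map_id _ m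

theorem fibreMap_fibreMap {ρ τ σ : Δ.Cone} (h : ρ ≤ τ) (h' : τ ≤ σ) (m : fibre M σ) :
    fibreMap M h (fibreMap M h' m) = fibreMap M (h.trans h') m :=
  M.map_comp (OrderDual.toDual_le_toDual.mpr h') (OrderDual.toDual_le_toDual.mpr h) m

theorem fibreMap_periodAct {τ σ : Δ.Cone} (h : τ ≤ σ) (l : periods τ.1) (m : fibre M σ) :
    fibreMap M h (periodAct M ⟨l.1, periods_mono h l.2⟩ m) = periodAct M l (fibreMap M h m) := by
  have h1 := map_monomialB_smul h (Δ.periodClass τ l) 1 m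
  rwa [pi1Map_periodClass] at h1

variable (M)

/-- The sections over `W` of the sheaf of a co-module: equivariant functions of the logarithmic
coordinates that are compatible with the structure maps near every point. -/
def coSections (W : Opens Δ.X) :
    Submodule ℂ (∀ σ : Δ.Cone, {w : Fin n → ℂ // Δ.expMap σ w ∈ W} → fibre M σ) where
  carrier := {u | (∀ (σ : Δ.Cone) (l : periods σ.1) (w w' : {w : Fin n → ℂ // Δ.expMap σ w ∈ W}),
      w'.1 = w.1 + l.1 → u σ w = periodAct M l (u σ w')) ∧
    -- For τ = σ this says that u is locally constant along the orbit.
    ∀ (τ σ : Δ.Cone) (h : τ ≤ σ) (z : {w : Fin n → ℂ // Δ.expMap σ w ∈ W}),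
      ∀ᶠ w in Δ.nearFilter τ σ z.1, ∃ hw : Δ.expMap τ w ∈ W, u τ ⟨w, hw⟩ = fibreMap M h (u σ z)}
  add_mem' := fun {u u'} hu hu' => by
    refine ⟨fun σ l w w' e => ?_, fun τ σ h z => ?_⟩
    · rw [Pi.add_apply, Pi.add_apply, Pi.add_apply, map_add, ← hu.1 σ l w w' e,
        ← hu'.1 σ l w w' e]
    · filter_upwards [hu.2 τ σ h z, hu'.2 τ σ h z] with w ⟨h1, h2⟩ ⟨_, h3⟩
      refine ⟨h1, ?_⟩
      rw [Pi.add_apply, Pi.add_apply, Pi.add_apply, Pi.add_apply, map_add, h2, h3]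
  zero_mem' := by
    refine ⟨fun σ l w w' e => ?_, fun τ σ h z => ?_⟩
    · exact (map_zero _).symm
    · filter_upwards [tendsto_expMap h z.1 (W.isOpen.mem_nhds z.2)] with w hw
      exact ⟨hw, (map_zero _).symm⟩
  smul_mem' := fun c u hu => by
    refine ⟨fun σ l w w' e => ?_, fun τ σ h z => ?_⟩
    · rw [Pi.smul_apply, Pi.smul_apply, Pi.smul_apply, map_smul, ← hu.1 σ l w w' e]
    · filter_upwards [hu.2 τ σ h z] with w ⟨h1, h2⟩
      refine ⟨h1, ?_⟩
      rw [Pi.smul_apply, Pi.smul_apply, Pi.smul_apply, Pi.smul_apply, map_smul, h2]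

/-- The restriction of sections. -/
def coRestrict {W W' : Opens Δ.X} (h : W ≤ W') : coSections M W' →ₗ[ℂ] coSections M W where
  toFun u := ⟨fun σ w => u.1 σ ⟨w.1, h w.2⟩,
    fun σ l w w' e => u.2.1 σ l ⟨w.1, h w.2⟩ ⟨w'.1, h w'.2⟩ e, fun τ σ hτ z => by
      filter_upwards [u.2.2 τ σ hτ ⟨z.1, h z.2⟩,
        tendsto_expMap hτ z.1 (W.isOpen.mem_nhds z.2)] with w ⟨_, h2⟩ hw
      exact ⟨hw, h2⟩⟩
  map_add' _ _ := rfl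
  map_smul' _ _ := rfl

/-- The presheaf of a co-module. -/
noncomputable def coPresheaf : TopCat.Presheaf (ModuleCat.{0} ℂ) Δ.X where
  obj W := ModuleCat.of ℂ (coSections M W.unop)
  map i := ModuleCat.ofHom (coRestrict M i.unop.le)
  map_id _ := rfl
  map_comp _ _ := rfl

/-- Both conditions on a function are local on X: equivariance relates logarithms of one point, and
compatibility at a point concerns only points near it. -/
theorem isSheaf_coPresheaf : (coPresheaf M).IsSheaf := by
  refine (TopCat.Presheaf.isSheaf_iff_isSheaf_comp (forget (ModuleCat.{0} ℂ)) _).mpr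
    (TopCat.Presheaf.isSheaf_of_isSheafUniqueGluing_types _ fun ι U sf hsf => ?_)
  have hsf' : ∀ (i j : ι) (σ : Δ.Cone) (w : Fin n → ℂ) (hi : Δ.expMap σ w ∈ U i)
      (hj : Δ.expMap σ w ∈ U j), (show coSections M (U i) from sf i).1 σ ⟨w, hi⟩ =
        (show coSections M (U j) from sf j).1 σ ⟨w, hj⟩ := fun i j σ w hi hj =>
    congrArg (fun u : coSections M (U i ⊓ U j) => u.1 σ ⟨w, ⟨hi, hj⟩⟩) (hsf i j)
  choose k hk using fun (σ : Δ.Cone) (w : {w : Fin n → ℂ // Δ.expMap σ w ∈ iSup U}) =>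
    Opens.mem_iSup.mp w.2
  let u : ∀ σ : Δ.Cone, {w : Fin n → ℂ // Δ.expMap σ w ∈ iSup U} → fibre M σ := fun σ w =>
    (show coSections M (U (k σ w)) from sf (k σ w)).1 σ ⟨w.1, hk σ w⟩
  have hu : ∀ (i : ι) (σ : Δ.Cone) (w : {w : Fin n → ℂ // Δ.expMap σ w ∈ iSup U})
      (hi : Δ.expMap σ w.1 ∈ U i), u σ w = (show coSections M (U i) from sf i).1 σ ⟨w.1, hi⟩ :=
    fun i σ w hi => hsf' _ _ _ _ _ _
  have hmem : u ∈ coSections M (iSup U) := by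
    refine ⟨fun σ l w w' e => ?_, fun τ σ h z => ?_⟩
    · have hi : Δ.expMap σ w'.1 ∈ U (k σ w) := by
        rw [e, expMap_add_period]
        exact hk σ w
      rw [hu (k σ w) σ w (hk σ w), hu (k σ w) σ w' hi]
      exact (show coSections M (U (k σ w)) from sf (k σ w)).2.1 σ l _ _ e
    · filter_upwards [(show coSections M (U (k σ z)) from sf (k σ z)).2.2 τ σ h ⟨z.1, hk σ z⟩]
        with w ⟨h1, h2⟩
      exact ⟨Opens.mem_iSup.mpr ⟨_, h1⟩, (hu (k σ z) τ ⟨w, _⟩ h1).trans h2⟩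
  refine ⟨(⟨u, hmem⟩ : coSections M (iSup U)), fun i => ?_, fun v hv => ?_⟩
  · exact (Subtype.ext (funext fun σ => funext fun w => hu i σ ⟨w.1, _⟩ w.2) :
      coRestrict M (le_iSup U i) ⟨u, hmem⟩ = (show coSections M (U i) from sf i))
  · refine (Subtype.ext (funext fun σ => funext fun w => ?_) :
      (show coSections M (iSup U) from v) = ⟨u, hmem⟩)
    exact congrArg (fun u : coSections M (U (k σ w)) => u.1 σ ⟨w.1, hk σ w⟩) (hv (k σ w))

/-- The sheaf of a co-module. -/
noncomputable def coSheaf : TopCat.Sheaf (ModuleCat.{0} ℂ) Δ.X := ⟨coPresheaf M, isSheaf_coPresheaf M⟩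

end CoModule

end Fan

/-! ### Stalks of the sheaf of a co-module and essential surjectivity -/

namespace Fan

open TopCat.Presheaf

variable {n : ℕ} {Δ : Fan n} (M : CoModule Δ.B)

theorem intPeriod_zero : intPeriod (0 : Fin n → ℤ) = 0 := by
  ext i
  simp [intPeriod]

theorem mem_nearSet_self {σ : Δ.Cone} {z w : Fin n → ℂ} {A : Finset (Fin n → ℤ)} {δ : ℝ}
    (hw : w ∈ Metric.ball z δ) : w ∈ Δ.nearSet σ σ z A δ :=
  ⟨⟨0, zero_mem _, by rwa [sub_zero]⟩, fun _ _ h1 h2 => (h2 h1).elim⟩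

/-- Differences of points of a small basic set by periods lie in the span. -/
theorem sub_mem_spanC_of_nearSet {τ σ : Δ.Cone} (h : τ ≤ σ) {z : Fin n → ℂ} {δ ε : ℝ}
    (hε : ∀ l ∈ periods σ.1, ‖l‖ < ε → l ∈ spanC σ.1) (hδ : 2 * δ ≤ ε) {w w' : Fin n → ℂ}
    (hw : w ∈ Δ.nearSet τ σ z ∅ δ) (hw' : w' ∈ Δ.nearSet τ σ z ∅ δ) (hl : w - w' ∈ periods τ.1) :
    w - w' ∈ spanC σ.1 := by
  obtain ⟨⟨k, hk, hkw⟩, -⟩ := hw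
  obtain ⟨⟨k', hk', hkw'⟩, -⟩ := hw'
  have e : w - k - (w' - k') = w - w' - (k - k') := by abel
  have h1 : (w - k) - (w' - k') ∈ spanC σ.1 := by
    refine hε _ ?_ ?_
    · rw [e]
      exact sub_mem (periods_mono h hl) (mem_periods_of_mem_spanC ((spanC σ.1).sub_mem hk hk'))
    · have h2 := dist_triangle_right (w - k) (w' - k') z
      rw [dist_eq_norm (w - k) (w' - k')] at h2
      rw [Metric.mem_ball] at hkw hkw'
      linarith
  have h2 := add_mem h1 ((spanC σ.1).sub_mem hk hk')
  rwa [e, sub_add_cancel] at h2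

/-- Elements of the module at `σ` extend to sections near the points of `O_σ`. -/
theorem exists_coSections (σ : Δ.Cone) (z : Fin n → ℂ) :
    ∃ (W : Opens Δ.X) (δ : ℝ) (c : fibre M σ →ₗ[ℂ] coSections M W), 0 < δ ∧
      ∀ w ∈ Metric.ball z δ, ∃ hw : Δ.expMap σ w ∈ W, ∀ m, (c m).1 σ ⟨w, hw⟩ = m := by
  obtain ⟨S, hS⟩ := Δ.exists_generators σ
  obtain ⟨ε, hε, hεl⟩ := exists_pos_mem_spanC hS
  have hδ : 0 < ε / 2 := half_pos hε
  have hδε : 2 * (ε / 2) ≤ ε := by linarith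
  obtain ⟨B, hB⟩ := exists_opens_nearSet σ z ∅ (by simp) hδ
  have hle : ∀ (τ : Δ.Cone) (w : {w : Fin n → ℂ // Δ.expMap τ w ∈ B}), τ ≤ σ :=
    fun τ w => ((hB τ w.1).mp w.2).1
  -- A logarithm of a point of `B` lies in the near set only after a translation by some integral
  -- period. The section takes the image of m there, and equivariance dictates its value at w.
  choose ν hν using fun (τ : Δ.Cone) (w : {w : Fin n → ℂ // Δ.expMap τ w ∈ B}) =>
    ((hB τ w.1).mp w.2).2
  let p : ∀ τ : Δ.Cone, {w : Fin n → ℂ // Δ.expMap τ w ∈ B} → periods τ.1 :=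
    fun τ w => ⟨intPeriod (ν τ w), intPeriod_mem_periods _⟩
  -- Two admissible translations differ by a period of O_τ in `spanC σ`; it acts trivially on M_σ,
  -- hence on the image of m, so the value does not depend on the choice of ν.
  have key : ∀ (τ : Δ.Cone) (w : {w : Fin n → ℂ // Δ.expMap τ w ∈ B}) (l : periods τ.1),
      w.1 - l.1 ∈ Δ.nearSet τ σ z ∅ (ε / 2) → ∀ m : fibre M σ,
        periodAct M (-p τ w) (fibreMap M (hle τ w) m) =
          periodAct M (-l) (fibreMap M (hle τ w) m) := fun τ w l hl m => by
    have e : w.1 - l.1 - (w.1 - (p τ w).1) = (p τ w - l).1 := by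
      change _ = (p τ w).1 - l.1
      abel
    have h1 := sub_mem_spanC_of_nearSet (hle τ w) hεl hδε hl (hν τ w) (by
      change w.1 - l.1 - (w.1 - (p τ w).1) ∈ _
      rw [e]
      exact (p τ w - l).2)
    change w.1 - l.1 - (w.1 - (p τ w).1) ∈ _ at h1
    rw [e] at h1
    have h2 : -l = -p τ w + (p τ w - l) := by abel
    rw [h2, periodAct_add, ← fibreMap_periodAct (hle τ w) (p τ w - l),
      periodAct_of_mem_spanC (l := ⟨(p τ w - l).1, periods_mono (hle τ w) (p τ w - l).2⟩) h1]
  have hmem : ∀ m : fibre M σ, (fun τ w => periodAct M (-p τ w) (fibreMap M (hle τ w) m)) ∈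
      coSections M B := fun m => by
    refine ⟨fun τ l w w' e => ?_, fun ρ τ hρ w => ?_⟩
    · have h1 : w'.1 - (p τ w + l).1 ∈ Δ.nearSet τ σ z ∅ (ε / 2) := by
        have e' : w'.1 - (p τ w + l).1 = w.1 - intPeriod (ν τ w) := by
          change _ - (intPeriod (ν τ w) + l.1) = _
          rw [e]
          abel
        rw [e']
        exact hν τ w
      have h2 : -p τ w = l + -(p τ w + l) := by abel
      change periodAct M (-p τ w) (fibreMap M (hle τ w) m) =
        periodAct M l (periodAct M (-p τ w') (fibreMap M (hle τ w') m))
      rw [key τ w' _ h1, ← periodAct_add, ← h2]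
    -- Near w the same translation is admissible for the points of O_ρ, so by `key` the
    -- compatibility reduces to functoriality and equivariance of the structure maps.
    · obtain ⟨δ', hδ', hsub⟩ := exists_nearSet_subset (ρ := ρ) (hle τ w) hδ (hν τ w)
      have h1 : ∀ᶠ w' in Δ.nearFilter ρ τ (w.1 - intPeriod (ν τ w)),
          w' ∈ Δ.nearSet ρ σ z ∅ (ε / 2) := ⟨∅, by simp, δ', hδ', hsub⟩
      have h2 := nearFilter_translate (intPeriod_mem_periods (σ := ρ.1) (ν τ w)) h1
      rw [sub_add_cancel] at h2
      filter_upwards [h2] with w' hw'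
      have hB' : Δ.expMap ρ w' ∈ B := (hB ρ w').mpr ⟨hρ.trans (hle τ w), _, hw'⟩
      refine ⟨hB', ?_⟩
      rw [key ρ ⟨w', hB'⟩ ⟨intPeriod (ν τ w), intPeriod_mem_periods _⟩ hw',
        ← fibreMap_fibreMap hρ (hle τ w), ← fibreMap_periodAct hρ]
      rfl
  refine ⟨B, ε / 2, LinearMap.codRestrict (coSections M B) (LinearMap.pi fun τ => LinearMap.pi
    fun w => periodAct M (-p τ w) ∘ₗ fibreMap M (hle τ w)) hmem, hδ, fun w hw => ?_⟩
  have hw' := mem_nearSet_self (Δ := Δ) (σ := σ) (A := ∅) hw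
  have hB' : Δ.expMap σ w ∈ B := (hB σ w).mpr ⟨le_rfl, 0, by rwa [intPeriod_zero, sub_zero]⟩
  refine ⟨hB', fun m => ?_⟩
  refine (key σ ⟨w, hB'⟩ 0 (by simpa using hw') m).trans ?_
  rw [neg_zero, periodAct_zero, fibreMap_refl]

/-- Equal values at z propagate along the structure maps to the nearby points of every orbit, and by
equivariance to all their logarithms. -/
theorem coPresheaf_germ_eq_iff {W W' : Opens Δ.X} {σ : Δ.Cone} {z : Fin n → ℂ}
    (hW : Δ.expMap σ z ∈ W) (hW' : Δ.expMap σ z ∈ W') (u : coSections M W) (u' : coSections M W') :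
    (coPresheaf M).germ W (Δ.expMap σ z) hW u = (coPresheaf M).germ W' (Δ.expMap σ z) hW' u' ↔
      u.1 σ ⟨z, hW⟩ = u'.1 σ ⟨z, hW'⟩ := by
  constructor
  · intro h
    obtain ⟨U, hU, i, i', hi⟩ := (coPresheaf M).germ_eq _ hW hW' u u' h
    exact congrArg (fun v : coSections M U => v.1 σ ⟨z, hU⟩) hi
  · intro h
    have hnear : {x : Δ.X | ∀ τ w, Δ.expMap τ w = x → ∃ (h : Δ.expMap τ w ∈ W)
        (h' : Δ.expMap τ w ∈ W'), u.1 τ ⟨w, h⟩ = u'.1 τ ⟨w, h'⟩} ∈ nhds (Δ.expMap σ z) := by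
      refine mem_nhds_expMap_iff.mpr fun τ hτ => ?_
      filter_upwards [u.2.2 τ σ hτ ⟨z, hW⟩, u'.2.2 τ σ hτ ⟨z, hW'⟩] with w ⟨h1, h2⟩ ⟨h3, h4⟩
      intro τ' w' e
      obtain rfl := Δ.cone_eq_of_expMap_eq e
      have hl := Δ.expMap_eq_iff.mp e.symm
      have e' : w = w' + (w - w') := (add_sub_cancel w' w).symm
      have h5 : Δ.expMap τ' w' ∈ W := e ▸ h1
      have h6 : Δ.expMap τ' w' ∈ W' := e ▸ h3
      refine ⟨h5, h6, ?_⟩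
      rw [u.2.1 τ' ⟨_, hl⟩ ⟨w', h5⟩ ⟨w, h1⟩ e', u'.2.1 τ' ⟨_, hl⟩ ⟨w', h6⟩ ⟨w, h3⟩ e', h2, h4, h]
    obtain ⟨N, hN, hNo, hzN⟩ := mem_nhds_iff.mp hnear
    have hNW : (⟨N, hNo⟩ : Opens Δ.X) ≤ W := fun x hx => by
      obtain ⟨τ, w, rfl⟩ := Δ.exists_expMap_eq x
      exact (hN hx τ w rfl).1
    have hNW' : (⟨N, hNo⟩ : Opens Δ.X) ≤ W' := fun x hx => by
      obtain ⟨τ, w, rfl⟩ := Δ.exists_expMap_eq x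
      exact (hN hx τ w rfl).2.1
    have hres : coRestrict M hNW u = coRestrict M hNW' u' :=
      Subtype.ext (funext fun τ => funext fun w => (hN w.2 τ w.1 rfl).2.2)
    refine ((coPresheaf M).germ_res_apply (homOfLE hNW) _ hzN u).symm.trans (Eq.trans ?_
      ((coPresheaf M).germ_res_apply (homOfLE hNW') _ hzN u'))
    exact congrArg ((coPresheaf M).germ (⟨N, hNo⟩ : Opens Δ.X) _ hzN) hres

/-- The germ at `exp(w) • x_σ` with a given value. -/
noncomputable def coGerm (σ : Δ.Cone) (w : Fin n → ℂ) :
    fibre M σ →ₗ[ℂ] (coPresheaf M).stalk (Δ.expMap σ w) :=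
  ((coPresheaf M).germ (exists_coSections M σ w).choose (Δ.expMap σ w)
    ((exists_coSections M σ w).choose_spec.choose_spec.choose_spec.2 w
      (Metric.mem_ball_self (exists_coSections M σ w).choose_spec.choose_spec.choose_spec.1)).choose).hom.comp
    (exists_coSections M σ w).choose_spec.choose_spec.choose

theorem germ_eq_coGerm {W : Opens Δ.X} {σ : Δ.Cone} {w : Fin n → ℂ} (hW : Δ.expMap σ w ∈ W)
    (u : coSections M W) :
    (coPresheaf M).germ W (Δ.expMap σ w) hW u = coGerm M σ w (u.1 σ ⟨w, hW⟩) := by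
  refine (coPresheaf_germ_eq_iff M _ _ u _).mpr ?_
  exact (((exists_coSections M σ w).choose_spec.choose_spec.choose_spec.2 w (Metric.mem_ball_self
    (exists_coSections M σ w).choose_spec.choose_spec.choose_spec.1)).choose_spec _).symm

theorem exists_coSection_eq (σ : Δ.Cone) (w : Fin n → ℂ) (m : fibre M σ) :
    ∃ (W : Opens Δ.X) (hW : Δ.expMap σ w ∈ W) (u : coSections M W), u.1 σ ⟨w, hW⟩ = m := by
  obtain ⟨W, δ, c, hδ, h⟩ := exists_coSections M σ w
  obtain ⟨hW, h⟩ := h w (Metric.mem_ball_self hδ)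
  exact ⟨W, hW, c m, h m⟩

theorem coGerm_bijective (σ : Δ.Cone) (w : Fin n → ℂ) : Function.Bijective (coGerm M σ w) := by
  constructor
  · intro m m' h
    obtain ⟨W, hW, u, rfl⟩ := exists_coSection_eq M σ w m
    obtain ⟨W', hW', u', rfl⟩ := exists_coSection_eq M σ w m'
    rw [← germ_eq_coGerm, ← germ_eq_coGerm, coPresheaf_germ_eq_iff] at h
    exact h
  · intro a
    obtain ⟨W, hW, u, rfl⟩ := (coPresheaf M).exists_germ_eq a
    exact ⟨_, (germ_eq_coGerm M hW u).symm⟩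

/-- The sections extending elements of M_σ form a linear family whose germs at the points of O_σ
near a given one are all the germs, each once. -/
theorem isLC_coSheaf : Δ.isLC (coSheaf M) := by
  intro σ
  refine isLocallyConstantSheaf_pullback (TopCat.ofHom (Δ.orbitMap σ)) (coSheaf M) fun y => ?_
  obtain ⟨z, rfl⟩ := Δ.exists_orbitExp_eq y
  obtain ⟨W, δ, c, hδ, h⟩ := exists_coSections M σ z
  refine ⟨⟨Δ.orbitExp σ '' Metric.ball z δ, Δ.isOpenMap_orbitExp σ _ Metric.isOpen_ball⟩, W,
    ModuleCat.of ℂ (fibre M σ), ModuleCat.ofHom c, ⟨z, Metric.mem_ball_self hδ, rfl⟩, ?_⟩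
  rintro _ ⟨w, hw, rfl⟩
  obtain ⟨hW, h⟩ := h w hw
  refine ⟨hW, ?_⟩
  have : (fun m => (coPresheaf M).germ W (Δ.expMap σ w) hW (c m)) = coGerm M σ w :=
    funext fun m => by rw [germ_eq_coGerm, h]
  have h2 := coGerm_bijective M σ w
  rw [← this] at h2
  exact h2

/-- The object of `LC(X)` of a co-module. -/
noncomputable def coLC : Δ.LC := ⟨coSheaf M, isLC_coSheaf M⟩

/-- The flat section with a given value. -/
noncomputable def coFlat (σ : Δ.Cone) : fibre M σ →ₗ[ℂ] flat (coLC M) σ :=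
  LinearMap.codRestrict (flat (coLC M) σ) (LinearMap.pi fun w => coGerm M σ w) fun m w => by
    obtain ⟨W, hW, u, hu⟩ := exists_coSection_eq M σ w m
    refine ⟨W, hW, u, ?_⟩
    filter_upwards [nhds_le_nearFilter σ w (u.2.2 σ σ le_rfl ⟨w, hW⟩)] with w' ⟨h1, h2⟩
    refine ⟨h1, Eq.trans ?_ (germ_eq_coGerm M h1 u).symm⟩
    rw [h2, hu, fibreMap_refl]
    rfl

theorem coFlat_apply (σ : Δ.Cone) (m : fibre M σ) (w : Fin n → ℂ) :
    (coFlat M σ m).1 w = coGerm M σ w m := rfl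

theorem coFlat_bijective (σ : Δ.Cone) : Function.Bijective (coFlat M σ) := by
  have h : Function.Bijective (flatEval (coLC M) σ 0 ∘ coFlat M σ) := coGerm_bijective M σ 0
  exact (Function.Bijective.of_comp_iff' (flatEval (coLC M) σ 0).bijective _).mp h

theorem coFlat_periodAct {σ : Δ.Cone} (l : periods σ.1) (m : fibre M σ) :
    coFlat M σ (periodAct M l m) = translate (coLC M) l (coFlat M σ m) := by
  refine Subtype.ext (funext fun w => ?_)
  obtain ⟨W, hW, u, rfl⟩ := exists_coSection_eq M σ (w + l.1) m
  have e := expMap_add_period l w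
  rw [translate_apply _ _ _ e, coFlat_apply, coFlat_apply, ← germ_eq_coGerm,
    ← u.2.1 σ l ⟨w, e ▸ hW⟩ ⟨w + l.1, hW⟩ rfl, ← germ_eq_coGerm]
  exact (stalkCast_germ (P := coPresheaf M) e hW u).symm

theorem coFlat_fibreMap {τ σ : Δ.Cone} (h : τ ≤ σ) (m : fibre M σ) :
    coFlat M τ (fibreMap M h m) = cosp (coLC M) h (coFlat M σ m) := by
  obtain ⟨W, hW, u, rfl⟩ := exists_coSection_eq M σ 0 m
  refine (cosp_eq h (z := 0) ⟨W, hW, u, germ_eq_coGerm M hW u, ?_⟩).symm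
  filter_upwards [u.2.2 τ σ h ⟨0, hW⟩] with w ⟨h1, h2⟩
  refine ⟨h1, Eq.trans ?_ (germ_eq_coGerm M h1 u).symm⟩
  rw [h2]
  rfl

theorem coFlat_smul {σ : Δ.Cone}
    (r : MonoidAlgebra ℂ (FundamentalGroup (Δ.Orbit σ) (Δ.basePoint σ))) (m : fibre M σ) :
    coFlat M σ ((show Δ.B.obj (op (OrderDual.toDual σ)) from r) • m) =
      monodromyHom (coLC M) σ r (coFlat M σ m) := by
  induction r using MonoidAlgebra.induction_linear with
  | zero =>
    rw [map_zero, LinearMap.zero_apply, ← map_zero (coFlat M σ)]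
    exact congrArg _ (zero_smul (Δ.B.obj (op (OrderDual.toDual σ))) m)
  | add r r' h h' =>
    rw [map_add, LinearMap.add_apply, ← h, ← h', ← map_add]
    exact congrArg _ (add_smul (show Δ.B.obj (op (OrderDual.toDual σ)) from r)
      (show Δ.B.obj (op (OrderDual.toDual σ)) from r') m)
  | single g c =>
    obtain ⟨l, rfl⟩ := periodClass_surjective σ g
    rw [monodromyHom_single, monodromyRep_periodClass, ← coFlat_periodAct, ← map_smul]
    refine congrArg _ ?_
    rw [periodAct_apply, fibre_smul, smul_smul, monomialB_mul, one_mul, mul_one]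
    rfl

/-- The map from a co-module to the flat sections of its sheaf. -/
noncomputable def coHom (σ : Δ.Coneᵒᵈ) : M.obj σ ⟶ flatModule (coLC M) σ :=
  ModuleCat.ofHom (X := M.obj σ) (Y := flatModule (coLC M) σ)
    { toFun := fun m => coFlat M (OrderDual.ofDual σ) m
      map_add' := fun m m' => (coFlat M (OrderDual.ofDual σ)).map_add m m'
      map_smul' := fun r m => coFlat_smul M (σ := OrderDual.ofDual σ) r m }

/-- The comparison of a co-module with the flat sections of its sheaf. -/
noncomputable def coEquiv (σ : Δ.Coneᵒᵈ) :
    M.obj σ ≃ₗ[Δ.B.obj (op σ)] flatModule (coLC M) σ :=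
  LinearEquiv.ofBijective (coHom M σ).hom (coFlat_bijective M (OrderDual.ofDual σ))

theorem coEquiv_map {α β : Δ.Coneᵒᵈ} (h : α ≤ β) (m : M.obj α) :
    coEquiv M β (M.map h m) = (etaObj (coLC M)).map h (coEquiv M α m) :=
  coFlat_fibreMap M (OrderDual.ofDual_le_ofDual.mpr h) m

/-- The co-module of the sheaf of a co-module. -/
noncomputable def coIso : (eta Δ).obj (coLC M) ≅ M where
  hom :=
    { app := fun σ => ModuleCat.ofHom (X := flatModule (coLC M) σ) (Y := M.obj σ)
        (coEquiv M σ).symm.toLinearMap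
      naturality := fun {α β} h m => by
        obtain ⟨m, rfl⟩ := (coEquiv M α).surjective m
        refine (congrArg (coEquiv M β).symm (coEquiv_map M h m)).symm.trans ?_
        exact ((coEquiv M β).symm_apply_apply _).trans
          (congrArg (M.map h) ((coEquiv M α).symm_apply_apply m).symm) }
  inv :=
    { app := fun σ => coHom M σ
      naturality := fun h m => coEquiv_map M h m }
  hom_inv_id := CoModule.Hom.ext (funext fun σ => ModuleCat.hom_ext (LinearMap.ext fun s =>
    (coEquiv M σ).apply_symm_apply s))
  inv_hom_id := CoModule.Hom.ext (funext fun σ => ModuleCat.hom_ext (LinearMap.ext fun s =>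
    (coEquiv M σ).symm_apply_apply s))

instance : (eta Δ).EssSurj where
  mem_essImage M := ⟨coLC M, ⟨coIso M⟩⟩

end Fan

theorem mainTheorem8 (n : ℕ) (Δ : Fan n) :
    ∃ η : Δ.LC ⥤ CoModule Δ.B, Nonempty (Δ.StalkFunctorData η) ∧ η.IsEquivalence :=
  -- The empty structure collects the instances of faithfulness, fullness and essential
  -- surjectivity.
  ⟨Fan.eta Δ, ⟨Fan.stalkFunctorData Δ⟩, { }⟩
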